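/- Let $\Omega\subset\mathbb R^2$ be a bounded strictly convex domain (open set) whose boundary is a smooth ($C^\infty$) closed curve of strictly positive curvature, and let $\ell=|\partial\Omega|$ be its length. Fix an $\ell$-periodic counterclockwise arclength parametrization $\gamma:\mathbb R\to\partial\Omega$. For $x,y\in\Omega$, a broken geodesic of $j$ reflections from $x$ to $y$ is a polygonal path with successive vertices $x,q_1,\dots,q_j,y$, where $q_1,\dots,q_j\in\partial\Omega$, each open link lies in $\Omega$, and at each $q_k$ the path is reflected elastically (angle of incidence equals angle of reflection). Let $q_{j+1}\in\partial\Omega$ be the point where its last link, continued beyond $y$, meets the boundary. Choose $s_1<\dots<s_{j+1}$ with $\gamma(s_k)=q_k$ and $0<s_{k+1}-s_k<\ell$; that is, $s_{k+1}$ is the first coordinate of the $k$-th iterate, started at $s_1$, of the lift of the billiard map to the universal cover. The path makes approximately one counterclockwise rotation if $$|s_{j+1}-s_1-\ell|\le \ell/100 .$$ Approximately one clockwise rotation is defined in the same way, with $\gamma$ replaced by the reversed parametrization $t\mapsto\gamma(-t)$. Theorem (8 Orbit Theorem). There exists a constant $C_0>0$, and for every $\Omega$ as above there exists $j_0=j_0(\Omega)\in\mathbb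 N$, such that the following holds for all $j\ge j_0$. Let $x,y\in\Omega$ be any two interior points such that $(x,y)$ is at distance at most $C_0/j^4$ from the diagonal $\{(q,q):q\in\partial\Omega\}$ of the boundary in $\mathbb R^2\times\mathbb R^2$. Then there are exactly four distinct broken geodesics of $j$ reflections from $x$ to $y$ making approximately one counterclockwise rotation, and exactly four making approximately one clockwise rotation. -/

import Mathlib

open scoped ContDiff

/-- The Euclidean plane. -/
abbrev Plane : Type := EuclideanSpace ℝ (Fin 2)

/-- The signed area of the parallelogram spanned by `u` and `v`. -/
def cross (u v : Plane) : ℝ := u 0 * v 1 - u 1 * v 0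

/-- `γ` is a smooth counterclockwise arclength parametrization of the boundary of `Ω`, of total
length `ℓ`: it is `ℓ`-periodic, and simple over one period.  The signed curvature of a unit speed
curve is `cross γ' γ''`; it is required to be positive everywhere.  For a convex `Ω` this makes `γ`
run counterclockwise. -/
structure IsBoundaryParametrization (Ω : Set Plane) (ℓ : ℝ) (γ : ℝ → Plane) : Prop where
  length_pos : 0 < ℓ
  smooth : ContDiff ℝ ∞ γ
  unit_speed : ∀ t, ‖deriv γ t‖ = 1
  eq_iff : ∀ s t, γ s = γ t ↔ ∃ k : ℤ, t = s + k * ℓ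
  range_eq : Set.range γ = frontier Ω
  curvature_pos : ∀ t, 0 < cross (deriv γ t) (deriv (deriv γ) t)

/-- A bounded (strictly) convex planar domain whose boundary is a smooth closed curve of strictly
positive curvature. -/
structure IsSmoothStrictlyConvexDomain (Ω : Set Plane) : Prop where
  isOpen : IsOpen Ω
  convex : Convex ℝ Ω
  bounded : Bornology.IsBounded Ω
  smooth_boundary : ∃ (ℓ : ℝ) (γ : ℝ → Plane), IsBoundaryParametrization Ω ℓ γ

/-- The point `(x, y)` of `ℝ² × ℝ² = ℝ⁴` is at Euclidean distance at most `r` from the diagonal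
`{(q, q) : q ∈ ∂Ω}` of the boundary (the distance is attained, as `∂Ω` is compact). -/
def NearBoundaryDiagonal (Ω : Set Plane) (r : ℝ) (x y : Plane) : Prop :=
  ∃ q ∈ frontier Ω, Real.sqrt (dist x q ^ 2 + dist y q ^ 2) ≤ r

/-- Elastic reflection at `p` off a line of direction `T`: the outgoing unit vector, from `p`
towards `b`, is the mirror image of the incoming unit vector, from `a` towards `p`, in the line
spanned by `T`. -/
def ReflectsAt (T a p b : Plane) : Prop :=
  ‖b - p‖⁻¹ • (b - p) = (Submodule.span ℝ {T}).reflection (‖p - a‖⁻¹ • (p - a))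

/-- `p 0 = x, p 1, …, p j, p (j + 1) = y` are the successive vertices of a broken geodesic (billiard
orbit) of `j` reflections in `Ω`, emanating from `x` and terminating at `y`: every link runs inside
`Ω`, and `p 1, …, p j` are boundary points at which the path is reflected elastically. -/
structure IsBrokenGeodesic (Ω : Set Plane) (γ : ℝ → Plane) (j : ℕ) (x y : Plane)
    (p : Fin (j + 2) → Plane) : Prop where
  start : p 0 = x
  finish : p (Fin.last (j + 1)) = y
  link : ∀ k : Fin (j + 1), openSegment ℝ (p k.castSucc) (p k.succ) ⊆ Ω
  reflection : ∀ k : Fin j, ∃ t : ℝ, γ t = p k.succ.castSucc ∧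
    ReflectsAt (deriv γ t) (p k.castSucc.castSucc) (p k.succ.castSucc) (p k.succ.succ)

/-- The broken geodesic with vertices `p 0, …, p (j + 1)` makes approximately one rotation in the
direction in which `γ` runs.

Here `s 0, …, s j` are lifts to `ℝ` of the arclength coordinates of the successive impact points
`p 1, …, p j` and of the next impact point, at which the orbit arrives at the boundary when its
last link is continued beyond `p (j + 1)`.  The lift of the billiard map to the universal cover
that is continuous and fixes grazing directions advances the arclength coordinate by an amount in
`(0, ℓ)`, so `s k` is the first coordinate of its `k`-th iterate at `s 0`.  The total advance
over these `j` iterations must equal the length `ℓ` of the boundary, up to `ℓ / 100`. -/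
def ApproxOneRotation (ℓ : ℝ) (γ : ℝ → Plane) (j : ℕ) (p : Fin (j + 2) → Plane) : Prop :=
  ∃ s : Fin (j + 1) → ℝ,
    (∀ k : Fin j, γ (s k.castSucc) = p k.succ.castSucc) ∧
    p (Fin.last (j + 1)) ∈ openSegment ℝ (p (Fin.last j).castSucc) (γ (s (Fin.last j))) ∧
    (∀ k : Fin j, 0 < s k.succ - s k.castSucc ∧ s k.succ - s k.castSucc < ℓ) ∧
    |s (Fin.last j) - s 0 - ℓ| ≤ ℓ / 100

/-- The broken geodesics of `j` reflections from `x` to `y` that make approximately one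
counterclockwise rotation, as sequences of vertices. -/
def counterclockwiseOrbits (Ω : Set Plane) (ℓ : ℝ) (γ : ℝ → Plane) (j : ℕ) (x y : Plane) :
    Set (Fin (j + 2) → Plane) :=
  {p | IsBrokenGeodesic Ω γ j x y p ∧ ApproxOneRotation ℓ γ j p}

/-- The broken geodesics of `j` reflections from `x` to `y` that make approximately one clockwise
rotation; the boundary is now run through in the opposite direction. -/
def clockwiseOrbits (Ω : Set Plane) (ℓ : ℝ) (γ : ℝ → Plane) (j : ℕ) (x y : Plane) :
    Set (Fin (j + 2) → Plane) :=
  {p | IsBrokenGeodesic Ω γ j x y p ∧ ApproxOneRotation ℓ (fun t => γ (-t)) j p}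

/-!
A billiard path of `j` bounces that goes about once around has all its links of length of order
`e = 1 / j` (`exists_gap_bounds`): the logarithms of consecutive short gaps differ by at most a
constant times the gaps themselves, so over a turn all gaps remain comparable.  In this regime the
*action* of a link, arc minus chord, is almost a universal function of its endpoints.  In the
Lazutkin parameter `u = ∫ κ ^ (2 / 3)`, a link from `u` to `u + Δ` has action
`Δ ^ 3 / 24 + Δ ^ 4 Q (u, Δ)` with `Q` smooth (`exists_action_expansion`), so the gradient of the
action is strongly monotone up to errors of higher order (`exists_action_monotone`).

**At most four.**  Let `x` and `y` lie within `e ^ 4` of the boundary point `γ σ`.  A line which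
crosses the boundary at an angle of order `e` and passes through `x` has one of its two ends within
`e ^ 3` of `γ σ`.  Hence the distance from `x` to the first bounce is either at most of order `e ^ 3`
(a *short* end) or of order `e` (a *long* end), with nothing in between, and likewise at `y`
(`exists_end_classification`).  This sorts the paths into four classes, and each contains at most
one path (`exists_connecting_unique`).  Pair the difference `ξ` of two paths of one class, in the
Lazutkin parameter, with the difference of the gradients of their actions.  The terms at the bounces
cancel by the reflection law, the links contribute at least a multiple of
`e ∑ (ξ (k + 1) - ξ k) ^ 2`, up to a higher order error, and only the two ends remain.  At a long end
the contribution has a sign (`exists_endAction_long`); at a short end the direction of the nearby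
point turns so fast with the bounce that the bounce is pinned (`exists_endAction_short`).  A discrete
Poincaré inequality absorbs the error and gives `ξ = 0` (`eq_zero_of_discrete_monotone`).

**At least four.**  Shoot from `x` at the boundary point `γ b`, and follow the billiard map.  If `b`
is at distance of order `e ^ 2` from `σ`, the angle is so small that the path turns by an amount of
order `e` only; if `x` is seen from `γ b` along the normal, or if `b` is a large multiple of `e`
beyond `σ`, it makes more than a full turn (`exists_shooting_range`).  On each of the two branches
in between, the next to last and the last impact pass, continuously, over `γ (σ + ℓ)`.  The point `y`
is on the inner side of the last chord while that chord has not reached `γ (σ + ℓ)`, on the outer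
side when `γ (σ + ℓ)` is under the middle of the chord, and on the inner side again afterwards, so
that the chord passes through `y` twice (`exists_two_zeros`, `exists_two_connecting`).

The counts hold for `x` and `y` within `e ^ 4` of a boundary point, so that the constant is `1`.
Since the threshold for `j` has to be found before the parametrization is given, it is taken from
one particular parametrization: all others are translates of it, being solutions of one
differential equation (`exists_eq_comp_add`).  A reflection of the plane exchanges the clockwise and
the counterclockwise paths (`mem_clockwiseOrbits_iff`).
-/

open Set Filter MeasureTheory
open scoped Topology

/-! ### Smooth dependence and Hadamard's lemma -/

/-- Smooth dependence of an integral over `[0, 1]` on a parameter. -/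
theorem contDiff_intervalIntegral_param {E F : Type} [NormedAddCommGroup E] [NormedSpace ℝ E]
    [FiniteDimensional ℝ E]
    [NormedAddCommGroup F] [NormedSpace ℝ F] [CompleteSpace F] (n : ℕ) (f : E × ℝ → F)
    (hf : ContDiff ℝ n f) : ContDiff ℝ n (fun x : E => ∫ t in (0 : ℝ)..1, f (x, t)) := by
  have key : ∀ (n : ℕ) (F : Type) [NormedAddCommGroup F] [NormedSpace ℝ F] [CompleteSpace F]
      (f : E × ℝ → F), ContDiff ℝ n f →
      ContDiff ℝ n (fun x : E => ∫ t in (0 : ℝ)..1, f (x, t)) := by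
    intro n
    induction n with
    | zero =>
      intro F _ _ _ f hf
      have hc : Continuous f := hf.continuous
      simp only [Nat.cast_zero, contDiff_zero]
      exact intervalIntegral.continuous_parametric_intervalIntegral_of_continuous'
        (f := fun x t => f (x, t)) (by simpa [Function.uncurry_def] using hc) 0 1
    | succ n ih =>
      intro F _ _ _ f hf
      have hd : ContDiff ℝ n (fderiv ℝ f) := hf.fderiv_right (by push_cast; rfl)
      have hdiff : Differentiable ℝ f := hf.differentiable (by simp)
      let g : E × ℝ → (E →L[ℝ] F) := fun p => (fderiv ℝ f p).comp (ContinuousLinearMap.inl ℝ E ℝ)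
      have hg : ContDiff ℝ n g := hd.clm_comp contDiff_const
      have hgc : Continuous g := hg.continuous
      have hc : Continuous f := hf.continuous
      push_cast
      rw [contDiff_succ_iff_hasFDerivAt]
      refine ⟨fun x => ∫ t in (0 : ℝ)..1, g (x, t), ih _ g hg, fun x₀ => ?_⟩
      have hcomp : IsCompact (Metric.closedBall x₀ 1 ×ˢ Icc (0 : ℝ) 1) :=
        (isCompact_closedBall x₀ 1).prod isCompact_Icc
      obtain ⟨C, hC⟩ := hcomp.exists_bound_of_continuousOn hgc.continuousOn
      refine intervalIntegral.hasFDerivAt_integral_of_dominated_of_fderiv_le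
        (F := fun x t => f (x, t)) (F' := fun x t => g (x, t)) (bound := fun _ => C)
        (Metric.closedBall_mem_nhds x₀ one_pos) ?_ ?_ ?_ ?_ ?_ ?_
      · exact Filter.Eventually.of_forall fun x =>
          (by fun_prop : Continuous fun t => f (x, t)).aestronglyMeasurable
      · exact (by fun_prop : Continuous fun t => f (x₀, t)).intervalIntegrable _ _
      · exact (by fun_prop : Continuous fun t => g (x₀, t)).aestronglyMeasurable
      · refine Filter.Eventually.of_forall fun t ht x hx => hC (x, t) ⟨hx, ?_⟩
        rw [uIoc_of_le zero_le_one] at ht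
        exact ⟨ht.1.le, ht.2⟩
      · exact intervalIntegrable_const
      · refine Filter.Eventually.of_forall fun t _ x _ => ?_
        exact ((hdiff (x, t)).hasFDerivAt).comp x (hasFDerivAt_prodMk_left x t)
  exact key n F f hf

/-- Hadamard's lemma in the second variable. -/
theorem exists_contDiff_add_smul {F : Type} [NormedAddCommGroup F] [NormedSpace ℝ F]
    [CompleteSpace F] (f : ℝ × ℝ → F) (hf : ContDiff ℝ ∞ f) :
    ∃ H : ℝ × ℝ → F, ContDiff ℝ ∞ H ∧ ∀ u d, f (u, d) = f (u, 0) + d • H (u, d) := by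
  let g : ℝ × ℝ → F := fun p => fderiv ℝ f p (0, 1)
  have hg : ContDiff ℝ ∞ g := (hf.fderiv_right (by simp)).clm_apply contDiff_const
  refine ⟨fun p => ∫ t in (0 : ℝ)..1, g (p.1, t * p.2), ?_, fun u d => ?_⟩
  · rw [contDiff_infty]
    intro n
    refine contDiff_intervalIntegral_param n (fun q : (ℝ × ℝ) × ℝ => g (q.1.1, q.2 * q.1.2)) ?_
    exact (hg.of_le (by exact_mod_cast le_top)).comp (by fun_prop)
  · have h1 : ∀ t ∈ uIcc (0 : ℝ) 1,
        HasDerivAt (fun t : ℝ => f (u, t * d)) (d • g (u, t * d)) t := by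
      intro t _
      have h2 : HasFDerivAt f (fderiv ℝ f (u, t * d)) (u, t * d) :=
        ((hf.differentiable (by simp)) _).hasFDerivAt
      have h3 : HasDerivAt (fun t : ℝ => ((u, t * d) : ℝ × ℝ)) (0, d) t := by
        simpa using (hasDerivAt_const t u).prodMk ((hasDerivAt_id t).mul_const d)
      have h4 := h2.comp_hasDerivAt t h3
      have h5 : d • g (u, t * d) = fderiv ℝ f (u, t * d) (0, d) := by
        change d • fderiv ℝ f (u, t * d) (0, 1) = _
        rw [← map_smul]; simp
      rw [h5]
      exact h4
    have h5 := intervalIntegral.integral_eq_sub_of_hasDerivAt h1 (by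
      have : Continuous g := hg.continuous
      exact (by fun_prop : Continuous fun t => d • g (u, t * d)).intervalIntegrable _ _)
    rw [intervalIntegral.integral_smul] at h5
    simp only [one_mul, zero_mul] at h5
    rw [h5]; abel

/-! ### Plane geometry and the frame of the boundary curve -/

theorem plane_inner_eq (u v : Plane) : inner ℝ u v = u 0 * v 0 + u 1 * v 1 := by
  simp [PiLp.inner_apply, Fin.sum_univ_two, mul_comm]

theorem plane_norm_sq (u : Plane) : ‖u‖ ^ 2 = u 0 ^ 2 + u 1 ^ 2 := by
  rw [← real_inner_self_eq_norm_sq, plane_inner_eq]; ring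

theorem cross_add_right (u v w : Plane) : cross u (v + w) = cross u v + cross u w := by
  simp [cross]; ring

theorem cross_sub_left (u v w : Plane) : cross (u - v) w = cross u w - cross v w := by
  simp [cross]; ring

theorem cross_sub_right (u v w : Plane) : cross u (v - w) = cross u v - cross u w := by
  simp [cross]; ring

theorem cross_smul_left (c : ℝ) (u v : Plane) : cross (c • u) v = c * cross u v := by
  simp [cross]; ring

theorem cross_smul_right (c : ℝ) (u v : Plane) : cross u (c • v) = c * cross u v := by
  simp [cross]; ring

theorem cross_neg_right (u v : Plane) : cross u (-v) = -cross u v := by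
  simp [cross]; ring

@[simp] theorem plane_cross_self (u : Plane) : cross u u = 0 := by
  simp [cross]; ring

@[simp] theorem cross_zero_right (u : Plane) : cross u 0 = 0 := by
  simp [cross]

theorem cross_swap (u v : Plane) : cross u v = -cross v u := by
  simp [cross]; ring

theorem inner_sq_add_cross_sq (u v : Plane) :
    (inner ℝ u v) ^ 2 + cross u v ^ 2 = ‖u‖ ^ 2 * ‖v‖ ^ 2 := by
  rw [plane_norm_sq, plane_norm_sq, plane_inner_eq, cross]; ring

theorem abs_cross_le (u v : Plane) : |cross u v| ≤ ‖u‖ * ‖v‖ := by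
  apply abs_le_of_sq_le_sq _ (by positivity)
  nlinarith [inner_sq_add_cross_sq u v, sq_nonneg (inner ℝ u v)]

theorem HasDerivAt.cross {f g : ℝ → Plane} {f' g' : Plane} {t : ℝ} (hf : HasDerivAt f f' t)
    (hg : HasDerivAt g g' t) :
    HasDerivAt (fun t => _root_.cross (f t) (g t))
      (_root_.cross f' (g t) + _root_.cross (f t) g') t := by
  have hf' : ∀ i, HasDerivAt (fun t => f t i) (f' i) t := fun i =>
    (EuclideanSpace.proj (𝕜 := ℝ) i : Plane →L[ℝ] ℝ).hasFDerivAt.comp_hasDerivAt t hf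
  have hg' : ∀ i, HasDerivAt (fun t => g t i) (g' i) t := fun i =>
    (EuclideanSpace.proj (𝕜 := ℝ) i : Plane →L[ℝ] ℝ).hasFDerivAt.comp_hasDerivAt t hg
  have := ((hf' 0).mul (hg' 1)).sub ((hf' 1).mul (hg' 0))
  simp only [_root_.cross]
  exact this.congr_deriv (by ring)

theorem continuous_cross : Continuous fun p : Plane × Plane => cross p.1 p.2 := by
  unfold cross; fun_prop

theorem Continuous.cross {X : Type*} [TopologicalSpace X] {f g : X → Plane} (hf : Continuous f)
    (hg : Continuous g) : Continuous fun x => _root_.cross (f x) (g x) :=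
  continuous_cross.comp (hf.prodMk hg)

/-- The vector `u` turned counterclockwise by a right angle. -/
def quarterTurn (u : Plane) : Plane := !₂[-u 1, u 0]

theorem eq_inner_smul_add_cross_smul {T : Plane} (hT : ‖T‖ = 1) (v : Plane) :
    v = (inner ℝ T v) • T + cross T v • quarterTurn T := by
  have h1 : T 0 ^ 2 + T 1 ^ 2 = 1 := by rw [← plane_norm_sq, hT]; norm_num
  rw [plane_inner_eq]
  ext i
  fin_cases i
  · simp [cross, quarterTurn]; linear_combination (-(v 0)) * h1
  · simp [cross, quarterTurn]; linear_combination (-(v 1)) * h1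

theorem eq_of_inner_eq_of_cross_eq {T u v : Plane} (hT : ‖T‖ = 1)
    (h1 : inner ℝ T u = inner ℝ T v) (h2 : cross T u = cross T v) : u = v := by
  rw [eq_inner_smul_add_cross_smul hT u, eq_inner_smul_add_cross_smul hT v, h1, h2]

theorem exists_bound_of_periodic {F : Type*} [NormedAddCommGroup F] {f : ℝ → F} {ℓ : ℝ}
    (hℓ : 0 < ℓ) (hp : Function.Periodic f ℓ) (hf : Continuous f) : ∃ C, ∀ t, ‖f t‖ ≤ C := by
  obtain ⟨C, hC⟩ := isCompact_Icc.exists_bound_of_continuousOn (s := Icc 0 ℓ) hf.continuousOn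
  refine ⟨C, fun t => ?_⟩
  obtain ⟨y, hy, hyt⟩ := hp.exists_mem_Ico₀ hℓ t
  rw [hyt]
  exact hC y ⟨hy.1, hy.2.le⟩

/-- The signed curvature of `γ`, provided that `γ` has unit speed. -/
noncomputable def curvature (γ : ℝ → Plane) (t : ℝ) : ℝ := cross (deriv γ t) (deriv (deriv γ) t)

namespace IsBoundaryParametrization

variable {Ω : Set Plane} {ℓ : ℝ} {γ : ℝ → Plane}

theorem contDiff_deriv (h : IsBoundaryParametrization Ω ℓ γ) : ContDiff ℝ ∞ (deriv γ) :=
  (contDiff_infty_iff_deriv.1 h.smooth).2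

theorem contDiff_deriv2 (h : IsBoundaryParametrization Ω ℓ γ) :
    ContDiff ℝ ∞ (deriv (deriv γ)) :=
  (contDiff_infty_iff_deriv.1 h.contDiff_deriv).2

theorem contDiff_deriv3 (h : IsBoundaryParametrization Ω ℓ γ) :
    ContDiff ℝ ∞ (deriv (deriv (deriv γ))) :=
  (contDiff_infty_iff_deriv.1 h.contDiff_deriv2).2

theorem hasDerivAt (h : IsBoundaryParametrization Ω ℓ γ) (t : ℝ) :
    HasDerivAt γ (deriv γ t) t :=
  (h.smooth.differentiable (by simp) t).hasDerivAt

theorem hasDerivAt2 (h : IsBoundaryParametrization Ω ℓ γ) (t : ℝ) :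
    HasDerivAt (deriv γ) (deriv (deriv γ) t) t :=
  (h.contDiff_deriv.differentiable (by simp) t).hasDerivAt

theorem hasDerivAt3 (h : IsBoundaryParametrization Ω ℓ γ) (t : ℝ) :
    HasDerivAt (deriv (deriv γ)) (deriv (deriv (deriv γ)) t) t :=
  (h.contDiff_deriv2.differentiable (by simp) t).hasDerivAt

theorem continuous (h : IsBoundaryParametrization Ω ℓ γ) : Continuous γ := h.smooth.continuous

theorem inner_tangent_self (h : IsBoundaryParametrization Ω ℓ γ) (t : ℝ) :
    inner ℝ (deriv γ t) (deriv γ t) = 1 := by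
  rw [real_inner_self_eq_norm_sq, h.unit_speed]; norm_num

theorem inner_tangent_normal (h : IsBoundaryParametrization Ω ℓ γ) (t : ℝ) :
    inner ℝ (deriv γ t) (deriv (deriv γ) t) = 0 := by
  have h1 := (h.hasDerivAt2 t).inner ℝ (h.hasDerivAt2 t)
  have h2 : (fun t => inner ℝ (deriv γ t) (deriv γ t)) = fun _ => (1 : ℝ) :=
    funext h.inner_tangent_self
  rw [h2] at h1
  have h3 := h1.unique (hasDerivAt_const t 1)
  rw [real_inner_comm (deriv γ t)] at h3
  linarith [real_inner_comm (deriv γ t) (deriv (deriv γ) t)]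

theorem normal_eq (h : IsBoundaryParametrization Ω ℓ γ) (t : ℝ) :
    deriv (deriv γ) t = curvature γ t • quarterTurn (deriv γ t) := by
  have := eq_inner_smul_add_cross_smul (h.unit_speed t) (deriv (deriv γ) t)
  rw [h.inner_tangent_normal, zero_smul, zero_add] at this
  exact this

theorem inner_normal (h : IsBoundaryParametrization Ω ℓ γ) (t : ℝ) (v : Plane) :
    inner ℝ (deriv (deriv γ) t) v = curvature γ t * cross (deriv γ t) v := by
  rw [h.normal_eq, plane_inner_eq]; simp [quarterTurn, cross]; ring

theorem cross_normal (h : IsBoundaryParametrization Ω ℓ γ) (t : ℝ) (v : Plane) :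
    cross (deriv (deriv γ) t) v = -(curvature γ t * inner ℝ (deriv γ t) v) := by
  rw [h.normal_eq, plane_inner_eq]; simp [quarterTurn, cross]; ring

theorem periodic (h : IsBoundaryParametrization Ω ℓ γ) : Function.Periodic γ ℓ := fun t =>
  ((h.eq_iff t (t + ℓ)).2 ⟨1, by simp⟩).symm

theorem _root_.periodic_deriv {F : Type*} [NormedAddCommGroup F] [NormedSpace ℝ F] {f : ℝ → F}
    {ℓ : ℝ} (hf : Function.Periodic f ℓ) : Function.Periodic (deriv f) ℓ := fun t => by
  have : (fun x => f (x + ℓ)) = f := funext hf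
  conv_rhs => rw [← this, deriv_comp_add_const]

theorem norm_sub_le (h : IsBoundaryParametrization Ω ℓ γ) (s t : ℝ) :
    ‖γ t - γ s‖ ≤ |t - s| := by
  have := Convex.norm_image_sub_le_of_norm_hasDerivWithin_le (s := univ) (C := 1)
    (fun x _ => (h.hasDerivAt x).hasDerivWithinAt) (fun x _ => (h.unit_speed x).le)
    convex_univ (mem_univ s) (mem_univ t)
  simpa using this

end IsBoundaryParametrization

/-- Uniform bounds `κ₀ ≤ κ ≤ K`, `‖γ''‖, ‖γ'''‖ ≤ K` for a unit speed curve, together with a scale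
`δ` on which the curve is close to its osculating parabolas. -/
structure CurveBounds (γ : ℝ → Plane) (κ₀ K δ : ℝ) : Prop where
  pos : 0 < κ₀
  one_le : 1 ≤ K
  curv_ge : ∀ t, κ₀ ≤ curvature γ t
  curv_le : ∀ t, curvature γ t ≤ K
  norm_two : ∀ t, ‖deriv (deriv γ) t‖ ≤ K
  norm_three : ∀ t, ‖deriv (deriv (deriv γ)) t‖ ≤ K
  delta_pos : 0 < δ
  delta_le : δ ≤ 1 / 4
  mul_delta_le : K * δ ≤ κ₀ / 4
  mul_delta_le' : K * δ ≤ 1 / 4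

theorem IsBoundaryParametrization.exists_bounds {Ω : Set Plane} {ℓ : ℝ} {γ : ℝ → Plane}
    (h : IsBoundaryParametrization Ω ℓ γ) : ∃ κ₀ K δ : ℝ, CurveBounds γ κ₀ K δ := by
  have p1 := periodic_deriv h.periodic
  have p2 := periodic_deriv p1
  have p3 := periodic_deriv p2
  obtain ⟨A, hA⟩ := exists_bound_of_periodic h.length_pos p2 h.contDiff_deriv2.continuous
  obtain ⟨B, hB⟩ := exists_bound_of_periodic h.length_pos p3 h.contDiff_deriv3.continuous
  have hκc : Continuous (curvature γ) :=
    h.contDiff_deriv.continuous.cross h.contDiff_deriv2.continuous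
  have pκ : Function.Periodic (curvature γ) ℓ := fun t => by simp [curvature, p1 t, p2 t]
  have hκpos : ∀ t, 0 < curvature γ t := h.curvature_pos
  obtain ⟨D, hD⟩ := exists_bound_of_periodic h.length_pos
    (f := fun t => (curvature γ t)⁻¹) (fun t => by simp [pκ t])
    (hκc.inv₀ fun t => (hκpos t).ne')
  have hDpos : 0 < D := lt_of_lt_of_le (norm_pos_iff.2 (inv_ne_zero (hκpos 0).ne')) (hD 0)
  have hle : ∀ t, curvature γ t ≤ A := fun t => by
    refine le_trans (le_trans (le_abs_self _) (abs_cross_le _ _)) ?_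
    rw [h.unit_speed, one_mul]; exact hA t
  have hge : ∀ t, D⁻¹ ≤ curvature γ t := fun t => by
    have := hD t
    rw [Real.norm_eq_abs, abs_of_pos (inv_pos.2 (hκpos t))] at this
    exact inv_le_of_inv_le₀ (hκpos t) this
  have hD' : 0 < D⁻¹ := inv_pos.2 hDpos
  obtain ⟨K, hK⟩ : ∃ K, K = max (max A B) 1 := ⟨_, rfl⟩
  have hAK : A ≤ K := hK ▸ (le_max_left _ _).trans (le_max_left _ _)
  have hBK : B ≤ K := hK ▸ (le_max_right _ _).trans (le_max_left _ _)
  have h1K : 1 ≤ K := hK ▸ le_max_right _ _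
  have hK0 : 0 < K := by linarith
  have hDK : D⁻¹ ≤ K := (hge 0).trans ((hle 0).trans hAK)
  refine ⟨D⁻¹, K, D⁻¹ / (4 * K ^ 2), hD', h1K, hge, fun t => (hle t).trans hAK,
    fun t => (hA t).trans hAK, fun t => (hB t).trans hBK, by positivity, ?_, ?_, ?_⟩
  · rw [div_le_iff₀ (by positivity)]; nlinarith
  · rw [← mul_div_assoc, div_le_iff₀ (by positivity)]
    nlinarith [mul_le_mul_of_nonneg_left h1K (mul_pos hD' hK0).le]
  · rw [← mul_div_assoc, div_le_iff₀ (by positivity)]; nlinarith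

/-! ### Short chords -/

theorem CurveBounds.K_pos {γ : ℝ → Plane} {κ₀ K δ : ℝ} (B : CurveBounds γ κ₀ K δ) : 0 < K :=
  zero_lt_one.trans_le B.one_le

/-- A map with derivative `O(|t - s| ^ n)` on the segment from `s` varies by
`O(|t - s| ^ (n + 1))`. -/
theorem norm_sub_le_of_deriv_le {f f' : ℝ → Plane} {s K : ℝ} {n : ℕ} (hK : 0 ≤ K)
    (hf : ∀ t, HasDerivAt f (f' t) t) (hb : ∀ t, ‖f' t‖ ≤ K * |t - s| ^ n) (t : ℝ) :
    ‖f t - f s‖ ≤ K * |t - s| ^ (n + 1) := by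
  have := Convex.norm_image_sub_le_of_norm_hasDerivWithin_le (s := uIcc s t)
    (C := K * |t - s| ^ n)
    (fun x _ => (hf x).hasDerivWithinAt) (fun x hx => (hb x).trans (by
      have : |x - s| ≤ |t - s| := by
        simpa [abs_sub_comm] using abs_sub_left_of_mem_uIcc hx
      gcongr))
    (convex_uIcc s t) left_mem_uIcc right_mem_uIcc
  rw [Real.norm_eq_abs] at this
  rw [pow_succ, ← mul_assoc]; exact this

namespace IsBoundaryParametrization

variable {Ω : Set Plane} {ℓ : ℝ} {γ : ℝ → Plane} {κ₀ K δ : ℝ}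

theorem norm_tangent_sub_le (h : IsBoundaryParametrization Ω ℓ γ) (B : CurveBounds γ κ₀ K δ)
    (s t : ℝ) : ‖deriv γ t - deriv γ s‖ ≤ K * |t - s| := by
  simpa using norm_sub_le_of_deriv_le (n := 0) B.K_pos.le h.hasDerivAt2
    (fun t => by simpa using B.norm_two t) t

theorem norm_normal_sub_le (h : IsBoundaryParametrization Ω ℓ γ) (B : CurveBounds γ κ₀ K δ)
    (s t : ℝ) : ‖deriv (deriv γ) t - deriv (deriv γ) s‖ ≤ K * |t - s| := by
  simpa using norm_sub_le_of_deriv_le (n := 0) B.K_pos.le h.hasDerivAt3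
    (fun t => by simpa using B.norm_three t) t

/-- Second order Taylor expansion of the curve. -/
theorem norm_taylor_le (h : IsBoundaryParametrization Ω ℓ γ) (B : CurveBounds γ κ₀ K δ) (s t : ℝ) :
    ‖γ t - γ s - (t - s) • deriv γ s - ((t - s) ^ 2 / 2) • deriv (deriv γ) s‖ ≤
      K * |t - s| ^ 3 := by
  have h1 : ∀ t, ‖deriv γ t - deriv γ s - (t - s) • deriv (deriv γ) s‖ ≤ K * |t - s| ^ 2 := by
    intro t
    have := norm_sub_le_of_deriv_le (n := 1) (s := s) (K := K)
      (f := fun t => deriv γ t - deriv γ s - (t - s) • deriv (deriv γ) s)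
      (f' := fun t => deriv (deriv γ) t - deriv (deriv γ) s) B.K_pos.le (fun t => by
        have h2 := ((h.hasDerivAt2 t).sub_const (deriv γ s)).sub
          (((hasDerivAt_id t).sub_const s).smul_const (deriv (deriv γ) s))
        exact h2.congr_deriv (by simp)) (fun t => by simpa using h.norm_normal_sub_le B s t) t
    simpa using this
  have := norm_sub_le_of_deriv_le (n := 2) (s := s) (K := K)
      (f := fun t => γ t - γ s - (t - s) • deriv γ s - ((t - s) ^ 2 / 2) • deriv (deriv γ) s)
      (f' := fun t => deriv γ t - deriv γ s - (t - s) • deriv (deriv γ) s) B.K_pos.le (fun t => by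
        have h2 := (((h.hasDerivAt t).sub_const (γ s)).sub
          (((hasDerivAt_id t).sub_const s).smul_const (deriv γ s))).sub
          (((((hasDerivAt_id t).sub_const s).pow 2).div_const 2).smul_const (deriv (deriv γ) s))
        exact h2.congr_deriv (by simp)) h1 t
  simpa using this

theorem abs_cross_tangent_chord_sub_le (h : IsBoundaryParametrization Ω ℓ γ)
    (B : CurveBounds γ κ₀ K δ) (s t : ℝ) :
    |cross (deriv γ s) (γ t - γ s) - curvature γ s * (t - s) ^ 2 / 2| ≤ K * |t - s| ^ 3 := by
  have h1 := abs_cross_le (deriv γ s)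
    (γ t - γ s - (t - s) • deriv γ s - ((t - s) ^ 2 / 2) • deriv (deriv γ) s)
  rw [h.unit_speed, one_mul, cross_sub_right, cross_sub_right, cross_smul_right, cross_smul_right,
    plane_cross_self] at h1
  refine le_trans (le_of_eq ?_) (h1.trans (h.norm_taylor_le B s t))
  rw [curvature]; congr 1; ring

theorem abs_inner_tangent_chord_sub_le (h : IsBoundaryParametrization Ω ℓ γ)
    (B : CurveBounds γ κ₀ K δ) (s t : ℝ) :
    |inner ℝ (deriv γ s) (γ t - γ s) - (t - s)| ≤ K * |t - s| ^ 3 := by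
  have h1 := abs_real_inner_le_norm (deriv γ s)
    (γ t - γ s - (t - s) • deriv γ s - ((t - s) ^ 2 / 2) • deriv (deriv γ) s)
  rw [h.unit_speed, one_mul, inner_sub_right, inner_sub_right, inner_smul_right, inner_smul_right,
    h.inner_tangent_normal, h.inner_tangent_self] at h1
  refine le_trans (le_of_eq ?_) (h1.trans (h.norm_taylor_le B s t))
  congr 1; ring

/-- Near its foot, the height of the curve over its tangent is at least quadratic. -/
theorem cross_tangent_chord_ge (h : IsBoundaryParametrization Ω ℓ γ)
    (B : CurveBounds γ κ₀ K δ) {s t : ℝ} (hst : |t - s| ≤ δ) :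
    κ₀ / 4 * (t - s) ^ 2 ≤ cross (deriv γ s) (γ t - γ s) := by
  have h1 := (abs_le.1 (h.abs_cross_tangent_chord_sub_le B s t)).1
  have h2 : K * |t - s| ≤ κ₀ / 4 :=
    (mul_le_mul_of_nonneg_left hst B.K_pos.le).trans B.mul_delta_le
  have h3 := B.curv_ge s
  have h4 : K * |t - s| ^ 3 ≤ κ₀ / 4 * (t - s) ^ 2 := by
    rw [← sq_abs (t - s)]; nlinarith [sq_nonneg (|t - s|)]
  nlinarith [sq_nonneg (t - s)]

theorem cross_tangent_chord_le (h : IsBoundaryParametrization Ω ℓ γ)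
    (B : CurveBounds γ κ₀ K δ) {s t : ℝ} (hst : |t - s| ≤ δ) :
    cross (deriv γ s) (γ t - γ s) ≤ K * (t - s) ^ 2 := by
  have h1 := (abs_le.1 (h.abs_cross_tangent_chord_sub_le B s t)).2
  have h2 : K * |t - s| ≤ 1 / 4 :=
    (mul_le_mul_of_nonneg_left hst B.K_pos.le).trans B.mul_delta_le'
  have h3 := B.curv_le s
  have h4 : K * |t - s| ^ 3 ≤ 1 / 4 * (t - s) ^ 2 := by
    rw [← sq_abs (t - s)]; nlinarith [sq_nonneg (|t - s|)]
  nlinarith [sq_nonneg (t - s), B.one_le]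

theorem norm_chord_ge (h : IsBoundaryParametrization Ω ℓ γ)
    (B : CurveBounds γ κ₀ K δ) (s t : ℝ) :
    |t - s| - K * |t - s| ^ 3 ≤ ‖γ t - γ s‖ := by
  have h1 := h.abs_inner_tangent_chord_sub_le B s t
  have h2 := abs_real_inner_le_norm (deriv γ s) (γ t - γ s)
  rw [h.unit_speed, one_mul] at h2
  have h3 := abs_sub_abs_le_abs_sub (t - s) (inner ℝ (deriv γ s) (γ t - γ s))
  rw [abs_sub_comm] at h1
  linarith

theorem half_le_norm_chord (h : IsBoundaryParametrization Ω ℓ γ)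
    (B : CurveBounds γ κ₀ K δ) {s t : ℝ} (hst : |t - s| ≤ δ) :
    |t - s| / 2 ≤ ‖γ t - γ s‖ := by
  have h1 := h.norm_chord_ge B s t
  have h2 : K * |t - s| ≤ 1 / 4 :=
    (mul_le_mul_of_nonneg_left hst B.K_pos.le).trans B.mul_delta_le'
  have h3 : |t - s| ≤ 1 / 4 := hst.trans B.delta_le
  have h0 := abs_nonneg (t - s)
  have h4 : K * |t - s| ^ 3 = (K * |t - s|) * |t - s| * |t - s| := by ring
  have h5 : (K * |t - s|) * |t - s| ≤ 1 / 4 * (1 / 4) := by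
    have := B.K_pos; gcongr
  nlinarith

/-- If a doubly periodic continuous function is positive off the lattice `ℤ ℓ` of its second
variable, then it is small only near that lattice. -/
theorem _root_.exists_lt_imp_near_lattice {ℓ : ℝ} (hℓ : 0 < ℓ) (F : ℝ → ℝ → ℝ)
    (hF : Continuous fun p : ℝ × ℝ => F p.1 p.2) (h1 : ∀ s g, F (s + ℓ) g = F s g)
    (h2 : ∀ s g, F s (g + ℓ) = F s g) (hpos : ∀ s g, 0 < g → g < ℓ → 0 < F s g) {η : ℝ}
    (hη : 0 < η) : ∃ m > 0, ∀ s g, F s g < m → ∃ k : ℤ, |g - k * ℓ| < η := by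
  have hcomp : IsCompact (Icc (0 : ℝ) ℓ ×ˢ Icc η (ℓ - η)) := isCompact_Icc.prod isCompact_Icc
  obtain ⟨m, hm, hmF⟩ : ∃ m > 0, ∀ s ∈ Icc (0 : ℝ) ℓ, ∀ g ∈ Icc η (ℓ - η), m ≤ F s g := by
    rcases (Icc (0 : ℝ) ℓ ×ˢ Icc η (ℓ - η)).eq_empty_or_nonempty with he | hne
    · refine ⟨1, one_pos, fun s hs g hg => ?_⟩
      have : (s, g) ∈ Icc (0 : ℝ) ℓ ×ˢ Icc η (ℓ - η) := ⟨hs, hg⟩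
      rw [he] at this; exact this.elim
    · obtain ⟨p, hp, hmin⟩ := hcomp.exists_isMinOn hne hF.continuousOn
      refine ⟨F p.1 p.2, hpos _ _ (hη.trans_le hp.2.1) (by linarith [hp.2.2]), fun s hs g hg => ?_⟩
      exact isMinOn_iff.1 hmin (s, g) ⟨hs, hg⟩
  refine ⟨m, hm, fun s g hlt => ?_⟩
  have hp1 : Function.Periodic (fun s => F s g) ℓ := fun s => h1 s g
  obtain ⟨s', hs', hs'e⟩ := hp1.exists_mem_Ico₀ hℓ s
  have hk := toIcoDiv hℓ 0 g
  have hg' := sub_toIcoDiv_zsmul_mem_Ico hℓ 0 g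
  set k := toIcoDiv hℓ 0 g
  rw [zsmul_eq_mul, zero_add] at hg'
  have hp2 : Function.Periodic (fun g => F s' g) ℓ := fun g => h2 s' g
  have h3 : F s' (g - k * ℓ) = F s' g := hp2.sub_int_mul_eq k
  by_cases hlo : g - k * ℓ < η
  · exact ⟨k, by rw [abs_of_nonneg hg'.1]; exact hlo⟩
  by_cases hhi : ℓ - η < g - k * ℓ
  · refine ⟨k + 1, ?_⟩
    push_cast
    rw [abs_lt]; constructor <;> nlinarith [hg'.2]
  · exfalso
    have := hmF s' ⟨hs'.1, hs'.2.le⟩ (g - k * ℓ) ⟨not_lt.1 hlo, not_lt.1 hhi⟩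
    rw [h3, ← hs'e] at this
    linarith

theorem ne_of_lt_of_lt (h : IsBoundaryParametrization Ω ℓ γ) {s g : ℝ} (h0 : 0 < g) (h1 : g < ℓ) :
    γ (s + g) ≠ γ s := by
  intro he
  obtain ⟨k, hk⟩ := (h.eq_iff _ _).1 he.symm
  have hk' : g = k * ℓ := by linarith
  have hℓ := h.length_pos
  have a1 : (0 : ℝ) < k := by by_contra hc; push Not at hc; nlinarith
  have a2 : (k : ℝ) < 1 := by by_contra hc; push Not at hc; nlinarith
  have b1 : 0 < k := by exact_mod_cast a1
  have b2 : k < 1 := by exact_mod_cast a2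
  omega

theorem exists_norm_lt_imp_near (h : IsBoundaryParametrization Ω ℓ γ) {η : ℝ} (hη : 0 < η) :
    ∃ m > 0, ∀ s t, ‖γ t - γ s‖ < m → ∃ k : ℤ, |t - s - k * ℓ| < η := by
  have hc := h.continuous
  obtain ⟨m, hm, H⟩ := exists_lt_imp_near_lattice h.length_pos (fun s g => ‖γ (s + g) - γ s‖)
    (by fun_prop) (fun s g => by
      have e1 := h.periodic s
      have e2 := h.periodic (s + g)
      rw [show s + ℓ + g = s + g + ℓ by ring]; simp only [e1, e2])
    (fun s g => by rw [← add_assoc, h.periodic]) (fun s g h0 h1 => by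
      rw [norm_pos_iff, sub_ne_zero]; exact h.ne_of_lt_of_lt h0 h1) hη
  refine ⟨m, hm, fun s t hst => H s (t - s) ?_⟩
  simpa using hst

/-- Chord-arc inequality, for the lift of the arc closest to zero. -/
theorem exists_chord_arc (h : IsBoundaryParametrization Ω ℓ γ) (B : CurveBounds γ κ₀ K δ) :
    ∃ m > 0, ∀ s t, ‖γ t - γ s‖ < m →
      ∃ k : ℤ, |t - s - k * ℓ| ≤ 2 * ‖γ t - γ s‖ := by
  obtain ⟨m, hm, H⟩ := h.exists_norm_lt_imp_near B.delta_pos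
  refine ⟨m, hm, fun s t hst => ?_⟩
  obtain ⟨k, hk⟩ := H s t hst
  refine ⟨k, ?_⟩
  have h1 := h.half_le_norm_chord B (s := s) (t := t - k * ℓ) (by
    rw [show t - k * ℓ - s = t - s - k * ℓ by ring]; exact hk.le)
  rw [h.periodic.sub_int_mul_eq k, show t - k * ℓ - s = t - s - k * ℓ by ring] at h1
  linarith

end IsBoundaryParametrization

/-! ### Convexity -/

namespace IsBoundaryParametrization

variable {Ω : Set Plane} {ℓ : ℝ} {γ : ℝ → Plane} {κ₀ K δ : ℝ}

theorem mem_frontier (h : IsBoundaryParametrization Ω ℓ γ) (t : ℝ) : γ t ∈ frontier Ω :=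
  h.range_eq ▸ mem_range_self t

theorem mem_closure (h : IsBoundaryParametrization Ω ℓ γ) (t : ℝ) : γ t ∈ closure Ω :=
  frontier_subset_closure (h.mem_frontier t)

theorem notMem (h : IsBoundaryParametrization Ω ℓ γ) (hΩ : IsSmoothStrictlyConvexDomain Ω)
    (t : ℝ) : γ t ∉ Ω := fun ht => by
  have := h.mem_frontier t
  rw [hΩ.isOpen.frontier_eq] at this
  exact this.2 ht

/-- The domain lies to the left of each of its tangents. By Hahn–Banach it lies on one side;
positive curvature bends the boundary to the left, which determines the side. -/
theorem cross_pos_of_mem (h : IsBoundaryParametrization Ω ℓ γ)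
    (hΩ : IsSmoothStrictlyConvexDomain Ω) (s : ℝ) {z : Plane} (hz : z ∈ Ω) :
    0 < cross (deriv γ s) (z - γ s) := by
  obtain ⟨κ₀, K, δ, B⟩ := h.exists_bounds
  obtain ⟨f, hf⟩ := geometric_hahn_banach_open_point hΩ.convex hΩ.isOpen (h.notMem hΩ s)
  have hle : ∀ w ∈ closure Ω, f w ≤ f (γ s) :=
    fun w hw => closure_minimal (s := Ω) (t := {w | f w ≤ f (γ s)}) (fun a ha => (hf a ha).le)
      (isClosed_le f.continuous continuous_const) hw
  have hmax : IsLocalMax (fun t => f (γ t)) s :=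
    Filter.Eventually.of_forall fun t => hle _ (h.mem_closure t)
  have h0 : f (deriv γ s) = 0 :=
    hmax.hasDerivAt_eq_zero (f.hasFDerivAt.comp_hasDerivAt s (h.hasDerivAt s))
  have hfv : ∀ v, f v = cross (deriv γ s) v * f (quarterTurn (deriv γ s)) := fun v => by
    conv_lhs => rw [eq_inner_smul_add_cross_smul (h.unit_speed s) v]
    rw [map_add, map_smul, map_smul, h0]; simp
  have hd := h.cross_tangent_chord_ge B (s := s) (t := s + δ) (by simp [abs_of_pos B.delta_pos])
  have h1 : f (γ (s + δ) - γ s) ≤ 0 := by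
    rw [map_sub]; linarith [hle _ (h.mem_closure (s + δ))]
  have h2 : f (z - γ s) < 0 := by rw [map_sub]; linarith [hf z hz]
  rw [hfv] at h1 h2
  have h3 : 0 < cross (deriv γ s) (γ (s + δ) - γ s) :=
    lt_of_lt_of_le (by have := B.pos; have := B.delta_pos; simp; positivity) hd
  have h4 : f (quarterTurn (deriv γ s)) ≤ 0 := by
    by_contra hc; push Not at hc; nlinarith [mul_pos h3 hc]
  by_contra hc
  push Not at hc
  nlinarith [mul_nonneg_of_nonpos_of_nonpos hc h4]

theorem cross_nonneg (h : IsBoundaryParametrization Ω ℓ γ)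
    (hΩ : IsSmoothStrictlyConvexDomain Ω) (s : ℝ) {z : Plane} (hz : z ∈ closure Ω) :
    0 ≤ cross (deriv γ s) (z - γ s) := by
  refine closure_minimal (s := Ω) (t := {w | 0 ≤ cross (deriv γ s) (w - γ s)})
    (fun a ha => (h.cross_pos_of_mem hΩ s ha).le) (isClosed_le continuous_const ?_) hz
  exact continuous_const.cross (continuous_id.sub continuous_const)

/-- Strict convexity: the boundary meets each of its tangent lines in a single point. -/
theorem cross_pos (h : IsBoundaryParametrization Ω ℓ γ)
    (hΩ : IsSmoothStrictlyConvexDomain Ω) {s t : ℝ} (hst : γ t ≠ γ s) :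
    0 < cross (deriv γ s) (γ t - γ s) := by
  obtain ⟨κ₀, K, δ, B⟩ := h.exists_bounds
  refine lt_of_le_of_ne (h.cross_nonneg hΩ s (h.mem_closure t)) fun h0 => ?_
  obtain ⟨m, hm, H⟩ := h.exists_norm_lt_imp_near B.delta_pos
  -- A point of the chord close to `γ s` would lie on the boundary and on the tangent at `γ s`.
  have hn : 0 < ‖γ t - γ s‖ := norm_pos_iff.2 (sub_ne_zero.2 hst)
  obtain ⟨ε, hε0, hε1, hεm⟩ : ∃ ε > 0, ε ≤ 1 ∧ ε * ‖γ t - γ s‖ < m := by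
    refine ⟨min 1 (m / (2 * ‖γ t - γ s‖)), by positivity, min_le_left _ _, ?_⟩
    calc _ ≤ m / (2 * ‖γ t - γ s‖) * ‖γ t - γ s‖ := by gcongr; exact min_le_right _ _
      _ = m / 2 := by field_simp
      _ < m := by linarith
  have hp1 : γ s + ε • (γ t - γ s) ∈ closure Ω :=
    hΩ.convex.closure.add_smul_sub_mem (h.mem_closure s) (h.mem_closure t) ⟨hε0.le, hε1⟩
  have hp2 : γ s + ε • (γ t - γ s) ∉ Ω := fun hc => by
    have := h.cross_pos_of_mem hΩ s hc
    rw [add_sub_cancel_left, cross_smul_right, ← h0] at this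
    simp at this
  have hp3 : γ s + ε • (γ t - γ s) ∈ frontier Ω := by
    rw [hΩ.isOpen.frontier_eq]; exact ⟨hp1, hp2⟩
  rw [← h.range_eq] at hp3
  obtain ⟨r, hr⟩ := hp3
  have hrs : γ r - γ s = ε • (γ t - γ s) := by rw [hr, add_sub_cancel_left]
  obtain ⟨k, hk⟩ := H s r (by rw [hrs, norm_smul, Real.norm_eq_abs, abs_of_pos hε0]; exact hεm)
  have h1 := h.cross_tangent_chord_ge B (s := s) (t := r - k * ℓ) (by
    rw [show r - k * ℓ - s = r - s - k * ℓ by ring]; exact hk.le)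
  rw [h.periodic.sub_int_mul_eq k, hrs, cross_smul_right, ← h0, mul_zero] at h1
  have h2 : r - k * ℓ - s = 0 := by
    have := B.pos
    have h3 : (r - k * ℓ - s) ^ 2 ≤ 0 := by nlinarith
    exact pow_eq_zero_iff (two_ne_zero) |>.1 (le_antisymm h3 (sq_nonneg _))
  have h3 : γ r = γ s := (h.eq_iff r s).2 ⟨-k, by push_cast; linarith⟩
  rw [h3, sub_self] at hrs
  exact (smul_ne_zero hε0.ne' (sub_ne_zero.2 hst)) hrs.symm

/-- Chords run inside the domain. A convex open set alone would not do: a chord could be part of the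
boundary. -/
theorem openSegment_subset (h : IsBoundaryParametrization Ω ℓ γ)
    (hΩ : IsSmoothStrictlyConvexDomain Ω) {s t : ℝ} (hst : γ t ≠ γ s) :
    openSegment ℝ (γ s) (γ t) ⊆ Ω := by
  intro z hz
  by_contra hc
  have h1 : z ∈ closure Ω :=
    hΩ.convex.closure.openSegment_subset (h.mem_closure s) (h.mem_closure t) hz
  have h2 : z ∈ frontier Ω := by rw [hΩ.isOpen.frontier_eq]; exact ⟨h1, hc⟩
  rw [← h.range_eq] at h2
  obtain ⟨r, rfl⟩ := h2
  obtain ⟨a, b, ha, hb, hab, hz⟩ := hz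
  have h3 : a * cross (deriv γ r) (γ s - γ r) + b * cross (deriv γ r) (γ t - γ r) = 0 := by
    rw [← cross_smul_right, ← cross_smul_right, ← cross_add_right]
    have : a • (γ s - γ r) + b • (γ t - γ r) = 0 := by
      have e : (a + b) • γ r = γ r := by rw [hab, one_smul]
      rw [smul_sub, smul_sub]
      rw [add_smul] at e
      have : a • γ s - a • γ r + (b • γ t - b • γ r) =
        (a • γ s + b • γ t) - (a • γ r + b • γ r) := by abel
      rw [this, e, hz, sub_self]
    rw [this, cross_zero_right]
  have n1 := h.cross_nonneg hΩ r (h.mem_closure s)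
  have n2 := h.cross_nonneg hΩ r (h.mem_closure t)
  by_cases hs : γ s = γ r
  · have n3 := h.cross_pos hΩ (s := r) (t := t) (by rw [← hs]; exact hst)
    nlinarith [mul_pos hb n3]
  · have n3 := h.cross_pos hΩ hs
    nlinarith [mul_pos ha n3, mul_nonneg hb.le n2]

theorem openSegment_subset_of_mem (h : IsBoundaryParametrization Ω ℓ γ)
    (hΩ : IsSmoothStrictlyConvexDomain Ω) {t : ℝ} {z : Plane} (hz : z ∈ Ω) :
    openSegment ℝ z (γ t) ⊆ Ω := by
  have := hΩ.convex.openSegment_interior_closure_subset_interior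
    (x := z) (y := γ t) (by rwa [hΩ.isOpen.interior_eq]) (h.mem_closure t)
  rwa [hΩ.isOpen.interior_eq] at this

/-- Boundary points close to the tangent line at `γ s` are close to `γ s` along the boundary. -/
theorem exists_cross_lt_imp_near (h : IsBoundaryParametrization Ω ℓ γ)
    (hΩ : IsSmoothStrictlyConvexDomain Ω) {η : ℝ} (hη : 0 < η) :
    ∃ m > 0, ∀ s t, cross (deriv γ s) (γ t - γ s) < m → ∃ k : ℤ, |t - s - k * ℓ| < η := by
  have hc := h.continuous
  have hp := periodic_deriv h.periodic
  obtain ⟨m, hm, H⟩ := exists_lt_imp_near_lattice h.length_pos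
    (fun s g => cross (deriv γ s) (γ (s + g) - γ s))
    ((h.contDiff_deriv.continuous.comp continuous_fst).cross (by fun_prop)) (fun s g => by
      have e1 := h.periodic s
      have e2 := h.periodic (s + g)
      rw [show s + ℓ + g = s + g + ℓ by ring]; simp only [e1, e2, hp s])
    (fun s g => by rw [← add_assoc, h.periodic]) (fun s g h0 h1 =>
      h.cross_pos hΩ (h.ne_of_lt_of_lt h0 h1)) hη
  refine ⟨m, hm, fun s t hst => H s (t - s) ?_⟩
  simpa using hst

end IsBoundaryParametrization

/-! ### Angles and the reflection law -/

/-- Cosine of the angle from the tangent at `γ s` to the direction of `z`. -/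
noncomputable def cosAt (γ : ℝ → Plane) (s : ℝ) (z : Plane) : ℝ :=
  inner ℝ (deriv γ s) (z - γ s) / ‖z - γ s‖

/-- Sine of the angle from the tangent at `γ s` to the direction of `z`. -/
noncomputable def sinAt (γ : ℝ → Plane) (s : ℝ) (z : Plane) : ℝ :=
  cross (deriv γ s) (z - γ s) / ‖z - γ s‖

/-- `t 0 < … < t n` are lifts of the arclength coordinates of successive impact points of a
billiard orbit; the reflection law is imposed at `t 1, …, t (n - 1)`. -/
structure IsBilliardSeq (ℓ : ℝ) (γ : ℝ → Plane) (t : ℕ → ℝ) (n : ℕ) : Prop where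
  lt_succ : ∀ k < n, t k < t (k + 1)
  succ_lt : ∀ k < n, t (k + 1) < t k + ℓ
  reflect : ∀ k, k + 1 < n →
    cosAt γ (t (k + 1)) (γ (t (k + 2))) = -cosAt γ (t (k + 1)) (γ (t k))

namespace IsBoundaryParametrization

variable {Ω : Set Plane} {ℓ : ℝ} {γ : ℝ → Plane} {κ₀ K δ : ℝ}

theorem cosAt_sq_add_sinAt_sq (h : IsBoundaryParametrization Ω ℓ γ) {s : ℝ} {z : Plane}
    (hz : z ≠ γ s) : cosAt γ s z ^ 2 + sinAt γ s z ^ 2 = 1 := by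
  have hn : ‖z - γ s‖ ≠ 0 := norm_ne_zero_iff.2 (sub_ne_zero.2 hz)
  rw [cosAt, sinAt, div_pow, div_pow, ← add_div, inner_sq_add_cross_sq, h.unit_speed]
  field_simp

theorem cosAt_sub_int_mul (h : IsBoundaryParametrization Ω ℓ γ) (s : ℝ) (k : ℤ) (z : Plane) :
    cosAt γ (s - k * ℓ) z = cosAt γ s z := by
  rw [cosAt, cosAt, h.periodic.sub_int_mul_eq k, (periodic_deriv h.periodic).sub_int_mul_eq k]

theorem chord_ne (h : IsBoundaryParametrization Ω ℓ γ) {s t : ℝ} (h0 : s < t) (h1 : t < s + ℓ) :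
    γ t ≠ γ s := by
  have := h.ne_of_lt_of_lt (s := s) (g := t - s) (by linarith) (by linarith)
  rwa [add_sub_cancel] at this

theorem sinAt_pos (h : IsBoundaryParametrization Ω ℓ γ) (hΩ : IsSmoothStrictlyConvexDomain Ω)
    {s t : ℝ} (hst : γ t ≠ γ s) : 0 < sinAt γ s (γ t) :=
  div_pos (h.cross_pos hΩ hst) (norm_pos_iff.2 (sub_ne_zero.2 hst))

theorem mem_ne (h : IsBoundaryParametrization Ω ℓ γ) (hΩ : IsSmoothStrictlyConvexDomain Ω)
    {s : ℝ} {z : Plane} (hz : z ∈ Ω) : z ≠ γ s := fun he => h.notMem hΩ s (he ▸ hz)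

theorem sinAt_pos_of_mem (h : IsBoundaryParametrization Ω ℓ γ)
    (hΩ : IsSmoothStrictlyConvexDomain Ω) {s : ℝ} {z : Plane} (hz : z ∈ Ω) : 0 < sinAt γ s z :=
  div_pos (h.cross_pos_of_mem hΩ s hz) (norm_pos_iff.2 (sub_ne_zero.2 (h.mem_ne hΩ hz)))

theorem sin_eq_of_cos_eq_neg {c c' d d' : ℝ} (h1 : c ^ 2 + d ^ 2 = 1) (h2 : c' ^ 2 + d' ^ 2 = 1)
    (hd : 0 < d) (hd' : 0 < d') (hc : c = -c') : d = d' := by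
  have : d ^ 2 = d' ^ 2 := by rw [hc] at h1; linarith [neg_sq c']
  exact (pow_left_inj₀ hd.le hd'.le two_ne_zero).1 this

theorem abs_pow_three_le (B : CurveBounds γ κ₀ K δ) {x : ℝ} (hx : |x| ≤ δ) :
    K * |x| ^ 3 ≤ |x| / 16 := by
  have h2 : K * |x| ≤ 1 / 4 :=
    (mul_le_mul_of_nonneg_left hx B.K_pos.le).trans B.mul_delta_le'
  have h3 : |x| ≤ 1 / 4 := hx.trans B.delta_le
  have h0 := abs_nonneg x
  have h4 : K * |x| ^ 3 = (K * |x|) * |x| * |x| := by ring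
  have h5 : (K * |x|) * |x| ≤ 1 / 4 * (1 / 4) := by
    have := B.K_pos; gcongr
  nlinarith

theorem cosAt_mul_pos (h : IsBoundaryParametrization Ω ℓ γ) (B : CurveBounds γ κ₀ K δ) {s t : ℝ}
    (h0 : t ≠ s) (hst : |t - s| ≤ δ) : 0 < (t - s) * cosAt γ s (γ t) := by
  have h1 := h.abs_inner_tangent_chord_sub_le B s t
  have h2 := h.half_le_norm_chord B hst
  have h3 := abs_pow_three_le B hst
  have h4 : 0 < |t - s| := abs_pos.2 (sub_ne_zero.2 h0)
  rw [cosAt, ← mul_div_assoc]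
  refine div_pos ?_ (by linarith)
  have h5 := abs_le.1 (h1.trans h3)
  rcases abs_cases (t - s) with ⟨e, _⟩ | ⟨e, _⟩ <;> rw [e] at h5 h4 <;> nlinarith

theorem sinAt_le (h : IsBoundaryParametrization Ω ℓ γ) (B : CurveBounds γ κ₀ K δ) {s t : ℝ}
    (h0 : t ≠ s) (hst : |t - s| ≤ δ) : sinAt γ s (γ t) ≤ 2 * K * |t - s| := by
  have h1 := h.cross_tangent_chord_le B hst
  have h2 := h.half_le_norm_chord B hst
  have h4 : 0 < |t - s| := abs_pos.2 (sub_ne_zero.2 h0)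
  rw [sinAt, div_le_iff₀ (by linarith)]
  refine h1.trans ?_
  rw [← sq_abs]
  nlinarith [mul_le_mul_of_nonneg_left h2 (mul_pos B.K_pos h4).le]

theorem le_sinAt (h : IsBoundaryParametrization Ω ℓ γ) (B : CurveBounds γ κ₀ K δ) {s t : ℝ}
    (h0 : t ≠ s) (hst : |t - s| ≤ δ) : κ₀ / 4 * |t - s| ≤ sinAt γ s (γ t) := by
  have h1 := h.cross_tangent_chord_ge B hst
  have h2 := h.half_le_norm_chord B hst
  have h3 := h.norm_sub_le s t
  have h4 : 0 < |t - s| := abs_pos.2 (sub_ne_zero.2 h0)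
  rw [sinAt, le_div_iff₀ (by linarith)]
  refine le_trans ?_ h1
  rw [← sq_abs (t - s)]
  have := B.pos
  nlinarith [mul_le_mul_of_nonneg_left h3 (by positivity : 0 ≤ κ₀ / 4 * |t - s|)]

/-- The angle of a short chord is half the curvature times its length, to second order. -/
theorem abs_sinAt_sub_le (h : IsBoundaryParametrization Ω ℓ γ) (B : CurveBounds γ κ₀ K δ) {s t : ℝ}
    (h0 : t ≠ s) (hst : |t - s| ≤ δ) :
    |sinAt γ s (γ t) - curvature γ s / 2 * (|t - s|)| ≤ 2 * K * |t - s| ^ 2 := by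
  have h1 := h.abs_cross_tangent_chord_sub_le B s t
  have h2 := h.half_le_norm_chord B hst
  have h2' := h.norm_chord_ge B s t
  have h3 := h.norm_sub_le s t
  have h4 : 0 < |t - s| := abs_pos.2 (sub_ne_zero.2 h0)
  have h5 : K * |t - s| ≤ 1 / 4 :=
    (mul_le_mul_of_nonneg_left hst B.K_pos.le).trans B.mul_delta_le'
  have h6 : |t - s| ≤ 1 / 4 := hst.trans B.delta_le
  rw [← sq_abs (t - s)] at h1
  rw [sinAt]
  have hr : 0 < ‖γ t - γ s‖ := by linarith
  have hk1 := B.curv_ge s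
  have hk2 := B.curv_le s
  have hκ := B.pos
  have hK := B.K_pos
  generalize |t - s| = g at *
  generalize ‖γ t - γ s‖ = r at *
  generalize cross (deriv γ s) (γ t - γ s) = H at *
  generalize curvature γ s = κ at *
  rw [abs_le] at h1 ⊢
  constructor
  · rw [neg_le_sub_iff_le_add, ← sub_le_iff_le_add, le_div_iff₀ hr]
    by_cases hs : κ / 2 * g - 2 * K * g ^ 2 ≤ 0
    · have : 0 ≤ H := by
        have : K * g * g ^ 2 ≤ κ₀ / 4 * g ^ 2 := by
          have : K * g ≤ κ₀ / 4 := (mul_le_mul_of_nonneg_left hst hK.le).trans B.mul_delta_le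
          gcongr
        nlinarith [sq_nonneg g]
      nlinarith
    · push Not at hs
      have := mul_le_mul_of_nonneg_left h3 hs.le
      nlinarith [pow_pos h4 3]
  · rw [sub_le_iff_le_add, div_le_iff₀ hr]
    have hp : 0 ≤ 2 * K * g ^ 2 + κ / 2 * g := by
      have : 0 ≤ κ := by linarith
      positivity
    have e1 := mul_le_mul_of_nonneg_left h2' hp
    have e2 : κ * g ≤ 1 / 4 := (mul_le_mul_of_nonneg_right hk2 h4.le).trans h5
    have e3 : K * g ^ 3 * (κ * g) ≤ K * g ^ 3 * (1 / 4) := by gcongr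
    have e4 : K * g ^ 3 * (K * g * g) ≤ K * g ^ 3 * (1 / 4 * (1 / 4)) := by gcongr
    have e5 : 0 < K * g ^ 3 := by positivity
    nlinarith

theorem sinAt_eq_of_reflect (h : IsBoundaryParametrization Ω ℓ γ)
    (hΩ : IsSmoothStrictlyConvexDomain Ω) {a b c : ℝ} (hab : γ a ≠ γ b) (hcb : γ c ≠ γ b)
    (hr : cosAt γ b (γ c) = -cosAt γ b (γ a)) : sinAt γ b (γ c) = sinAt γ b (γ a) :=
  sin_eq_of_cos_eq_neg (h.cosAt_sq_add_sinAt_sq hcb) (h.cosAt_sq_add_sinAt_sq hab)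
    (h.sinAt_pos hΩ hcb) (h.sinAt_pos hΩ hab) hr

/-- A chord making a small angle with the tangent at its foot is short, and the sign of the cosine
tells on which side of the foot it lies. -/
theorem exists_near_of_sinAt (h : IsBoundaryParametrization Ω ℓ γ)
    (hΩ : IsSmoothStrictlyConvexDomain Ω) (B : CurveBounds γ κ₀ K δ) {η : ℝ} (hη : 0 < η) :
    ∃ μ > 0, ∀ s t, s < t → t < s + ℓ →
      (sinAt γ s (γ t) ≤ μ → 0 < cosAt γ s (γ t) → t - s < η) ∧
      (sinAt γ t (γ s) ≤ μ → cosAt γ t (γ s) < 0 → t - s < η) := by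
  have hℓ := h.length_pos
  obtain ⟨m, hm, H⟩ := h.exists_cross_lt_imp_near hΩ
    (η := min η (min δ ℓ)) (lt_min hη (lt_min B.delta_pos hℓ))
  have key : ∀ s t, γ t ≠ γ s → |t - s| < ℓ → sinAt γ s (γ t) ≤ m / (2 * ℓ) →
      ∃ k : ℤ, |t - s - k * ℓ| < min η (min δ ℓ) := by
    intro s t hne hlt hs
    refine H s t ?_
    rw [sinAt, div_le_iff₀ (norm_pos_iff.2 (sub_ne_zero.2 hne))] at hs
    have h1 : ‖γ t - γ s‖ ≤ ℓ := (h.norm_sub_le s t).trans hlt.le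
    calc _ ≤ _ := hs
      _ ≤ m / (2 * ℓ) * ℓ := by gcongr
      _ = m / 2 := by field_simp
      _ < m := by linarith
  refine ⟨m / (2 * ℓ), by positivity, fun s t hst htl => ⟨fun hs hc => ?_, fun hs hc => ?_⟩⟩
  · obtain ⟨k, hk⟩ := key s t (h.chord_ne hst htl) (by rw [abs_lt]; constructor <;> linarith) hs
    rw [lt_min_iff, lt_min_iff] at hk
    obtain ⟨k1, k2, k3⟩ := hk
    have hk' := abs_lt.1 k3
    have c1 : (-1 : ℝ) < k := by by_contra hh; push Not at hh; nlinarith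
    have c2 : (k : ℝ) < 2 := by by_contra hh; push Not at hh; nlinarith
    have c1' : -1 < k := by exact_mod_cast c1
    have c2' : k < 2 := by exact_mod_cast c2
    obtain rfl | rfl : k = 0 ∨ k = 1 := by omega
    · simp only [Int.cast_zero, zero_mul, sub_zero] at k1; exact (abs_lt.1 k1).2
    · exfalso
      simp only [Int.cast_one, one_mul] at k2
      have := h.cosAt_mul_pos B (s := s) (t := t - ℓ) (by linarith) (by
        rw [show t - ℓ - s = t - s - ℓ by ring]; exact k2.le)
      rw [h.periodic.sub_eq] at this
      nlinarith
  · obtain ⟨k, hk⟩ := key t s (h.chord_ne hst htl).symm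
      (by rw [abs_lt]; constructor <;> linarith) hs
    rw [lt_min_iff, lt_min_iff] at hk
    obtain ⟨k1, k2, k3⟩ := hk
    have hk' := abs_lt.1 k3
    have c1 : (-2 : ℝ) < k := by by_contra hh; push Not at hh; nlinarith
    have c2 : (k : ℝ) < 1 := by by_contra hh; push Not at hh; nlinarith
    have c1' : -2 < k := by exact_mod_cast c1
    have c2' : k < 1 := by exact_mod_cast c2
    obtain rfl | rfl : k = 0 ∨ k = -1 := by omega
    · simp only [Int.cast_zero, zero_mul, sub_zero] at k1; linarith [(abs_lt.1 k1).1]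
    · exfalso
      simp only [Int.cast_neg, Int.cast_one, neg_mul, one_mul, sub_neg_eq_add] at k2
      have := h.cosAt_mul_pos B (s := t) (t := s + ℓ) (by linarith) (by
        rw [show s + ℓ - t = s - t + ℓ by ring]; exact k2.le)
      rw [h.periodic s] at this
      nlinarith

/-- After (or before) a short link, the billiard orbit has a short link. -/
theorem exists_short_imp_short (h : IsBoundaryParametrization Ω ℓ γ)
    (hΩ : IsSmoothStrictlyConvexDomain Ω) (B : CurveBounds γ κ₀ K δ) :
    ∃ δ₂ > 0, δ₂ ≤ δ ∧ ∀ a b c, a < b → b < a + ℓ → b < c → c < b + ℓ →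
      cosAt γ b (γ c) = -cosAt γ b (γ a) → (b - a ≤ δ₂ → c - b ≤ δ) ∧ (c - b ≤ δ₂ → b - a ≤ δ) := by
  obtain ⟨μ, hμ, H⟩ := h.exists_near_of_sinAt hΩ B B.delta_pos
  have hK := B.K_pos
  refine ⟨min δ (μ / (2 * K)), lt_min B.delta_pos (by positivity), min_le_left _ _, ?_⟩
  intro a b c hab hab' hbc hbc' hr
  have hs := h.sinAt_eq_of_reflect hΩ (h.chord_ne hab hab').symm (h.chord_ne hbc hbc') hr
  constructor
  · intro hle
    rw [le_min_iff, le_div_iff₀ (by positivity)] at hle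
    have hab0 : |a - b| = b - a := by rw [abs_of_neg (by linarith)]; ring
    have e1 := h.sinAt_le B (s := b) (t := a) hab.ne (by rw [hab0]; exact hle.1)
    have e2 := h.cosAt_mul_pos B (s := b) (t := a) hab.ne (by rw [hab0]; exact hle.1)
    refine ((H b c hbc hbc').1 ?_ ?_).le
    · rw [hs]; rw [hab0] at e1; linarith
    · rw [hr]; nlinarith
  · intro hle
    rw [le_min_iff, le_div_iff₀ (by positivity)] at hle
    have hab0 : |c - b| = c - b := by rw [abs_of_pos (by linarith)]
    have e1 := h.sinAt_le B (s := b) (t := c) hbc.ne' (by rw [hab0]; exact hle.1)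
    have e2 := h.cosAt_mul_pos B (s := b) (t := c) hbc.ne' (by rw [hab0]; exact hle.1)
    refine ((H a b hab hab').2 ?_ ?_).le
    · rw [← hs]; rw [hab0] at e1; linarith
    · rw [hr] at e2; nlinarith

/-- Successive short links have almost the same length. -/
theorem abs_log_gap_sub_le (h : IsBoundaryParametrization Ω ℓ γ)
    (hΩ : IsSmoothStrictlyConvexDomain Ω) (B : CurveBounds γ κ₀ K δ) {a b c : ℝ}
    (hab : a < b) (hab' : b < a + ℓ) (hbc : b < c) (hbc' : c < b + ℓ)
    (hr : cosAt γ b (γ c) = -cosAt γ b (γ a)) (h1 : b - a ≤ δ) (h2 : c - b ≤ δ) :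
    |Real.log (c - b) - Real.log (b - a)| ≤
      4 * K / κ₀ * (8 * K / κ₀ + 1) * ((b - a) + (c - b)) := by
  have hs := h.sinAt_eq_of_reflect hΩ (h.chord_ne hab hab').symm (h.chord_ne hbc hbc') hr
  have ha0 : |a - b| = b - a := by rw [abs_of_neg (by linarith)]; ring
  have hc0 : |c - b| = c - b := by rw [abs_of_pos (by linarith)]
  have A1 := h.sinAt_le B (s := b) (t := a) hab.ne (by rw [ha0]; exact h1)
  have A2 := h.le_sinAt B (s := b) (t := a) hab.ne (by rw [ha0]; exact h1)
  have A3 := h.abs_sinAt_sub_le B (s := b) (t := a) hab.ne (by rw [ha0]; exact h1)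
  have C1 := h.sinAt_le B (s := b) (t := c) hbc.ne' (by rw [hc0]; exact h2)
  have C2 := h.le_sinAt B (s := b) (t := c) hbc.ne' (by rw [hc0]; exact h2)
  have C3 := h.abs_sinAt_sub_le B (s := b) (t := c) hbc.ne' (by rw [hc0]; exact h2)
  rw [ha0] at A1 A2 A3
  rw [hc0, hs] at C1 C2 C3
  have hk := B.curv_ge b
  have hκ := B.pos
  have hK := B.K_pos
  have hx : 0 < b - a := by linarith
  have hy : 0 < c - b := by linarith
  generalize b - a = x at *
  generalize c - b = y at *
  generalize sinAt γ b (γ a) = A at *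
  generalize curvature γ b = κ at *
  rw [abs_le] at A3 C3
  have r1 : y ≤ 8 * K / κ₀ * x := by
    rw [div_mul_eq_mul_div, le_div_iff₀ hκ]; nlinarith
  have r2 : x ≤ 8 * K / κ₀ * y := by
    rw [div_mul_eq_mul_div, le_div_iff₀ hκ]; nlinarith
  have d1 : y - x ≤ 4 * K / κ₀ * (x ^ 2 + y ^ 2) := by
    rw [div_mul_eq_mul_div, le_div_iff₀ hκ]
    by_cases hyx : y ≤ x
    · have : 0 ≤ 4 * K * (x ^ 2 + y ^ 2) := by positivity
      nlinarith
    · push Not at hyx; nlinarith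
  have d2 : x - y ≤ 4 * K / κ₀ * (x ^ 2 + y ^ 2) := by
    rw [div_mul_eq_mul_div, le_div_iff₀ hκ]
    by_cases hyx : x ≤ y
    · have : 0 ≤ 4 * K * (x ^ 2 + y ^ 2) := by positivity
      nlinarith
    · push Not at hyx; nlinarith
  have gen : ∀ x y : ℝ, 0 < x → 0 < y → y ≤ 8 * K / κ₀ * x →
      y - x ≤ 4 * K / κ₀ * (x ^ 2 + y ^ 2) →
      Real.log y - Real.log x ≤ 4 * K / κ₀ * (8 * K / κ₀ + 1) * (x + y) := by
    intro x y hx hy r d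
    rw [← Real.log_div hy.ne' hx.ne']
    have l1 := Real.log_le_sub_one_of_pos (div_pos hy hx)
    refine l1.trans ?_
    have : y / x - 1 = (y - x) / x := by field_simp
    rw [this, div_le_iff₀ hx]
    refine d.trans ?_
    have hC : 0 < 4 * K / κ₀ := by positivity
    have hR : 0 < 8 * K / κ₀ := by positivity
    rw [mul_assoc, mul_assoc]
    refine mul_le_mul_of_nonneg_left ?_ hC.le
    have e := mul_le_mul_of_nonneg_left r hy.le
    nlinarith [mul_pos hx hy, mul_pos hR hx, mul_pos (mul_pos hR hx) hx, mul_pos (mul_pos hR hx) hy]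
  rw [abs_le]
  constructor
  · have := gen y x hy hx r2 (by linarith)
    rw [add_comm y x] at this; linarith
  · exact gen x y hx hy r1 d1

end IsBoundaryParametrization

/-! ### Comparability of the gaps of a billiard sequence -/

namespace IsBilliardSeq

variable {ℓ : ℝ} {γ : ℝ → Plane} {t : ℕ → ℝ} {n : ℕ}

theorem mono (h : IsBilliardSeq ℓ γ t n) {m : ℕ} (hm : m ≤ n) : IsBilliardSeq ℓ γ t m :=
  ⟨fun k hk => h.lt_succ k (by omega), fun k hk => h.succ_lt k (by omega),
    fun k hk => h.reflect k (by omega)⟩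

theorem le_of_le (h : IsBilliardSeq ℓ γ t n) {i k : ℕ} (hik : i ≤ k) (hk : k ≤ n) :
    t i ≤ t k := by
  induction k, hik using Nat.le_induction with
  | base => exact le_rfl
  | succ m _ ih => exact (ih (by omega)).trans (h.lt_succ m (by omega)).le

end IsBilliardSeq

namespace IsBoundaryParametrization

variable {Ω : Set Plane} {ℓ : ℝ} {γ : ℝ → Plane} {κ₀ K δ : ℝ}

/-- Along one or two rotations, a billiard orbit with one short link has all its links of
comparable length. -/
theorem exists_gap_comparable (h : IsBoundaryParametrization Ω ℓ γ)
    (hΩ : IsSmoothStrictlyConvexDomain Ω) (B : CurveBounds γ κ₀ K δ) :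
    ∃ δ₁ > 0, ∃ M ≥ 1, δ₁ * M ≤ δ ∧ ∀ (t : ℕ → ℝ) (n : ℕ), IsBilliardSeq ℓ γ t (n + 1) →
      t n - t 0 ≤ 2 * ℓ → ∀ i ≤ n, t (i + 1) - t i ≤ δ₁ → ∀ k ≤ n,
        t (k + 1) - t k ≤ M * (t (i + 1) - t i) ∧ t (i + 1) - t i ≤ M * (t (k + 1) - t k) := by
  obtain ⟨δ₂, hδ₂, hδ₂δ, H⟩ := h.exists_short_imp_short hΩ B
  have hℓ := h.length_pos
  have hK := B.K_pos
  have hκ := B.pos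
  obtain ⟨C, hC⟩ : ∃ C, C = 4 * K / κ₀ * (8 * K / κ₀ + 1) := ⟨_, rfl⟩
  have hC0 : 0 < C := by rw [hC]; positivity
  have hM : 1 ≤ Real.exp (C * (4 * ℓ + 1)) := Real.one_le_exp (by positivity)
  have hMpos : 0 < Real.exp (C * (4 * ℓ + 1)) := Real.exp_pos _
  have hexp : ∀ x y : ℝ, 0 < x → 0 < y → |Real.log y - Real.log x| ≤ C * (4 * ℓ + 1) →
      y ≤ Real.exp (C * (4 * ℓ + 1)) * x ∧ x ≤ Real.exp (C * (4 * ℓ + 1)) * y := by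
    intro x y hx hy hxy
    rw [abs_le] at hxy
    constructor
    · rw [← Real.log_le_log_iff hy (by positivity), Real.log_mul hMpos.ne' hx.ne', Real.log_exp]
      linarith
    · rw [← Real.log_le_log_iff hx (by positivity), Real.log_mul hMpos.ne' hy.ne', Real.log_exp]
      linarith
  refine ⟨δ₂ / Real.exp (C * (4 * ℓ + 1)), by positivity, _, hM, ?_, ?_⟩
  · rw [div_mul_cancel₀ _ hMpos.ne']; exact hδ₂δ
  intro t n ht htn i hi hgi k hk
  have hpos : ∀ k ≤ n, 0 < t (k + 1) - t k := fun k hk => sub_pos.2 (ht.lt_succ k (by omega))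
  have hgi' : Real.exp (C * (4 * ℓ + 1)) * (t (i + 1) - t i) ≤ δ₂ := by
    rw [le_div_iff₀ hMpos] at hgi; linarith
  have hgi1 : t (i + 1) - t i ≤ δ₂ := by
    have := mul_le_mul_of_nonneg_right hM (hpos i hi).le; linarith
  have hδ1 : δ ≤ 1 / 4 := B.delta_le
  -- the logarithm of the gap varies at most like the arclength, as long as the gaps stay short
  have step : ∀ k, k + 1 ≤ n → t (k + 1) - t k ≤ δ → t (k + 2) - t (k + 1) ≤ δ →
      |Real.log (t (k + 2) - t (k + 1)) - Real.log (t (k + 1) - t k)| ≤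
        C * ((t (k + 1) - t k) + (t (k + 2) - t (k + 1))) := by
    intro k hk h1 h2
    rw [hC]
    exact h.abs_log_gap_sub_le hΩ B (ht.lt_succ k (by omega)) (ht.succ_lt k (by omega))
      (ht.lt_succ (k + 1) (by omega)) (ht.succ_lt (k + 1) (by omega)) (ht.reflect k (by omega))
      h1 h2
  have short : ∀ k, k + 1 ≤ n → (t (k + 1) - t k ≤ δ₂ → t (k + 2) - t (k + 1) ≤ δ) ∧
      (t (k + 2) - t (k + 1) ≤ δ₂ → t (k + 1) - t k ≤ δ) := fun k hk =>
    H _ _ _ (ht.lt_succ k (by omega)) (ht.succ_lt k (by omega))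
      (ht.lt_succ (k + 1) (by omega)) (ht.succ_lt (k + 1) (by omega)) (ht.reflect k (by omega))
  have htot : ∀ a b, a ≤ n → b ≤ n → t a - t b ≤ 2 * ℓ := fun a b ha hb => by
    have e1 := ht.le_of_le (i := 0) (k := b) (by omega) (by omega)
    have e2 := ht.le_of_le (i := a) (k := n) (by omega) (by omega)
    linarith
  -- induction away from the `i`-th gap: over two turns the logarithm changes by a bounded amount,
  -- and so the gaps stay short and the induction continues
  have fwd : ∀ k, i ≤ k → k ≤ n → t (k + 1) - t k ≤ δ₂ ∧
      |Real.log (t (k + 1) - t k) - Real.log (t (i + 1) - t i)| ≤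
        C * (2 * (t k - t i) + (t (k + 1) - t k)) := by
    intro k hik
    induction k, hik using Nat.le_induction with
    | base =>
      intro _
      refine ⟨hgi1, ?_⟩
      have := (hpos i hi).le
      rw [sub_self, abs_zero, sub_self]; positivity
    | succ m hm ih =>
      intro hmn
      obtain ⟨i1, i2⟩ := ih (by omega)
      have h1 := (short m hmn).1 i1
      have h2 := step m hmn (i1.trans hδ₂δ) h1
      have h3 : |Real.log (t (m + 1 + 1) - t (m + 1)) - Real.log (t (i + 1) - t i)| ≤
        C * (2 * (t (m + 1) - t i) + (t (m + 1 + 1) - t (m + 1))) := by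
        refine (abs_sub_le _ (Real.log (t (m + 1) - t m)) _).trans ((add_le_add h2 i2).trans ?_)
        exact le_of_eq (by ring)
      refine ⟨?_, h3⟩
      refine ((hexp _ _ (hpos i hi) (hpos (m + 1) hmn) (h3.trans ?_)).1).trans hgi'
      have := htot (m + 1) i hmn hi
      refine mul_le_mul_of_nonneg_left ?_ hC0.le
      have e : t (m + 1 + 1) - t (m + 1) ≤ δ := h1
      linarith
  have bwd : ∀ d, d ≤ i → t (i - d + 1) - t (i - d) ≤ δ₂ ∧
      |Real.log (t (i - d + 1) - t (i - d)) - Real.log (t (i + 1) - t i)| ≤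
        C * (2 * (t (i + 1) - t (i - d)) - (t (i - d + 1) - t (i - d))) := by
    intro d
    induction d with
    | zero =>
      intro _
      refine ⟨by simpa using hgi1, ?_⟩
      have := (hpos i hi).le
      rw [Nat.sub_zero, sub_self, abs_zero]
      refine mul_nonneg hC0.le ?_
      linarith
    | succ d ih =>
      intro hd
      obtain ⟨i1, i2⟩ := ih (by omega)
      obtain ⟨m, hm⟩ : ∃ m, m = i - (d + 1) := ⟨_, rfl⟩
      have hm1 : i - d = m + 1 := by omega
      rw [← hm]
      rw [hm1] at i1 i2
      have hmn : m + 1 ≤ n := by omega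
      have h1 := (short m hmn).2 i1
      have h2 := step m hmn h1 (i1.trans hδ₂δ)
      rw [abs_sub_comm] at h2
      have h3 : |Real.log (t (m + 1) - t m) - Real.log (t (i + 1) - t i)| ≤
        C * (2 * (t (i + 1) - t m) - (t (m + 1) - t m)) := by
        refine (abs_sub_le _ (Real.log (t (m + 1 + 1) - t (m + 1))) _).trans
          ((add_le_add h2 i2).trans ?_)
        exact le_of_eq (by ring)
      refine ⟨?_, h3⟩
      refine ((hexp _ _ (hpos i hi) (hpos m (by omega)) (h3.trans ?_)).1).trans hgi'
      have := htot i m hi (by omega)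
      refine mul_le_mul_of_nonneg_left ?_ hC0.le
      have := hpos m (by omega)
      linarith
  rcases le_total i k with hik | hki
  · obtain ⟨f1, f2⟩ := fwd k hik hk
    refine hexp _ _ (hpos i hi) (hpos k hk) (f2.trans (mul_le_mul_of_nonneg_left ?_ hC0.le))
    linarith [htot k i hk hi]
  · obtain ⟨f1, f2⟩ := bwd (i - k) (by omega)
    rw [show i - (i - k) = k by omega] at f1 f2
    refine hexp _ _ (hpos i hi) (hpos k hk) (f2.trans (mul_le_mul_of_nonneg_left ?_ hC0.le))
    linarith [htot i k hi hk, hpos k hk]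

/-- The links of an orbit of `n` links making about one rotation have length of order `1 / n`. -/
theorem exists_gap_bounds (h : IsBoundaryParametrization Ω ℓ γ)
    (hΩ : IsSmoothStrictlyConvexDomain Ω) (B : CurveBounds γ κ₀ K δ) :
    ∃ m > 0, ∃ M > 0, ∃ n₀ : ℕ, ∀ (t : ℕ → ℝ) (n : ℕ), n₀ ≤ n → IsBilliardSeq ℓ γ t (n + 1) →
      t n - t 0 ≤ 2 * ℓ → ∀ k ≤ n, t (k + 1) - t k ≤ M / (n + 1) ∧
        (ℓ / 2 ≤ t (n + 1) - t 0 → m / (n + 1) ≤ t (k + 1) - t k) := by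
  obtain ⟨δ₁, hδ₁, M, hM, hδM, H⟩ := h.exists_gap_comparable hΩ B
  have hℓ := h.length_pos
  obtain ⟨n₀, hn₀⟩ := exists_nat_gt (2 * ℓ / δ₁)
  have hM0 : 0 < M := by linarith
  refine ⟨ℓ / 2 / M, by positivity, M * (4 * ℓ), by positivity, n₀ + 1, ?_⟩
  intro t n hn ht htn k hk
  have hn1 : 0 < n := by omega
  have hn1' : (0 : ℝ) < n := by exact_mod_cast hn1
  have hn1'' : (1 : ℝ) ≤ n := by exact_mod_cast hn1
  have hsum : ∀ m, ∑ i ∈ Finset.range m, (t (i + 1) - t i) = t m - t 0 := fun m =>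
    Finset.sum_range_sub t m
  -- the shortest gap is below the average, and the longest one above
  obtain ⟨i, hi, hgi⟩ : ∃ i < n, t (i + 1) - t i ≤ 2 * ℓ / n := by
    by_contra hc
    push Not at hc
    have h1 : ∑ i ∈ Finset.range n, 2 * ℓ / (n : ℝ) < ∑ i ∈ Finset.range n, (t (i + 1) - t i) :=
      Finset.sum_lt_sum_of_nonempty (Finset.nonempty_range_iff.2 hn1.ne')
        fun i hi => hc i (Finset.mem_range.1 hi)
    rw [hsum, Finset.sum_const, Finset.card_range, nsmul_eq_mul, mul_div_cancel₀ _ hn1'.ne'] at h1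
    linarith
  have hgi1 : t (i + 1) - t i ≤ δ₁ := by
    refine hgi.trans ?_
    rw [div_le_iff₀ hn1']
    rw [div_lt_iff₀ hδ₁] at hn₀
    have : (n₀ : ℝ) ≤ n := by exact_mod_cast (by omega : n₀ ≤ n)
    nlinarith
  have hcomp := H t n ht htn i hi.le hgi1
  have hgi2 : t (i + 1) - t i ≤ 4 * ℓ / (n + 1) := by
    refine hgi.trans ?_
    rw [div_le_div_iff₀ hn1' (by positivity)]
    nlinarith
  refine ⟨?_, fun htot => ?_⟩
  · refine (hcomp k hk).1.trans ?_
    rw [mul_div_assoc]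
    gcongr
  · obtain ⟨l, hl, hgl⟩ : ∃ l < n + 1, ℓ / 2 / (n + 1) ≤ t (l + 1) - t l := by
      by_contra hc
      push Not at hc
      have h1 : ∑ i ∈ Finset.range (n + 1), (t (i + 1) - t i) <
          ∑ i ∈ Finset.range (n + 1), ℓ / 2 / ((n : ℝ) + 1) :=
        Finset.sum_lt_sum_of_nonempty (Finset.nonempty_range_iff.2 (by omega))
          fun i hi => hc i (Finset.mem_range.1 hi)
      rw [hsum, Finset.sum_const, Finset.card_range, nsmul_eq_mul] at h1
      push_cast at h1
      rw [mul_div_cancel₀ _ (by positivity)] at h1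
      linarith
    have hkδ : t (k + 1) - t k ≤ δ₁ ∨ δ₁ < t (k + 1) - t k := le_or_gt _ _
    have c1 := (hcomp k hk).2
    have c2 := (hcomp l (by omega)).1
    rcases hkδ with hkδ | hkδ
    · have := (H t n ht htn k hk hkδ l (by omega)).1
      rw [div_right_comm, div_le_iff₀ hM0]
      linarith
    · -- a link longer than the threshold exceeds every short one
      by_cases hlδ : t (l + 1) - t l ≤ δ₁
      · have := (H t n ht htn l (by omega) hlδ k hk).2
        rw [div_right_comm, div_le_iff₀ hM0]
        linarith
      · have e1 : ℓ / 2 / M / (n + 1) ≤ 2 * ℓ / n := by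
          rw [div_div, div_le_div_iff₀ (by positivity) hn1']
          have : (n : ℝ) ≤ M * (n + 1) := by nlinarith
          nlinarith
        have e2 : 2 * ℓ / n ≤ δ₁ := by
          rw [div_le_iff₀ hn1']
          rw [div_lt_iff₀ hδ₁] at hn₀
          have : (n₀ : ℝ) ≤ n := by exact_mod_cast (by omega : n₀ ≤ n)
          nlinarith
        linarith

end IsBoundaryParametrization

/-! ### The Lazutkin parameter -/

namespace IsBoundaryParametrization

variable {Ω : Set Plane} {ℓ : ℝ} {γ : ℝ → Plane} {κ₀ K δ : ℝ}

theorem contDiff_curvature (h : IsBoundaryParametrization Ω ℓ γ) : ContDiff ℝ ∞ (curvature γ) := by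
  have h1 := h.contDiff_deriv
  have h2 := h.contDiff_deriv2
  rw [contDiff_euclidean] at h1 h2
  exact ((h1 0).mul (h2 1)).sub ((h1 1).mul (h2 0))

/-- The Lazutkin parameter `u = ∫ κ ^ (2 / 3) ds`, or rather its inverse `u ↦ s u`. -/
theorem exists_lazutkin (h : IsBoundaryParametrization Ω ℓ γ) :
    ∃ s U : ℝ → ℝ, ContDiff ℝ ∞ s ∧ StrictMono s ∧ Continuous U ∧ (∀ t, s (U t) = t) ∧
      (∀ u, 0 < deriv s u) ∧ ∀ u, deriv s u ^ 3 * curvature γ (s u) ^ 2 = 1 := by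
  obtain ⟨κ₀, K, δ, B⟩ := h.exists_bounds
  have hκ := h.contDiff_curvature
  have hpos : ∀ t, 0 < curvature γ t := h.curvature_pos
  obtain ⟨g, hg⟩ : ∃ g : ℝ → ℝ, g = fun t => curvature γ t ^ (2 / 3 : ℝ) := ⟨_, rfl⟩
  have hgs : ContDiff ℝ ∞ g := by
    rw [hg]; exact hκ.rpow_const_of_ne fun t => (hpos t).ne'
  have hgpos : ∀ t, 0 < g t := fun t => by rw [hg]; exact Real.rpow_pos_of_pos (hpos t) _
  obtain ⟨c, hc, hgc⟩ : ∃ c > 0, ∀ t, c ≤ g t := by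
    refine ⟨κ₀ ^ (2 / 3 : ℝ), Real.rpow_pos_of_pos B.pos _, fun t => ?_⟩
    rw [hg]; exact Real.rpow_le_rpow B.pos.le (B.curv_ge t) (by norm_num)
  have hg3 : ∀ t, g t ^ 3 = curvature γ t ^ 2 := fun t => by
    rw [hg]; simp only
    rw [← Real.rpow_natCast, ← Real.rpow_mul (hpos t).le, ← Real.rpow_natCast]
    norm_num
  obtain ⟨U, hU⟩ : ∃ U : ℝ → ℝ, U = fun t => ∫ x in (0 : ℝ)..t, g x := ⟨_, rfl⟩
  have hUd : ∀ t, HasDerivAt U (g t) t := fun t => by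
    rw [hU]
    exact intervalIntegral.integral_hasDerivAt_right (hgs.continuous.intervalIntegrable _ _)
      (hgs.continuous.stronglyMeasurableAtFilter _ _) hgs.continuous.continuousAt
  have hU' : deriv U = g := funext fun t => (hUd t).deriv
  have hUs : ContDiff ℝ ∞ U := by
    rw [contDiff_infty_iff_deriv]
    exact ⟨fun t => (hUd t).differentiableAt, hU' ▸ hgs⟩
  have hUmono : StrictMono U := strictMono_of_deriv_pos fun t => by rw [hU']; exact hgpos t
  have hUd' : ∀ t, HasDerivAt (fun t => U t - c * t) (g t - c * 1) t := fun t =>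
    (hUd t).sub ((hasDerivAt_id t).const_mul c)
  have hUc : Monotone fun t => U t - c * t :=
    monotone_of_deriv_nonneg (fun t => (hUd' t).differentiableAt) fun t => by
      rw [(hUd' t).deriv]
      have := hgc t
      simp only [mul_one]; linarith
  have hU0 : U 0 = 0 := by rw [hU]; simp
  have hsurj : Function.Surjective U := by
    refine hUs.continuous.surjective ?_ ?_
    · refine Filter.tendsto_atTop_mono' _ ?_ (Filter.tendsto_id.const_mul_atTop hc)
      filter_upwards [Filter.eventually_ge_atTop 0] with t ht
      have := hUc ht
      simp only [hU0, mul_zero, sub_zero] at this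
      simp only [id]; linarith
    · refine Filter.tendsto_atBot_mono' _ ?_ (Filter.tendsto_id.const_mul_atBot hc)
      filter_upwards [Filter.eventually_le_atBot 0] with t ht
      have := hUc ht
      simp only [hU0, mul_zero, sub_zero] at this
      simp only [id]; linarith
  obtain ⟨e, he⟩ : ∃ e : ℝ ≃o ℝ, ⇑e = U := ⟨hUmono.orderIsoOfSurjective U hsurj, rfl⟩
  have hes : ContDiff ℝ ∞ e.symm := by
    refine (e.toHomeomorph).contDiff_symm_deriv (f' := g) (fun t => (hgpos t).ne') (fun t => ?_) ?_
    · have := hUd t; rw [← he] at this; exact this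
    · have := hUs; rw [← he] at this; exact this
  have hd : ∀ u, deriv e.symm u = (g (e.symm u))⁻¹ := fun u => by
    have h1 : HasDerivAt e.symm (deriv e.symm u) u := (hes.differentiable (by simp) u).hasDerivAt
    have h2 := (hUd (e.symm u)).comp u h1
    have h3 : U ∘ e.symm = id := funext fun x => by simp [← he]
    rw [h3] at h2
    have h4 := h2.unique (hasDerivAt_id u)
    exact eq_inv_of_mul_eq_one_right h4
  refine ⟨e.symm, U, hes, e.symm.strictMono, hUs.continuous, fun t => by simp [← he],
    fun u => by rw [hd]; exact inv_pos.2 (hgpos _), fun u => ?_⟩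
  rw [hd, inv_pow, hg3]
  exact inv_mul_cancel₀ (pow_ne_zero 2 (hpos _).ne')

theorem inner_tangent_deriv3 (h : IsBoundaryParametrization Ω ℓ γ) (t : ℝ) :
    inner ℝ (deriv γ t) (deriv (deriv (deriv γ)) t) = -curvature γ t ^ 2 := by
  have h1 := (h.hasDerivAt2 t).inner ℝ (h.hasDerivAt3 t)
  have h2 : (fun t => inner ℝ (deriv γ t) (deriv (deriv γ) t)) = fun _ => (0 : ℝ) :=
    funext h.inner_tangent_normal
  rw [h2] at h1
  have h3 := h1.unique (hasDerivAt_const t 0)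
  rw [h.inner_normal] at h3
  have : curvature γ t * cross (deriv γ t) (deriv (deriv γ) t) = curvature γ t ^ 2 := by
    rw [curvature]; ring
  linarith

theorem inner_normal_self (h : IsBoundaryParametrization Ω ℓ γ) (t : ℝ) :
    inner ℝ (deriv (deriv γ) t) (deriv (deriv γ) t) = curvature γ t ^ 2 := by
  rw [h.inner_normal, curvature]; ring

/-- The squared chord is `σ² (1 - σ² b)`, where `b` is smooth and equals `κ² / 12` on the
diagonal. -/
theorem exists_norm_chord_sq (h : IsBoundaryParametrization Ω ℓ γ) :
    ∃ b : ℝ × ℝ → ℝ, ContDiff ℝ ∞ b ∧ (∀ t, b (t, 0) = curvature γ t ^ 2 / 12) ∧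
      ∀ t σ, ‖γ (t + σ) - γ t‖ ^ 2 = σ ^ 2 * (1 - σ ^ 2 * b (t, σ)) := by
  have s3 := h.contDiff_deriv3
  -- the remainder of the second order Taylor expansion, in integral form
  obtain ⟨E, hE⟩ : ∃ E : ℝ × ℝ → Plane, E = fun p => ∫ x in (0 : ℝ)..1,
    ((1 - x) ^ 2 / 2) • deriv (deriv (deriv γ)) (p.1 + x * p.2) := ⟨_, rfl⟩
  have hEs : ContDiff ℝ ∞ E := by
    rw [contDiff_infty]
    intro n
    rw [hE]
    refine contDiff_intervalIntegral_param n (fun q : (ℝ × ℝ) × ℝ =>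
      ((1 - q.2) ^ 2 / 2) • deriv (deriv (deriv γ)) (q.1.1 + q.2 * q.1.2)) ?_
    have s3' : ContDiff ℝ n (deriv (deriv (deriv γ))) := s3.of_le (by exact_mod_cast le_top)
    have a1 : ContDiff ℝ n fun q : (ℝ × ℝ) × ℝ => (1 - q.2) ^ 2 / 2 := by fun_prop
    have a2 : ContDiff ℝ n fun q : (ℝ × ℝ) × ℝ => q.1.1 + q.2 * q.1.2 := by fun_prop
    exact a1.smul (s3'.comp a2)
  have hE0 : ∀ t, E (t, 0) = (1 / 6 : ℝ) • deriv (deriv (deriv γ)) t := fun t => by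
    rw [hE]
    simp only [mul_zero, add_zero]
    rw [intervalIntegral.integral_smul_const]
    congr 1
    have : ∀ x ∈ uIcc (0 : ℝ) 1,
        HasDerivAt (fun x : ℝ => -((1 - x) ^ 3 / 6)) ((1 - x) ^ 2 / 2) x := by
      intro x _
      have := ((((hasDerivAt_id x).const_sub 1).pow 3).div_const 6).neg
      exact this.congr_deriv (by simp; ring)
    rw [intervalIntegral.integral_eq_sub_of_hasDerivAt this
      ((by fun_prop : Continuous fun x : ℝ => (1 - x) ^ 2 / 2).intervalIntegrable _ _)]
    norm_num
  have hEe : ∀ t σ, γ (t + σ) - γ t = σ • deriv γ t + (σ ^ 2 / 2) • deriv (deriv γ) t +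
      σ ^ 3 • E (t, σ) := by
    intro t σ
    have hd : ∀ x ∈ uIcc (0 : ℝ) 1, HasDerivAt (fun x : ℝ => γ (t + x * σ) +
        (σ * (1 - x)) • deriv γ (t + x * σ) +
        (σ ^ 2 * (1 - x) ^ 2 / 2) • deriv (deriv γ) (t + x * σ))
        (σ ^ 3 • (((1 - x) ^ 2 / 2) • deriv (deriv (deriv γ)) (t + x * σ))) x := by
      intro x _
      have e0 : HasDerivAt (fun x : ℝ => t + x * σ) σ x := by
        simpa using ((hasDerivAt_id x).mul_const σ).const_add t
      have e1 := (h.hasDerivAt (t + x * σ)).scomp x e0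
      have e2 := (h.hasDerivAt2 (t + x * σ)).scomp x e0
      have e3 := (h.hasDerivAt3 (t + x * σ)).scomp x e0
      have f1 := ((hasDerivAt_id x).const_sub 1).const_mul σ
      have f2 := ((((hasDerivAt_id x).const_sub 1).pow 2).const_mul (σ ^ 2)).div_const 2
      have := (e1.add (f1.smul e2)).add (f2.smul e3)
      refine this.congr_deriv ?_
      simp only [id, Function.comp, Pi.pow_apply]
      module
    have hi := intervalIntegral.integral_eq_sub_of_hasDerivAt hd (by
      have := s3.continuous
      exact (by fun_prop : Continuous fun x : ℝ => σ ^ 3 • (((1 - x) ^ 2 / 2) •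
        deriv (deriv (deriv γ)) (t + x * σ))).intervalIntegrable _ _)
    rw [intervalIntegral.integral_smul] at hi
    rw [hE]
    simp only
    rw [hi]
    simp only [one_mul, zero_mul, add_zero, sub_self, sub_zero, mul_zero, mul_one]
    norm_num
    module
  refine ⟨fun p => -(curvature γ p.1 ^ 2 / 4 + 2 * inner ℝ (deriv γ p.1) (E p) +
    p.2 * inner ℝ (deriv (deriv γ) p.1) (E p) + p.2 ^ 2 * inner ℝ (E p) (E p)), ?_, ?_, ?_⟩
  · have k := h.contDiff_curvature.comp (contDiff_fst (𝕜 := ℝ) (E := ℝ) (F := ℝ))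
    have d1 := h.contDiff_deriv.comp (contDiff_fst (𝕜 := ℝ) (E := ℝ) (F := ℝ))
    have d2 := h.contDiff_deriv2.comp (contDiff_fst (𝕜 := ℝ) (E := ℝ) (F := ℝ))
    exact ((((k.pow 2).div_const 4).add (contDiff_const.mul (d1.inner ℝ hEs))).add
      (contDiff_snd.mul (d2.inner ℝ hEs))).add ((contDiff_snd.pow 2).mul (hEs.inner ℝ hEs)) |>.neg
  · intro t
    simp only [hE0, inner_smul_right, h.inner_tangent_deriv3]
    ring
  · intro t σ
    rw [← real_inner_self_eq_norm_sq, hEe]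
    simp only [inner_add_left, inner_add_right, inner_smul_left, inner_smul_right,
      h.inner_tangent_self, h.inner_tangent_normal, h.inner_normal_self]
    rw [real_inner_comm (deriv γ t) (deriv (deriv γ) t), h.inner_tangent_normal,
      real_inner_comm (deriv γ t) (E (t, σ)), real_inner_comm (deriv (deriv γ) t) (E (t, σ))]
    simp
    ring

end IsBoundaryParametrization

/-! ### Expansion of the action of a link -/

/-- Partial derivative in `u` of the action `(s v - s u) - ‖γ (s v) - γ (s u)‖` of a link. -/
noncomputable def actionLeft (γ : ℝ → Plane) (s : ℝ → ℝ) (u v : ℝ) : ℝ :=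
  -(deriv s u * (1 - cosAt γ (s u) (γ (s v))))

/-- Partial derivative in `v` of the action `(s v - s u) - ‖γ (s v) - γ (s u)‖` of a link. -/
noncomputable def actionRight (γ : ℝ → Plane) (s : ℝ → ℝ) (u v : ℝ) : ℝ :=
  deriv s v * (1 + cosAt γ (s v) (γ (s u)))

theorem hasDerivAt_norm {f : ℝ → Plane} {f' : Plane} {t : ℝ} (hf : HasDerivAt f f' t)
    (h0 : f t ≠ 0) : HasDerivAt (fun t => ‖f t‖) (inner ℝ (f t) f' / ‖f t‖) t := by
  have h1 := hf.norm_sq.sqrt (pow_ne_zero 2 (norm_ne_zero_iff.2 h0))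
  simp only [Real.sqrt_sq (norm_nonneg _)] at h1
  refine h1.congr_deriv ?_
  have := norm_ne_zero_iff.2 h0
  field_simp

/-- At `d = 0` the quotient in Hadamard's lemma is the derivative. -/
theorem eq_of_eq_add_smul {f W : ℝ × ℝ → ℝ} (hW : ContDiff ℝ ∞ W)
    (hfW : ∀ u d, f (u, d) = f (u, 0) + d * W (u, d)) {u c : ℝ}
    (hf : HasDerivAt (fun d => f (u, d)) c 0) : W (u, 0) = c := by
  have hWd : HasDerivAt (fun d => W (u, d)) (deriv (fun d => W (u, d)) 0) 0 := by
    have : ContDiff ℝ ∞ fun d => W (u, d) := hW.comp (by fun_prop)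
    exact (this.differentiable (by simp) 0).hasDerivAt
  have h1 : HasDerivAt (fun d => f (u, 0) + d * W (u, d))
      (1 * W (u, 0) + 0 * deriv (fun d => W (u, d)) 0) 0 :=
    ((hasDerivAt_id (0 : ℝ)).mul hWd).const_add _
  have h2 : (fun d => f (u, d)) = fun d => f (u, 0) + d * W (u, d) := funext (hfW u)
  rw [h2] at hf
  have := h1.unique hf
  linarith

namespace IsBoundaryParametrization

variable {Ω : Set Plane} {ℓ : ℝ} {γ : ℝ → Plane} {κ₀ K δ : ℝ} {s : ℝ → ℝ}

/-- In the Lazutkin parameter the action of a link is `Δ ^ 3 / 24 + Δ ^ 4 Q` with `Q` smooth, so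
that its leading part does not depend on the base point. -/
theorem exists_action_expansion (h : IsBoundaryParametrization Ω ℓ γ)
    (hs : ContDiff ℝ ∞ s) (hmono : StrictMono s)
    (hκ : ∀ u, deriv s u ^ 3 * curvature γ (s u) ^ 2 = 1) (a b : ℝ) :
    ∃ D > 0, D ≤ 1 ∧ ∃ (O : Set (ℝ × ℝ)) (Q : ℝ × ℝ → ℝ), IsOpen O ∧ ContDiffOn ℝ ∞ Q O ∧
      Icc a b ×ˢ Icc 0 D ⊆ O ∧
      ∀ p ∈ O, 0 < p.2 → γ (s (p.1 + p.2)) ≠ γ (s p.1) ∧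
        s (p.1 + p.2) - s p.1 - ‖γ (s (p.1 + p.2)) - γ (s p.1)‖ = p.2 ^ 3 / 24 + p.2 ^ 4 * Q p := by
  obtain ⟨B, hB, hB0, hBe⟩ := h.exists_norm_chord_sq
  obtain ⟨W, hW, hWe⟩ := exists_contDiff_add_smul (fun p : ℝ × ℝ => s (p.1 + p.2))
    (hs.comp (by fun_prop))
  simp only [smul_eq_mul, add_zero] at hWe
  have hW0 : ∀ u, W (u, 0) = deriv s u := fun u => by
    refine eq_of_eq_add_smul (f := fun p : ℝ × ℝ => s (p.1 + p.2)) hW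
      (fun u d => by simp only [add_zero]; exact hWe u d) ?_
    have h1 : HasDerivAt s (deriv s u) (u + 0) := by
      rw [add_zero]; exact (hs.differentiable (by simp) u).hasDerivAt
    exact h1.comp_const_add u 0
  obtain ⟨β, hβ⟩ : ∃ β : ℝ × ℝ → ℝ, β = fun p => B (s p.1, p.2 * W p) := ⟨_, rfl⟩
  have hβs : ContDiff ℝ ∞ β := by
    rw [hβ]
    exact hB.comp ((hs.comp contDiff_fst).prodMk (contDiff_snd.mul hW))
  obtain ⟨V, hV⟩ : ∃ V : ℝ × ℝ → ℝ, V = fun p => W p ^ 3 * β p := ⟨_, rfl⟩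
  have hVs : ContDiff ℝ ∞ V := by rw [hV]; exact (hW.pow 3).mul hβs
  obtain ⟨H, hH, hHe⟩ := exists_contDiff_add_smul V hVs
  -- this is where the Lazutkin parameter enters: `s' ^ 3 κ ^ 2 = 1`
  have hV0 : ∀ u, V (u, 0) = 1 / 12 := fun u => by
    rw [hV, hβ]
    simp only [zero_mul, hB0, hW0]
    linear_combination (1 / 12) * hκ u
  simp only [hV0, smul_eq_mul] at hHe
  obtain ⟨z, hz⟩ : ∃ z : ℝ × ℝ → ℝ, z = fun p => p.2 ^ 2 * (W p ^ 2 * β p) := ⟨_, rfl⟩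
  have hzs : ContDiff ℝ ∞ z := by
    rw [hz]; exact (contDiff_snd.pow 2).mul ((hW.pow 2).mul hβs)
  have hcpt : IsCompact (Icc a b ×ˢ Icc (0 : ℝ) 1) := isCompact_Icc.prod isCompact_Icc
  obtain ⟨C, hC⟩ := hcpt.exists_bound_of_continuousOn
    ((hW.pow 2).mul hβs).continuous.continuousOn
  obtain ⟨D, hD0, hD1, hDC⟩ : ∃ D > 0, D ≤ 1 ∧ D * C ≤ 1 / 2 := by
    refine ⟨min 1 (1 / (2 * (|C| + 1))), by positivity, min_le_left _ _, ?_⟩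
    calc _ ≤ min 1 (1 / (2 * (|C| + 1))) * (|C| + 1) := by
          gcongr; linarith [le_abs_self C]
      _ ≤ 1 / (2 * (|C| + 1)) * (|C| + 1) := by gcongr; exact min_le_right _ _
      _ = 1 / 2 := by field_simp
  have hρs : ContDiffOn ℝ ∞ (fun p => Real.sqrt (1 - z p)) {p | z p < 1} := fun p hp =>
    ((contDiff_const.sub hzs).contDiffAt.sqrt (by
      have : z p < 1 := hp
      linarith)).contDiffWithinAt
  refine ⟨D, hD0, hD1, {p | z p < 1}, fun p => H p / (1 + Real.sqrt (1 - z p)) +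
    p.2 * (W p ^ 2 * β p) / (24 * (1 + Real.sqrt (1 - z p)) ^ 2),
    isOpen_lt hzs.continuous continuous_const, ?_, ?_, ?_⟩
  · refine ContDiffOn.add (hH.contDiffOn.div (contDiffOn_const.add hρs) fun p _ => ?_)
      (ContDiffOn.div (contDiff_snd.mul ((hW.pow 2).mul hβs)).contDiffOn
        (contDiffOn_const.mul ((contDiffOn_const.add hρs).pow 2)) fun p _ => ?_)
    · positivity
    · positivity
  · rintro p ⟨hp1, hp2⟩
    have h1 := hC p ⟨hp1, hp2.1, hp2.2.trans hD1⟩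
    have h2 := (abs_le.1 (Real.norm_eq_abs _ ▸ h1)).2
    change z p < 1
    rw [hz]
    have hC0 : 0 ≤ C := (norm_nonneg _).trans h1
    calc p.2 ^ 2 * (W p ^ 2 * β p) ≤ p.2 ^ 2 * C := by gcongr
      _ ≤ D ^ 2 * C := by have := hp2.1; have := hp2.2; gcongr
      _ = D * (D * C) := by ring
      _ ≤ 1 * (1 / 2) := by gcongr
      _ < 1 := by norm_num
  · rintro ⟨u, d⟩ hp hd
    simp only at hd ⊢
    have hzp : z (u, d) < 1 := hp
    obtain ⟨ρ, hρ⟩ : ∃ ρ, ρ = Real.sqrt (1 - z (u, d)) := ⟨_, rfl⟩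
    have hρ0 : 0 ≤ ρ := hρ ▸ Real.sqrt_nonneg _
    have hρ2 : ρ ^ 2 = 1 - z (u, d) := by rw [hρ, Real.sq_sqrt (by linarith)]
    have hσ : 0 < d * W (u, d) := by
      have := hmono (show u < u + d by linarith)
      rw [hWe] at this; linarith
    have hn : ‖γ (s (u + d)) - γ (s u)‖ = d * W (u, d) * ρ := by
      have e1 := hBe (s u) (d * W (u, d))
      rw [← hWe] at e1
      have e2 : B (s u, d * W (u, d)) = β (u, d) := by rw [hβ]
      have e3 : (d * W (u, d)) ^ 2 * β (u, d) = z (u, d) := by rw [hz]; ring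
      rw [e2, e3, ← hρ2, ← mul_pow] at e1
      exact (pow_left_inj₀ (norm_nonneg _) (by positivity) two_ne_zero).1 e1
    have hρpos : 0 < ρ := hρ ▸ Real.sqrt_pos.2 (by linarith)
    refine ⟨fun hc => (mul_pos hσ hρpos).ne' (by rw [← hn, hc, sub_self, norm_zero]), ?_⟩
    rw [hn, ← hρ, hWe]
    have e4 : W (u, d) ^ 3 * β (u, d) = 1 / 12 + d * H (u, d) := by rw [← hHe, hV]
    have e5 : d ^ 2 * (W (u, d) ^ 2 * β (u, d)) = 1 - ρ ^ 2 := by rw [hρ2, hz]; ring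
    have e6 : (1 + ρ) ≠ 0 := by positivity
    field_simp
    linear_combination (24 * d ^ 3 * (1 + ρ)) * e4 +
      (-(24 * d * W (u, d) * (1 + ρ)) - d ^ 3) * e5

end IsBoundaryParametrization

/-! ### Monotonicity of the action of a link -/

/-- The algebra behind the monotonicity of the action. Between the link from `u` to `u + d` and the
link from `u'` to `u' + d'`, with `ξ = u' - u` and `η = d' - d`, the derivative of the action in the
right end varies by `(d + d') / 8 * η + e`, and the sum of its two derivatives by `f`, where `e` and
`f` are small. -/
theorem action_monotone_algebra {C μ d d' ξ η e f : ℝ} (hC0 : 0 ≤ C) (hμ0 : 0 < μ) (hμ1 : μ ≤ 1)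
    (hd0 : 0 < d) (hd0' : 0 < d') (hμ : d ≤ μ) (hμ' : d' ≤ μ)
    (hRb : |e| ≤ 4 * C * μ ^ 2 * |η| + C * μ ^ 3 * |ξ|)
    (L : |f| ≤ 5 * C * μ ^ 3 * |η| + C * μ ^ 4 * |ξ|) :
    ((d + d') / 8 - (20 * C + 2) * μ ^ 2) * η ^ 2 - (20 * C + 2) * μ ^ 4 * ξ ^ 2 ≤
        (f - ((d + d') / 8 * η + e)) * ξ + ((d + d') / 8 * η + e) * (ξ + η) ∧
      |f - ((d + d') / 8 * η + e)| ≤ (20 * C + 2) * μ * (|ξ| + |ξ + η|) ∧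
      |(d + d') / 8 * η + e| ≤ (20 * C + 2) * μ * (|ξ| + |ξ + η|) := by
  have p1 : μ ^ 2 ≤ μ := by nlinarith
  have p2 : μ ^ 3 ≤ μ := by nlinarith [sq_nonneg μ]
  have p3 : μ ^ 4 ≤ μ := by nlinarith [sq_nonneg μ]
  have aη := abs_nonneg η
  have aξ := abs_nonneg ξ
  have tri : |η| ≤ |ξ| + |ξ + η| := by
    have := abs_sub (ξ + η) ξ
    rw [add_sub_cancel_left] at this; linarith
  have Rb : |(d + d') / 8 * η + e| ≤ (1 / 4 + 4 * C) * μ * |η| + C * μ * |ξ| := by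
    refine (abs_add_le _ _).trans ?_
    rw [abs_mul, abs_of_nonneg (by positivity : 0 ≤ (d + d') / 8)]
    have q1 : (d + d') / 8 * |η| ≤ μ / 4 * |η| :=
      mul_le_mul_of_nonneg_right (by linarith) aη
    have q2 : 4 * C * μ ^ 2 * |η| ≤ 4 * C * μ * |η| := by gcongr
    have q3 : C * μ ^ 3 * |ξ| ≤ C * μ * |ξ| := by gcongr
    linarith
  have Fb : |f| ≤ 5 * C * μ * |η| + C * μ * |ξ| := by
    have q2 : 5 * C * μ ^ 3 * |η| ≤ 5 * C * μ * |η| := by gcongr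
    have q3 : C * μ ^ 4 * |ξ| ≤ C * μ * |ξ| := by gcongr
    linarith
  have hCμ : 0 ≤ C * μ := by positivity
  have t1 := mul_le_mul_of_nonneg_left tri hCμ
  have t2 := mul_le_mul_of_nonneg_left tri hμ0.le
  have t3 : 0 ≤ C * μ * |ξ| := by positivity
  have t4 : 0 ≤ C * μ * |ξ + η| := by positivity
  have t5 : 0 ≤ μ * |ξ| := by positivity
  have t6 : 0 ≤ μ * |ξ + η| := by positivity
  refine ⟨?_, ?_, ?_⟩
  · have w1 : |e * η| ≤ (4 * C * μ ^ 2 * |η| + C * μ ^ 3 * |ξ|) * |η| := by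
      rw [abs_mul]; gcongr
    have w2 : |f * ξ| ≤ (5 * C * μ ^ 3 * |η| + C * μ ^ 4 * |ξ|) * |ξ| := by
      rw [abs_mul]; gcongr
    have w3 := neg_abs_le (e * η)
    have w4 := neg_abs_le (f * ξ)
    have w5 : 2 * (μ ^ 3 * (|η| * |ξ|)) ≤ μ ^ 2 * η ^ 2 + μ ^ 4 * ξ ^ 2 := by
      rw [← sq_abs η, ← sq_abs ξ]
      nlinarith [sq_nonneg (μ * |η| - μ ^ 2 * |ξ|)]
    have w6 := mul_le_mul_of_nonneg_left w5 hC0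
    have w7 : |η| * |η| = η ^ 2 := by rw [← sq_abs]; ring
    have w8 : |ξ| * |ξ| = ξ ^ 2 := by rw [← sq_abs]; ring
    have w9 : 0 ≤ μ ^ 2 * η ^ 2 := by positivity
    have w10 : 0 ≤ μ ^ 4 * ξ ^ 2 := by positivity
    have w11 : 0 ≤ C * (μ ^ 2 * η ^ 2) := by positivity
    have w12 : 0 ≤ C * (μ ^ 4 * ξ ^ 2) := by positivity
    have z1 : (4 * C * μ ^ 2 * |η| + C * μ ^ 3 * |ξ|) * |η| =
      4 * (C * (μ ^ 2 * η ^ 2)) + C * (μ ^ 3 * (|η| * |ξ|)) := by rw [← w7]; ring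
    have z2 : (5 * C * μ ^ 3 * |η| + C * μ ^ 4 * |ξ|) * |ξ| =
      5 * (C * (μ ^ 3 * (|η| * |ξ|))) + C * (μ ^ 4 * ξ ^ 2) := by rw [← w8]; ring
    rw [z1] at w1
    rw [z2] at w2
    have z3 : (f - ((d + d') / 8 * η + e)) * ξ + ((d + d') / 8 * η + e) * (ξ + η) =
      (d + d') / 8 * η ^ 2 + e * η + f * ξ := by ring
    rw [z3]
    linarith
  · have := abs_sub f ((d + d') / 8 * η + e)
    linarith
  · linarith

namespace IsBoundaryParametrization

variable {Ω : Set Plane} {ℓ : ℝ} {γ : ℝ → Plane} {κ₀ K δ : ℝ} {s : ℝ → ℝ}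

theorem hasDerivAt_action_right (h : IsBoundaryParametrization Ω ℓ γ) (hs : ContDiff ℝ ∞ s)
    {u d : ℝ} (hne : γ (s (u + d)) ≠ γ (s u)) :
    HasDerivAt (fun d => s (u + d) - s u - ‖γ (s (u + d)) - γ (s u)‖)
      (actionRight γ s u (u + d)) d := by
  have hsd : ∀ x, HasDerivAt s (deriv s x) x := fun x => (hs.differentiable (by simp) x).hasDerivAt
  have h1 : HasDerivAt (fun d => s (u + d)) (deriv s (u + d)) d := (hsd (u + d)).comp_const_add u d
  have h2 := (h.hasDerivAt (s (u + d))).scomp d h1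
  have h3 := hasDerivAt_norm (h2.sub_const (γ (s u))) (sub_ne_zero.2 hne)
  refine ((h1.sub_const (s u)).sub h3).congr_deriv ?_
  have hn : ‖γ (s u) - γ (s (u + d))‖ ≠ 0 := norm_ne_zero_iff.2 (sub_ne_zero.2 hne.symm)
  rw [actionRight, cosAt]
  simp only [Function.comp, inner_smul_right]
  rw [norm_sub_rev (γ (s (u + d))), ← neg_sub (γ (s u)), inner_neg_left,
    real_inner_comm (deriv γ (s (u + d)))]
  field_simp
  ring

/-- Derivative of the action when both ends are moved at equal speed in the Lazutkin parameter. -/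
theorem hasDerivAt_action_shift (h : IsBoundaryParametrization Ω ℓ γ) (hs : ContDiff ℝ ∞ s)
    {u d : ℝ} (hne : γ (s (u + d)) ≠ γ (s u)) :
    HasDerivAt (fun u => s (u + d) - s u - ‖γ (s (u + d)) - γ (s u)‖)
      (actionLeft γ s u (u + d) + actionRight γ s u (u + d)) u := by
  have hsd : ∀ x, HasDerivAt s (deriv s x) x := fun x => (hs.differentiable (by simp) x).hasDerivAt
  have h1 : HasDerivAt (fun u => s (u + d)) (deriv s (u + d)) u := (hsd (u + d)).comp_add_const u d
  have h2 := (h.hasDerivAt (s (u + d))).scomp u h1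
  have h2' := (h.hasDerivAt (s u)).scomp u (hsd u)
  have h3 := hasDerivAt_norm (h2.sub h2') (sub_ne_zero.2 hne)
  refine ((h1.sub (hsd u)).sub h3).congr_deriv ?_
  have hn : ‖γ (s u) - γ (s (u + d))‖ ≠ 0 := norm_ne_zero_iff.2 (sub_ne_zero.2 hne.symm)
  rw [actionRight, actionLeft, cosAt, cosAt]
  simp only [Function.comp, inner_smul_right, inner_sub_right, Pi.sub_apply, inner_sub_left]
  rw [norm_sub_rev (γ (s (u + d))), real_inner_comm (deriv γ (s (u + d))),
    real_inner_comm (deriv γ (s (u + d))), real_inner_comm (deriv γ (s u)),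
    real_inner_comm (deriv γ (s u))]
  field_simp
  ring

/-- The derivatives of the action of a link to leading order, with Lipschitz remainders. -/
theorem exists_link_expansion (h : IsBoundaryParametrization Ω ℓ γ)
    (hs : ContDiff ℝ ∞ s) (hmono : StrictMono s)
    (hκ : ∀ u, deriv s u ^ 3 * curvature γ (s u) ^ 2 = 1) (a b : ℝ) :
    ∃ D > 0, D ≤ 1 ∧ ∃ C ≥ 0, ∃ Y Z : ℝ → ℝ → ℝ,
      (∀ u ∈ Icc a b, ∀ d ∈ Icc 0 D, |Y u d| ≤ C ∧ |Z u d| ≤ C) ∧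
      (∀ u ∈ Icc a b, ∀ d ∈ Icc 0 D, ∀ u' ∈ Icc a b, ∀ d' ∈ Icc 0 D,
        |Y u' d' - Y u d| ≤ C * (|u' - u| + |d' - d|) ∧
        |Z u' d' - Z u d| ≤ C * (|u' - u| + |d' - d|)) ∧
      ∀ u ∈ Icc a b, ∀ d ∈ Ioc 0 D,
        actionRight γ s u (u + d) = d ^ 2 / 8 + d ^ 3 * Y u d ∧
        actionLeft γ s u (u + d) + actionRight γ s u (u + d) = d ^ 4 * Z u d := by
  obtain ⟨D, hD, hD1, O, Q, hO, hQ, hsub, hG⟩ := h.exists_action_expansion hs hmono hκ a b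
  have hQ' : ContDiffOn ℝ ∞ (fderiv ℝ Q) O := hQ.fderiv_of_isOpen hO (by simp)
  obtain ⟨Y, hY⟩ : ∃ Y : ℝ × ℝ → ℝ, Y = fun p => 4 * Q p + p.2 * fderiv ℝ Q p (0, 1) := ⟨_, rfl⟩
  obtain ⟨Z, hZ⟩ : ∃ Z : ℝ × ℝ → ℝ, Z = fun p => fderiv ℝ Q p (1, 0) := ⟨_, rfl⟩
  have hYs : ContDiffOn ℝ ∞ Y O := by
    rw [hY]
    exact (contDiffOn_const.mul hQ).add
      (contDiff_snd.contDiffOn.mul (hQ'.clm_apply contDiffOn_const))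
  have hZs : ContDiffOn ℝ ∞ Z O := by
    rw [hZ]; exact hQ'.clm_apply contDiffOn_const
  have hcomp : IsCompact (Icc a b ×ˢ Icc 0 D) := isCompact_Icc.prod isCompact_Icc
  have hconv : Convex ℝ (Icc a b ×ˢ Icc 0 D) := (convex_Icc a b).prod (convex_Icc 0 D)
  obtain ⟨C₁, hC₁⟩ := hcomp.exists_bound_of_continuousOn (hYs.continuousOn.mono hsub)
  obtain ⟨C₂, hC₂⟩ := hcomp.exists_bound_of_continuousOn (hZs.continuousOn.mono hsub)
  obtain ⟨C₃, hC₃⟩ := (hYs.mono hsub).exists_lipschitzOnWith (by simp) hconv hcomp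
  obtain ⟨C₄, hC₄⟩ := (hZs.mono hsub).exists_lipschitzOnWith (by simp) hconv hcomp
  obtain ⟨C, hC⟩ : ∃ C, C = max (max (max C₁ C₂) (max C₃ C₄)) 0 := ⟨_, rfl⟩
  have c0 : 0 ≤ C := by rw [hC]; exact le_max_right _ _
  have c1 : C₁ ≤ C := by rw [hC]; simp
  have c2 : C₂ ≤ C := by rw [hC]; simp
  have c3 : (C₃ : ℝ) ≤ C := by rw [hC]; simp
  have c4 : (C₄ : ℝ) ≤ C := by rw [hC]; simp
  have hdist : ∀ u d u' d' : ℝ, dist ((u', d') : ℝ × ℝ) (u, d) ≤ |u' - u| + |d' - d| := by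
    intro u d u' d'
    rw [Prod.dist_eq, Real.dist_eq, Real.dist_eq]
    exact max_le (by linarith [abs_nonneg (d' - d)]) (by linarith [abs_nonneg (u' - u)])
  refine ⟨D, hD, hD1, C, c0, fun u d => Y (u, d), fun u d => Z (u, d), ?_, ?_, ?_⟩
  · intro u hu d hd
    exact ⟨(hC₁ (u, d) ⟨hu, hd⟩).trans c1, (hC₂ (u, d) ⟨hu, hd⟩).trans c2⟩
  · intro u hu d hd u' hu' d' hd'
    have e1 := hC₃.dist_le_mul (u', d') ⟨hu', hd'⟩ (u, d) ⟨hu, hd⟩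
    have e2 := hC₄.dist_le_mul (u', d') ⟨hu', hd'⟩ (u, d) ⟨hu, hd⟩
    rw [Real.dist_eq] at e1 e2
    exact ⟨e1.trans (mul_le_mul c3 (hdist _ _ _ _) dist_nonneg c0),
      e2.trans (mul_le_mul c4 (hdist _ _ _ _) dist_nonneg c0)⟩
  · intro u hu d hd
    have hmem : (u, d) ∈ O := hsub ⟨hu, hd.1.le, hd.2⟩
    have hne := (hG (u, d) hmem hd.1).1
    have hQd : HasFDerivAt Q (fderiv ℝ Q (u, d)) (u, d) :=
      ((hQ.differentiableOn (by simp)).differentiableAt (hO.mem_nhds hmem)).hasFDerivAt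
    have hopen : IsOpen (O ∩ {p : ℝ × ℝ | 0 < p.2}) :=
      hO.inter (isOpen_lt continuous_const continuous_snd)
    have hnear : ∀ p ∈ O ∩ {p : ℝ × ℝ | 0 < p.2},
        s (p.1 + p.2) - s p.1 - ‖γ (s (p.1 + p.2)) - γ (s p.1)‖ =
        p.2 ^ 3 / 24 + p.2 ^ 4 * Q p := fun p hp => (hG p hp.1 hp.2).2
    constructor
    · have l1 : HasDerivAt (fun d : ℝ => ((u, d) : ℝ × ℝ)) (0, 1) d :=
        (hasDerivAt_const d u).prodMk (hasDerivAt_id d)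
      have l2 := hQd.comp_hasDerivAt d l1
      have l3 := (((hasDerivAt_id d).pow 3).div_const 24).add (((hasDerivAt_id d).pow 4).mul l2)
      have l4 : ∀ᶠ x in nhds d, s (u + x) - s u - ‖γ (s (u + x)) - γ (s u)‖ =
          x ^ 3 / 24 + x ^ 4 * Q (u, x) := by
        have : ContinuousAt (fun x : ℝ => ((u, x) : ℝ × ℝ)) d := by fun_prop
        filter_upwards [this.eventually (hopen.mem_nhds ⟨hmem, hd.1⟩)] with x hx
        exact hnear _ hx
      have l5 := (h.hasDerivAt_action_right hs hne).congr_of_eventuallyEq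
        (Filter.EventuallyEq.symm l4)
      rw [l5.unique l3, hY]
      simp
      ring
    · have l1 : HasDerivAt (fun u : ℝ => ((u, d) : ℝ × ℝ)) (1, 0) u :=
        (hasDerivAt_id u).prodMk (hasDerivAt_const u d)
      have l2 := hQd.comp_hasDerivAt u l1
      have l3 := (l2.const_mul (d ^ 4)).const_add (d ^ 3 / 24)
      have l4 : ∀ᶠ x in nhds u, s (x + d) - s x - ‖γ (s (x + d)) - γ (s x)‖ =
          d ^ 3 / 24 + d ^ 4 * Q (x, d) := by
        have : ContinuousAt (fun x : ℝ => ((x, d) : ℝ × ℝ)) u := by fun_prop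
        filter_upwards [this.eventually (hopen.mem_nhds ⟨hmem, hd.1⟩)] with x hx
        exact hnear _ hx
      have l5 := (h.hasDerivAt_action_shift hs hne).congr_of_eventuallyEq
        (Filter.EventuallyEq.symm l4)
      rw [l5.unique l3, hZ]

/-- Strong monotonicity of the gradient of the action of a link, up to errors of higher order. -/
theorem exists_action_monotone (h : IsBoundaryParametrization Ω ℓ γ)
    (hs : ContDiff ℝ ∞ s) (hmono : StrictMono s)
    (hκ : ∀ u, deriv s u ^ 3 * curvature γ (s u) ^ 2 = 1) (a b : ℝ) :
    ∃ D > 0, D ≤ 1 ∧ ∃ C ≥ 1, ∀ u ∈ Icc a b, ∀ u' ∈ Icc a b, ∀ v v' μ, u < v → u' < v' →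
      v - u ≤ μ → v' - u' ≤ μ → μ ≤ D →
      (((v - u) + (v' - u')) / 8 - C * μ ^ 2) * ((v' - v) - (u' - u)) ^ 2
          - C * μ ^ 4 * (u' - u) ^ 2 ≤
        (actionLeft γ s u' v' - actionLeft γ s u v) * (u' - u) +
          (actionRight γ s u' v' - actionRight γ s u v) * (v' - v) ∧
      |actionLeft γ s u' v' - actionLeft γ s u v| ≤ C * μ * (|u' - u| + |v' - v|) ∧
      |actionRight γ s u' v' - actionRight γ s u v| ≤ C * μ * (|u' - u| + |v' - v|) := by
  obtain ⟨D, hD, hD1, C, hC0, Y, Z, hb, hl, he⟩ := h.exists_link_expansion hs hmono hκ a b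
  refine ⟨D, hD, hD1, 20 * C + 2, by linarith, ?_⟩
  intro u hu u' hu' v v' μ huv huv' hμ hμ' hμD
  obtain ⟨d, hd⟩ : ∃ d, d = v - u := ⟨_, rfl⟩
  obtain ⟨d', hd'⟩ : ∃ d', d' = v' - u' := ⟨_, rfl⟩
  obtain rfl : v = u + d := by linarith
  obtain rfl : v' = u' + d' := by linarith
  rw [← hd] at hμ
  rw [← hd'] at hμ'
  have hd0 : 0 < d := by linarith
  have hd0' : 0 < d' := by linarith
  have hm : d ∈ Icc 0 D := ⟨hd0.le, by linarith⟩
  have hm' : d' ∈ Icc 0 D := ⟨hd0'.le, by linarith⟩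
  obtain ⟨r1, l1⟩ := he u hu d ⟨hd0, by linarith⟩
  obtain ⟨r2, l2⟩ := he u' hu' d' ⟨hd0', by linarith⟩
  obtain ⟨by2, bz2⟩ := hb u' hu' d' hm'
  obtain ⟨ly, lz⟩ := hl u hu d hm u' hu' d' hm'
  rw [show u + d - u + (u' + d' - u') = d + d' by ring,
    show u' + d' - (u + d) - (u' - u) = d' - d by ring]
  obtain ⟨ξ, hξ⟩ : ∃ ξ, ξ = u' - u := ⟨_, rfl⟩
  obtain ⟨η, hη⟩ : ∃ η, η = d' - d := ⟨_, rfl⟩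
  have hμ0 : 0 < μ := by linarith
  have hμ1 : μ ≤ 1 := by linarith
  rw [← hξ, ← hη] at ly lz ⊢
  rw [show u' + d' - (u + d) = ξ + η by rw [hξ, hη]; ring]
  -- difference of the right derivatives
  have R : ∃ e, actionRight γ s u' (u' + d') - actionRight γ s u (u + d) =
      (d + d') / 8 * η + e ∧ |e| ≤ 4 * C * μ ^ 2 * |η| + C * μ ^ 3 * |ξ| := by
    refine ⟨(d' ^ 3 - d ^ 3) * Y u' d' + d ^ 3 * (Y u' d' - Y u d), by rw [r1, r2, hη]; ring, ?_⟩
    refine (abs_add_le _ _).trans ?_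
    rw [abs_mul, abs_mul, show d' ^ 3 - d ^ 3 = η * (d' ^ 2 + d' * d + d ^ 2) by rw [hη]; ring,
      abs_mul, abs_of_nonneg (by positivity : 0 ≤ d' ^ 2 + d' * d + d ^ 2),
      abs_of_nonneg (by positivity : 0 ≤ d ^ 3)]
    have e1 : d' ^ 2 + d' * d + d ^ 2 ≤ 3 * μ ^ 2 := by
      have := pow_le_pow_left₀ hd0'.le hμ' 2
      have := pow_le_pow_left₀ hd0.le hμ 2
      have := mul_le_mul hμ' hμ hd0.le hμ0.le
      nlinarith
    have e2 : d ^ 3 ≤ μ ^ 3 := pow_le_pow_left₀ hd0.le hμ 3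
    have e3 : μ ^ 3 * (C * |η|) ≤ μ ^ 2 * (C * |η|) := by
      refine mul_le_mul_of_nonneg_right ?_ (by positivity)
      nlinarith [sq_nonneg μ]
    calc _ ≤ |η| * (3 * μ ^ 2) * C + μ ^ 3 * (C * (|ξ| + |η|)) := by gcongr
      _ ≤ _ := by linarith
  have L : |(actionLeft γ s u' (u' + d') + actionRight γ s u' (u' + d')) -
      (actionLeft γ s u (u + d) + actionRight γ s u (u + d))| ≤
      5 * C * μ ^ 3 * |η| + C * μ ^ 4 * |ξ| := by
    rw [l1, l2]
    rw [show d' ^ 4 * Z u' d' - d ^ 4 * Z u d =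
      (d' ^ 4 - d ^ 4) * Z u' d' + d ^ 4 * (Z u' d' - Z u d) by ring]
    refine (abs_add_le _ _).trans ?_
    rw [abs_mul, abs_mul, show d' ^ 4 - d ^ 4 = η * (d' ^ 3 + d' ^ 2 * d + d' * d ^ 2 + d ^ 3) by
      rw [hη]; ring, abs_mul,
      abs_of_nonneg (by positivity : 0 ≤ d' ^ 3 + d' ^ 2 * d + d' * d ^ 2 + d ^ 3),
      abs_of_nonneg (by positivity : 0 ≤ d ^ 4)]
    have e1 : d' ^ 3 + d' ^ 2 * d + d' * d ^ 2 + d ^ 3 ≤ 4 * μ ^ 3 := by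
      have a1 := pow_le_pow_left₀ hd0'.le hμ' 3
      have a2 := pow_le_pow_left₀ hd0.le hμ 3
      have a3 := mul_le_mul (pow_le_pow_left₀ hd0'.le hμ' 2) hμ hd0.le (by positivity)
      have a4 := mul_le_mul hμ' (pow_le_pow_left₀ hd0.le hμ 2) (by positivity) hμ0.le
      linarith
    have e2 : d ^ 4 ≤ μ ^ 4 := pow_le_pow_left₀ hd0.le hμ 4
    have e3 : μ ^ 4 * (C * |η|) ≤ μ ^ 3 * (C * |η|) := by
      refine mul_le_mul_of_nonneg_right ?_ (by positivity)
      nlinarith [pow_pos hμ0 3]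
    calc _ ≤ |η| * (4 * μ ^ 3) * C + μ ^ 4 * (C * (|ξ| + |η|)) := by gcongr
      _ ≤ _ := by linarith
  obtain ⟨e, hRe, hRb⟩ := R
  obtain ⟨f, hf⟩ : ∃ f, f = (actionLeft γ s u' (u' + d') + actionRight γ s u' (u' + d')) -
      (actionLeft γ s u (u + d) + actionRight γ s u (u + d)) := ⟨_, rfl⟩
  rw [← hf] at L
  have hLe : actionLeft γ s u' (u' + d') - actionLeft γ s u (u + d) =
      f - ((d + d') / 8 * η + e) := by
    rw [← hRe, hf]; ring
  rw [hLe, hRe]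
  exact action_monotone_algebra hC0 hμ0 hμ1 hd0 hd0' hμ hμ' hRb L

end IsBoundaryParametrization

/-! ### A discrete Poincaré inequality, and angles seen from near the boundary -/

/-- A discrete Poincaré argument: strong monotonicity of the links, with controlled end terms,
forces two critical configurations to agree. Here `ξ` is the difference of the configurations, and
`P k`, `R k` are those of the derivatives of the action of the `k`-th link in its left and right
end. -/
theorem eq_zero_of_discrete_monotone {n : ℕ} (hn : 1 ≤ n) {ξ P R : ℕ → ℝ} {α β c : ℝ}
    (hβ : 0 ≤ β)
    (hlink : ∀ k < n, α * (ξ (k + 1) - ξ k) ^ 2 - β * ξ k ^ 2 ≤ P k * ξ k + R k * ξ (k + 1))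
    (hcrit : ∀ k, k + 1 < n → R k + P (k + 1) = 0)
    (hleft : P 0 * ξ 0 ≤ -c * ξ 0 ^ 2 + α / 4 * (ξ 1 - ξ 0) ^ 2)
    (hright : R (n - 1) * ξ n ≤ α / 4 * (ξ n - ξ (n - 1)) ^ 2)
    (hα : 4 * β * n ^ 2 < α) (hc : 2 * β * n < c) : ∀ k ≤ n, ξ k = 0 := by
  obtain ⟨S, hS⟩ : ∃ S : ℕ → ℝ, S = fun m => ∑ k ∈ Finset.range m, (ξ (k + 1) - ξ k) ^ 2 := ⟨_, rfl⟩
  have hS0 : ∀ m, 0 ≤ S m := fun m => by rw [hS]; exact Finset.sum_nonneg fun _ _ => sq_nonneg _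
  have hSmono : ∀ m ≤ n, S m ≤ S n := fun m hm => by
    rw [hS]
    exact Finset.sum_le_sum_of_subset_of_nonneg (Finset.range_mono hm) fun _ _ _ => sq_nonneg _
  have hn' : (1 : ℝ) ≤ n := by exact_mod_cast hn
  have hα0 : 0 < α := lt_of_le_of_lt (by positivity) hα
  have hsum : ∀ m, 1 ≤ m → m ≤ n → ∑ k ∈ Finset.range m, (P k * ξ k + R k * ξ (k + 1)) =
      P 0 * ξ 0 + R (m - 1) * ξ m := by
    intro m hm
    induction m, hm using Nat.le_induction with
    | base => intro _; simp
    | succ m hm ih =>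
      intro hmn
      rw [Finset.sum_range_succ, ih (by omega)]
      have := hcrit (m - 1) (by omega)
      rw [Nat.sub_add_cancel hm] at this
      rw [Nat.add_sub_cancel]
      linear_combination ξ m * this
  have hpoin : ∀ k ≤ n, ξ k ^ 2 ≤ 2 * ξ 0 ^ 2 + 2 * n * S n := by
    intro k hk
    have h1 : ξ k - ξ 0 = ∑ i ∈ Finset.range k, (ξ (i + 1) - ξ i) := (Finset.sum_range_sub ξ k).symm
    have h2 : (ξ k - ξ 0) ^ 2 ≤ k * S k := by
      rw [h1, hS]
      simpa using sq_sum_le_card_mul_sum_sq (s := Finset.range k) (f := fun i => ξ (i + 1) - ξ i)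
    have h3 : (k : ℝ) * S k ≤ n * S n := by
      have : (k : ℝ) ≤ n := by exact_mod_cast hk
      exact mul_le_mul this (hSmono k hk) (hS0 k) (by linarith)
    nlinarith [sq_nonneg (ξ k - 2 * ξ 0)]
  have h1 : α * S n - β * ∑ k ∈ Finset.range n, ξ k ^ 2 ≤ P 0 * ξ 0 + R (n - 1) * ξ n := by
    rw [← hsum n hn le_rfl, hS, Finset.mul_sum, Finset.mul_sum, ← Finset.sum_sub_distrib]
    exact Finset.sum_le_sum fun k hk => hlink k (Finset.mem_range.1 hk)
  have h2 : ∑ k ∈ Finset.range n, ξ k ^ 2 ≤ n * (2 * ξ 0 ^ 2 + 2 * n * S n) := by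
    have := Finset.sum_le_card_nsmul (Finset.range n) (fun k => ξ k ^ 2)
      (2 * ξ 0 ^ 2 + 2 * n * S n) fun k hk => hpoin k (Finset.mem_range.1 hk).le
    rwa [Finset.card_range, nsmul_eq_mul] at this
  have h3 : (ξ 1 - ξ 0) ^ 2 ≤ S n := by
    rw [hS]
    exact Finset.single_le_sum (f := fun k => (ξ (k + 1) - ξ k) ^ 2)
      (fun _ _ => sq_nonneg _) (Finset.mem_range.2 hn)
  have h4 : (ξ n - ξ (n - 1)) ^ 2 ≤ S n := by
    rw [hS]
    have := Finset.single_le_sum (f := fun k => (ξ (k + 1) - ξ k) ^ 2)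
      (fun _ _ => sq_nonneg _) (Finset.mem_range.2 (show n - 1 < n by omega))
    rwa [Nat.sub_add_cancel hn] at this
  have h5 := mul_le_mul_of_nonneg_left h2 hβ
  have h6 := mul_le_mul_of_nonneg_left h3 hα0.le
  have h7 := mul_le_mul_of_nonneg_left h4 hα0.le
  have h8 : (α / 2 - 2 * β * n ^ 2) * S n + (c - 2 * β * n) * ξ 0 ^ 2 ≤ 0 := by nlinarith
  have h9 : 0 < α / 2 - 2 * β * n ^ 2 := by linarith
  have h10 : 0 < c - 2 * β * n := by linarith
  have h11 : S n = 0 := by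
    refine le_antisymm ?_ (hS0 n)
    by_contra hlt
    push Not at hlt
    nlinarith [mul_pos h9 hlt, mul_nonneg h10.le (sq_nonneg (ξ 0))]
  have h12 : ξ 0 ^ 2 = 0 := by
    rw [h11] at h8
    refine le_antisymm ?_ (sq_nonneg _)
    by_contra hlt
    push Not at hlt
    nlinarith [mul_pos h10 hlt]
  intro k hk
  have := hpoin k hk
  rw [h11, h12] at this
  exact pow_eq_zero_iff two_ne_zero |>.1 (le_antisymm (by linarith) (sq_nonneg _))

namespace IsBoundaryParametrization

variable {Ω : Set Plane} {ℓ : ℝ} {γ : ℝ → Plane} {κ₀ K δ : ℝ} {s : ℝ → ℝ}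

/-- As the base point moves, the tangent turns at the rate `κ` and the direction of `z` at the rate
`sin / r`, where `r` is the distance of `z`. The two effects compete: the second prevails close to
`z`, the first one further away. -/
theorem hasDerivAt_cosAt (h : IsBoundaryParametrization Ω ℓ γ) {t : ℝ} {z : Plane}
    (hz : z ≠ γ t) :
    HasDerivAt (fun t => cosAt γ t z)
      (sinAt γ t z * (curvature γ t - sinAt γ t z / ‖z - γ t‖)) t := by
  have h0 : z - γ t ≠ 0 := sub_ne_zero.2 hz
  have h1 := (h.hasDerivAt t).const_sub z
  have h2 := hasDerivAt_norm h1 h0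
  have h3 := (h.hasDerivAt2 t).inner ℝ h1
  have hn : ‖z - γ t‖ ≠ 0 := norm_ne_zero_iff.2 h0
  refine (h3.div h2 hn).congr_deriv ?_
  rw [inner_neg_right, inner_neg_right, h.inner_tangent_self, h.inner_normal,
    real_inner_comm (deriv γ t), sinAt]
  have h4 := inner_sq_add_cross_sq (deriv γ t) (z - γ t)
  rw [h.unit_speed] at h4
  field_simp
  linear_combination h4

theorem hasDerivAt_cross_tangent (h : IsBoundaryParametrization Ω ℓ γ) (t : ℝ) (z : Plane) :
    HasDerivAt (fun t => cross (deriv γ t) (z - γ t))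
      (-(curvature γ t * inner ℝ (deriv γ t) (z - γ t))) t := by
  refine ((h.hasDerivAt2 t).cross ((h.hasDerivAt t).const_sub z)).congr_deriv ?_
  rw [h.cross_normal, cross_neg_right, plane_cross_self]; simp

/-- A point `z` very close to `γ σ`, seen from a boundary point `γ t` at a larger distance, looks
like `γ σ` itself. -/
theorem sinAt_near (h : IsBoundaryParametrization Ω ℓ γ) (B : CurveBounds γ κ₀ K δ) {θ σ t : ℝ}
    {z : Plane} (hθ : K * θ ≤ κ₀ / 32) (hθ' : K * θ ≤ 1 / 32) (hθκ : θ ≤ κ₀ / 32) (ht0 : t ≠ σ)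
    (htθ : |t - σ| ≤ θ) (hz : ‖z - γ σ‖ ≤ θ * |t - σ| ^ 2) :
    κ₀ / 4 * |t - σ| ≤ sinAt γ t z ∧ sinAt γ t z ≤ K * |t - σ| ∧ 0 < (σ - t) * cosAt γ t z ∧
      κ₀ ^ 2 / 16 * |t - σ| ≤ sinAt γ t z * (curvature γ t - sinAt γ t z / ‖z - γ t‖) ∧
      0 < ‖z - γ t‖ := by
  have hg : 0 < |t - σ| := abs_pos.2 (sub_ne_zero.2 ht0)
  have h1 := h.abs_cross_tangent_chord_sub_le B t σ
  have h2 := h.abs_inner_tangent_chord_sub_le B t σ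
  have h3 := h.norm_chord_ge B t σ
  have h4 := h.norm_sub_le t σ
  have hk1 := B.curv_ge t
  have hk2 := B.curv_le t
  have hκ := B.pos
  have hK := B.one_le
  rw [abs_sub_comm σ t] at h1 h2 h3 h4
  rw [← sq_abs, abs_sub_comm σ t] at h1
  have e1 : |cross (deriv γ t) (z - γ σ)| ≤ θ * |t - σ| ^ 2 :=
    (abs_cross_le _ _).trans (by rw [h.unit_speed, one_mul]; exact hz)
  have e2 : |inner ℝ (deriv γ t) (z - γ σ)| ≤ θ * |t - σ| ^ 2 :=
    (abs_real_inner_le_norm _ _).trans (by rw [h.unit_speed, one_mul]; exact hz)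
  have e3 : cross (deriv γ t) (z - γ t) =
      cross (deriv γ t) (γ σ - γ t) + cross (deriv γ t) (z - γ σ) := by
    rw [← cross_add_right]; congr 1; abel
  have e4 : inner ℝ (deriv γ t) (z - γ t) =
      inner ℝ (deriv γ t) (γ σ - γ t) + inner ℝ (deriv γ t) (z - γ σ) := by
    rw [← inner_add_right]; congr 1; abel
  have e5 : ‖z - γ t‖ ≤ ‖γ σ - γ t‖ + ‖z - γ σ‖ := by
    have : z - γ t = (γ σ - γ t) + (z - γ σ) := by abel
    rw [this]; exact norm_add_le _ _
  have e6 : ‖γ σ - γ t‖ ≤ ‖z - γ t‖ + ‖z - γ σ‖ := by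
    have : γ σ - γ t = (z - γ t) - (z - γ σ) := by abel
    rw [this]; exact _root_.norm_sub_le _ _
  have hsgn : (σ - t) * cosAt γ t z = (σ - t) * inner ℝ (deriv γ t) (z - γ t) / ‖z - γ t‖ := by
    rw [cosAt, mul_div_assoc]
  rw [hsgn, sinAt, e3]
  rw [e4]
  have hsg : (σ - t) ^ 2 = |t - σ| ^ 2 := by rw [sq_abs]; ring
  have hsa : |σ - t| = |t - σ| := abs_sub_comm _ _
  generalize σ - t = d at *
  generalize |t - σ| = g at *
  generalize cross (deriv γ t) (γ σ - γ t) = H at *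
  generalize cross (deriv γ t) (z - γ σ) = H' at *
  generalize inner ℝ (deriv γ t) (γ σ - γ t) = I at *
  generalize inner ℝ (deriv γ t) (z - γ σ) = I' at *
  generalize ‖γ σ - γ t‖ = r₀ at *
  generalize ‖z - γ t‖ = r at *
  generalize ‖z - γ σ‖ = ε at *
  generalize curvature γ t = κ at *
  have hθ0 : 0 < θ := hg.trans_le htθ
  have hθ32 : θ ≤ 1 / 32 := by nlinarith
  have g1 : K * g ≤ κ / 32 := (mul_le_mul_of_nonneg_left htθ (by linarith)).trans (by linarith)
  have g2 : K * g ≤ 1 / 32 := (mul_le_mul_of_nonneg_left htθ (by linarith)).trans hθ'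
  have g3 : K * g ^ 3 ≤ κ / 32 * g ^ 2 := by
    have := mul_le_mul_of_nonneg_right g1 (sq_nonneg g); linarith
  have g4 : K * g ^ 3 ≤ g / 32 := by
    have : K * g * (g * g) ≤ 1 / 32 * (g * 1) := by
      have : g ≤ 1 := by linarith
      gcongr
    linarith
  have g5 : θ * g ^ 2 ≤ κ / 32 * g ^ 2 := by
    have : θ ≤ κ / 32 := by linarith
    gcongr
  have g6 : θ * g ^ 2 ≤ g / 32 := by
    have : θ * g * g ≤ 1 / 32 * 1 * g := by
      have : g ≤ 1 := by linarith
      gcongr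
    linarith
  rw [abs_le] at h1 h2 e1 e2
  have hg2 := pow_pos hg 2
  have hκ' : 0 < κ := by linarith
  have hκg : 0 < κ * g ^ 2 := by positivity
  have hκKg : κ * g ^ 2 ≤ K * g ^ 2 := by gcongr
  have HL : 7 / 16 * κ * g ^ 2 ≤ H + H' := by linarith
  have HU : H + H' ≤ 9 / 16 * κ * g ^ 2 := by linarith
  have rL : 15 / 16 * g ≤ r := by linarith
  have rU : r ≤ 17 / 16 * g := by linarith
  have hr : 0 < r := by linarith
  have sL : κ / 4 * g ≤ (H + H') / r := by
    rw [le_div_iff₀ hr]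
    have := mul_le_mul_of_nonneg_left rU (by positivity : 0 ≤ κ / 4 * g)
    linarith
  have sU : (H + H') / r ≤ 3 / 4 * κ * r := by
    rw [div_le_iff₀ hr]
    have : (15 / 16 * g) ^ 2 ≤ r ^ 2 := by gcongr
    have := mul_le_mul_of_nonneg_left this hκ'.le
    linarith
  have sU' : (H + H') / r ≤ K * g := by
    rw [div_le_iff₀ hr]
    have := mul_le_mul_of_nonneg_left rL (by positivity : 0 ≤ K * g)
    linarith
  refine ⟨?_, sU', ?_, ?_, hr⟩
  · refine le_trans ?_ sL; gcongr
  · refine div_pos ?_ hr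
    rcases abs_cases d with ⟨a1, _⟩ | ⟨a1, _⟩
    · exact mul_pos (by linarith) (by linarith)
    · exact mul_pos_of_neg_of_neg (by linarith) (by linarith)
  · have q1 : (H + H') / r / r ≤ 3 / 4 * κ := by rw [div_le_iff₀ hr]; exact sU
    have q2 : κ₀ / 4 ≤ κ - (H + H') / r / r := by linarith
    calc κ₀ ^ 2 / 16 * g = (κ₀ / 4 * g) * (κ₀ / 4) := by ring
      _ ≤ ((H + H') / r) * (κ - (H + H') / r / r) := by
        refine mul_le_mul ?_ q2 (by positivity) (le_trans (by positivity) sL)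
        refine le_trans ?_ sL; gcongr

end IsBoundaryParametrization

/-! ### Long and short end links -/

theorem eventually_mul_le (C : ℝ) {c : ℝ} (hc : 0 < c) : ∀ᶠ e in 𝓝[>] (0 : ℝ), C * e ≤ c := by
  have h1 : Tendsto (fun e : ℝ => C * e) (𝓝[>] 0) (𝓝 0) := by
    have : Tendsto (fun e : ℝ => C * e) (𝓝 0) (𝓝 (C * 0)) := (by fun_prop : Continuous _).tendsto _
    rw [mul_zero] at this
    exact this.mono_left nhdsWithin_le_nhds
  exact h1.eventually (ge_mem_nhds hc)

theorem eventually_pos_le {c : ℝ} (hc : 0 < c) : ∀ᶠ e in 𝓝[>] (0 : ℝ), 0 < e ∧ e ≤ c := by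
  filter_upwards [self_mem_nhdsWithin, eventually_mul_le 1 hc] with e h1 h2
  exact ⟨h1, by linarith⟩

/-- The mean value inequality. -/
theorem mul_sub_le_of_le_hasDerivAt {f f' : ℝ → ℝ} {a b C : ℝ} (hab : a ≤ b)
    (hf : ∀ x ∈ Icc a b, HasDerivAt f (f' x) x) (hC : ∀ x ∈ Icc a b, C ≤ f' x) :
    C * (b - a) ≤ f b - f a := by
  refine (convex_Icc a b).mul_sub_le_image_sub_of_le_deriv
    (fun x hx => (hf x hx).continuousAt.continuousWithinAt)
    (fun x hx => (hf x (interior_subset hx)).differentiableAt.differentiableWithinAt)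
    (fun x hx => ?_) a (left_mem_Icc.2 hab) b (right_mem_Icc.2 hab) hab
  rw [(hf x (interior_subset hx)).deriv]
  exact hC x (interior_subset hx)

namespace IsBoundaryParametrization

variable {Ω : Set Plane} {ℓ : ℝ} {γ : ℝ → Plane} {κ₀ K δ : ℝ} {s : ℝ → ℝ}

/-- Seen from boundary points at distance at least `g` from `γ σ`, on one side of it, the cosine of
the direction of a point `z` close to `γ σ` increases. -/
theorem cosAt_growth_long (h : IsBoundaryParametrization Ω ℓ γ) (B : CurveBounds γ κ₀ K δ)
    {θ σ t t' g : ℝ} {z : Plane} (hθ : K * θ ≤ κ₀ / 32) (hθ' : K * θ ≤ 1 / 32)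
    (hθκ : θ ≤ κ₀ / 32) (hg : 0 < g) (hθ0 : 0 < θ) (htt' : t ≤ t')
    (hside : (σ + g ≤ t ∧ t' ≤ σ + θ) ∨ (σ - θ ≤ t ∧ t' ≤ σ - g))
    (hz : ‖z - γ σ‖ ≤ θ * g ^ 2) :
    κ₀ ^ 2 / 16 * g * (t' - t) ≤ cosAt γ t' z - cosAt γ t z := by
  have key : ∀ x ∈ Icc t t', z ≠ γ x ∧
      κ₀ ^ 2 / 16 * g ≤ sinAt γ x z * (curvature γ x - sinAt γ x z / ‖z - γ x‖) := by
    intro x hx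
    have h1 : g ≤ |x - σ| ∧ |x - σ| ≤ θ := by
      rcases hside with ⟨a1, a2⟩ | ⟨a1, a2⟩
      · rw [abs_of_nonneg (by linarith [hx.1])]; exact ⟨by linarith [hx.1], by linarith [hx.2]⟩
      · rw [abs_of_nonpos (by linarith [hx.2])]; exact ⟨by linarith [hx.2], by linarith [hx.1]⟩
    have h2 : x ≠ σ := fun hc => by rw [hc, sub_self, abs_zero] at h1; linarith [h1.1]
    have h3 : ‖z - γ σ‖ ≤ θ * |x - σ| ^ 2 := hz.trans (by have := h1.1; gcongr)
    obtain ⟨-, -, -, h4, h5⟩ := h.sinAt_near B hθ hθ' hθκ h2 h1.2 h3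
    refine ⟨fun hc => ?_, le_trans ?_ h4⟩
    · rw [hc, sub_self, norm_zero] at h5; exact h5.false
    · have := h1.1; gcongr
  exact mul_sub_le_of_le_hasDerivAt htt' (fun x hx => h.hasDerivAt_cosAt (key x hx).1)
    fun x hx => (key x hx).2

/-- Seen from boundary points very close to `z`, the cosine of the direction of `z` decreases
steeply. -/
theorem eventually_cosAt_decay_short (h : IsBoundaryParametrization Ω ℓ γ)
    (B : CurveBounds γ κ₀ K δ) {a C : ℝ} (ha : 0 < a) (hC : 0 < C) :
    ∀ᶠ e in 𝓝[>] (0 : ℝ), ∀ (z : Plane) (t t' : ℝ), t ≤ t' → t' - t ≤ δ → (∀ x, z ≠ γ x) →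
      ‖z - γ t‖ ≤ C * e ^ 3 → ‖z - γ t'‖ ≤ C * e ^ 3 → a * e ≤ sinAt γ t z → a * e ≤ sinAt γ t' z →
      a ^ 2 / (1000 * C) / e * (t' - t) ≤ cosAt γ t z - cosAt γ t' z := by
  filter_upwards [eventually_pos_le one_pos, eventually_mul_le (100 * K * C) ha] with
    e ⟨he0, he1⟩ hs
  intro z t t' htt' hδ hz hr hr' hs1 hs2
  have hK := B.K_pos
  have he2 : 100 * K * C * e ^ 2 ≤ a := by
    refine le_trans ?_ hs
    have : e ^ 2 ≤ e := by nlinarith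
    gcongr
  obtain ⟨p, hp, hpt, hpt', hps⟩ : ∃ p ∈ Icc t t', ‖z - γ t‖ ≤ ‖z - γ p‖ ∧
      ‖z - γ t'‖ ≤ ‖z - γ p‖ ∧ a * e ≤ sinAt γ p z ∧ ‖z - γ p‖ ≤ C * e ^ 3 := by
    rcases le_total ‖z - γ t‖ ‖z - γ t'‖ with hle | hle
    · exact ⟨t', ⟨htt', le_rfl⟩, hle, le_rfl, hs2, hr'⟩
    · exact ⟨t, ⟨le_rfl, htt'⟩, le_rfl, hle, hs1, hr⟩
  obtain ⟨hps, hpC⟩ := hps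
  obtain ⟨ρ, hρ⟩ : ∃ ρ, ρ = ‖z - γ p‖ := ⟨_, rfl⟩
  rw [← hρ] at hpt hpt' hpC
  have hρ0 : 0 < ρ := hρ ▸ norm_pos_iff.2 (sub_ne_zero.2 (hz p))
  have hlen : t' - t ≤ 4 * ρ := by
    have h1 := h.half_le_norm_chord B (s := t) (t := t')
      (by rw [abs_of_nonneg (by linarith)]; exact hδ)
    rw [abs_of_nonneg (by linarith)] at h1
    have h2 : ‖γ t' - γ t‖ ≤ ‖z - γ t‖ + ‖z - γ t'‖ := by
      rw [show γ t' - γ t = (z - γ t) - (z - γ t') by abel]; exact _root_.norm_sub_le _ _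
    linarith
  have hrx : ∀ x ∈ Icc t t', ‖z - γ x‖ ≤ 5 * ρ := by
    intro x hx
    have h1 : ‖z - γ x‖ ≤ ‖z - γ p‖ + ‖γ x - γ p‖ := by
      rw [show z - γ x = (z - γ p) - (γ x - γ p) by abel]; exact _root_.norm_sub_le _ _
    have h2 := h.norm_sub_le p x
    have h3 : |x - p| ≤ t' - t := by
      rw [abs_le]; constructor <;> linarith [hx.1, hx.2, hp.1, hp.2]
    rw [← hρ] at h1; linarith
  have hhp : a * e * ρ ≤ cross (deriv γ p) (z - γ p) := by
    rw [sinAt, ← hρ, le_div_iff₀ hρ0] at hps; exact hps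
  have hhx : ∀ x ∈ Icc t t', a * e * ρ / 2 ≤ cross (deriv γ x) (z - γ x) := by
    intro x hx
    have h1 : ‖cross (deriv γ x) (z - γ x) - cross (deriv γ p) (z - γ p)‖ ≤
        (K * (5 * ρ)) * ‖x - p‖ := by
      refine Convex.norm_image_sub_le_of_norm_hasDerivWithin_le (s := Icc t t')
        (fun y _ => (h.hasDerivAt_cross_tangent y z).hasDerivWithinAt) (fun y hy => ?_)
        (convex_Icc t t') hp hx
      rw [norm_neg, norm_mul, Real.norm_eq_abs, abs_of_pos (B.pos.trans_le (B.curv_ge y))]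
      refine mul_le_mul (B.curv_le y) ?_ (norm_nonneg _) hK.le
      refine le_trans (norm_inner_le_norm _ _) ?_
      rw [h.unit_speed, one_mul]; exact hrx y hy
    have h3 : |x - p| ≤ 4 * ρ := by
      rw [abs_le]; constructor <;> linarith [hx.1, hx.2, hp.1, hp.2]
    rw [Real.norm_eq_abs, Real.norm_eq_abs] at h1
    have h4 := (abs_le.1 (h1.trans (mul_le_mul_of_nonneg_left h3 (by positivity)))).1
    have h5 : K * (5 * ρ) * (4 * ρ) ≤ a * e * ρ / 2 := by
      have : 20 * K * ρ ≤ a * e / 2 := by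
        calc 20 * K * ρ ≤ 20 * K * (C * e ^ 3) := by gcongr
          _ = (100 * K * C * e ^ 2) * (e / 5) := by ring
          _ ≤ a * (e / 5) := by gcongr
          _ ≤ a * e / 2 := by have : 0 < a * e := by positivity
                              linarith
      nlinarith
    linarith
  have key : ∀ x ∈ Icc t t', a ^ 2 / (1000 * C) / e ≤
      -(sinAt γ x z * (curvature γ x - sinAt γ x z / ‖z - γ x‖)) := by
    intro x hx
    have hr0 : 0 < ‖z - γ x‖ := norm_pos_iff.2 (sub_ne_zero.2 (hz x))
    have h1 : a * e / 10 ≤ sinAt γ x z := by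
      rw [sinAt, le_div_iff₀ hr0]
      refine le_trans ?_ (hhx x hx)
      have := mul_le_mul_of_nonneg_left (hrx x hx) (by positivity : 0 ≤ a * e / 10)
      linarith
    have h2 : a / (50 * C * e ^ 2) ≤ sinAt γ x z / ‖z - γ x‖ := by
      rw [le_div_iff₀ hr0]
      refine le_trans ?_ h1
      rw [div_mul_eq_mul_div, div_le_iff₀ (by positivity)]
      have : ‖z - γ x‖ ≤ 5 * (C * e ^ 3) := (hrx x hx).trans (by linarith)
      have := mul_le_mul_of_nonneg_left this ha.le
      linarith
    have h3 : K ≤ a / (100 * C * e ^ 2) := by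
      rw [le_div_iff₀ (by positivity)]; linarith
    have h4 : a / (50 * C * e ^ 2) = 2 * (a / (100 * C * e ^ 2)) := by field_simp; norm_num
    have h5 : a / (100 * C * e ^ 2) ≤ sinAt γ x z / ‖z - γ x‖ - curvature γ x := by
      linarith [B.curv_le x]
    calc a ^ 2 / (1000 * C) / e = (a * e / 10) * (a / (100 * C * e ^ 2)) := by
          field_simp; norm_num
      _ ≤ sinAt γ x z * (sinAt γ x z / ‖z - γ x‖ - curvature γ x) :=
          mul_le_mul h1 h5 (by positivity) (le_trans (by positivity) h1)
      _ = _ := by ring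
  have := mul_sub_le_of_le_hasDerivAt (f := fun x => -cosAt γ x z) htt'
    (fun x _ => (h.hasDerivAt_cosAt (hz x)).neg) key
  linarith

set_option maxHeartbeats 600000 in
/-- A link of small angle that passes through a point `z` close to `γ σ` has one end close to
`γ σ`: either the end on this side of `z` (short class) or the other one (long class). -/
theorem exists_end_classification (h : IsBoundaryParametrization Ω ℓ γ)
    (hΩ : IsSmoothStrictlyConvexDomain Ω) (B : CurveBounds γ κ₀ K δ) {a A θ : ℝ} (ha : 0 < a)
    (hA : 0 < A) (hθ0 : 0 < θ)
    (hθ : K * θ ≤ κ₀ / 32) (hθ' : K * θ ≤ 1 / 32) (hθκ : θ ≤ κ₀ / 32) :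
    ∃ ϑ > 0, ∃ c > 0, ∃ C > 0, ∀ᶠ e in 𝓝[>] (0 : ℝ), ∀ (z : Plane) (t σ : ℝ),
      (∀ x, z ≠ γ x) → ‖z - γ σ‖ ≤ e ^ 4 →
      a * e ≤ sinAt γ t z → sinAt γ t z ≤ A * e →
      (‖z - γ t‖ ≤ ϑ * e → ‖z - γ t‖ ≤ C * e ^ 3 ∧ ∃ k : ℤ, |t - σ - k * ℓ| ≤ C * e ^ 3) ∧
      (ϑ * e < ‖z - γ t‖ → ∃ k : ℤ, c * e ≤ |t - σ - k * ℓ| ∧ |t - σ - k * ℓ| ≤ C * e ∧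
        0 < (σ + k * ℓ - t) * cosAt γ t z) := by
  have hK := B.K_pos
  have hκ := B.pos
  have hℓ := h.length_pos
  obtain ⟨m, hm, hnear⟩ := h.exists_chord_arc B
  obtain ⟨m', hm', hlat⟩ := h.exists_cross_lt_imp_near hΩ hθ0
  obtain ⟨D, hD⟩ := exists_bound_of_periodic h.length_pos h.periodic h.continuous
  have hD0 : 0 ≤ D := (norm_nonneg _).trans (hD 0)
  -- with `r` the distance of `z`, the height of `γ σ` over the tangent at `γ t` is `a e r` at
  -- least, up to `e ^ 4`, and of order `K r ^ 2` at most if `r` is small; so `r ≤ a e / (16 K)`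
  -- forces `r = O(e ^ 3)`
  refine ⟨a / (16 * K), by positivity, a / K, by positivity,
    max (16 / a + 4) (4 * A / κ₀), by positivity, ?_⟩
  filter_upwards [eventually_pos_le one_pos, eventually_mul_le (a / (16 * K) + 1) (half_pos hm),
    eventually_mul_le (2 * (a / (16 * K) + 1)) B.delta_pos, eventually_mul_le (64 * K) ha,
    eventually_mul_le (8 * K) one_pos,
    eventually_mul_le (2 * (A * (2 * D + 1) + 1)) hm',
    eventually_mul_le 1 (by positivity : 0 < a / (32 * K)),
    eventually_mul_le 1 (by positivity : 0 < θ * (a / (32 * K)) ^ 2)] with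
    e ⟨he0, he1⟩ s1 s1' s2 s3 s4 s5 s6
  intro z t σ hz hzσ hs hs'
  have e41 : e ^ 4 ≤ e := by
    have := pow_le_of_le_one he0.le he1 (n := 4) (by norm_num); exact this
  have e43 : e ^ 4 ≤ e ^ 3 := by
    have := mul_le_mul_of_nonneg_left he1 (pow_nonneg he0.le 3); linarith
  have hr0 : 0 < ‖z - γ t‖ := norm_pos_iff.2 (sub_ne_zero.2 (hz t))
  obtain ⟨r, hr⟩ : ∃ r, r = ‖z - γ t‖ := ⟨_, rfl⟩
  have e2 : |cross (deriv γ t) (z - γ σ)| ≤ e ^ 4 :=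
    (abs_cross_le _ _).trans (by rw [h.unit_speed, one_mul]; exact hzσ)
  have e3 : cross (deriv γ t) (z - γ t) =
      cross (deriv γ t) (γ σ - γ t) + cross (deriv γ t) (z - γ σ) := by
    rw [← cross_add_right]; congr 1; abel
  have e5 : r ≤ ‖γ σ - γ t‖ + ‖z - γ σ‖ := by
    have : z - γ t = (γ σ - γ t) + (z - γ σ) := by abel
    rw [hr, this]; exact norm_add_le _ _
  have e6 : ‖γ σ - γ t‖ ≤ r + ‖z - γ σ‖ := by
    have : γ σ - γ t = (z - γ t) - (z - γ σ) := by abel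
    rw [hr, this]; exact _root_.norm_sub_le _ _
  have hsr : a * e * r ≤ cross (deriv γ t) (z - γ t) ∧ cross (deriv γ t) (z - γ t) ≤ A * e * r := by
    rw [sinAt, ← hr, le_div_iff₀ (hr ▸ hr0)] at hs
    rw [sinAt, ← hr, div_le_iff₀ (hr ▸ hr0)] at hs'
    exact ⟨hs, hs'⟩
  rw [e3] at hsr
  rw [abs_le] at e2
  rw [← hr] at hr0 ⊢
  constructor
  · intro hlt
    have hd : ‖γ t - γ σ‖ ≤ r + e ^ 4 := by rw [norm_sub_rev]; linarith
    have hd1 : r + e ^ 4 < m := by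
      linarith only [hlt, e41, s1, hm]
    obtain ⟨k, hk⟩ := hnear σ t (hd.trans_lt hd1)
    have hk' : |t - σ - k * ℓ| ≤ 2 * (r + e ^ 4) := hk.trans (by linarith)
    have hkδ : |(σ + k * ℓ) - t| ≤ δ := by
      rw [abs_sub_comm, show t - (σ + k * ℓ) = t - σ - k * ℓ by ring]
      refine hk'.trans ?_
      linarith
    have h1 := h.cross_tangent_chord_le B hkδ
    rw [h.periodic.int_mul k σ, ← sq_abs, abs_sub_comm,
      show t - (σ + k * ℓ) = t - σ - k * ℓ by ring] at h1
    have h2 : |t - σ - k * ℓ| ^ 2 ≤ (2 * (r + e ^ 4)) ^ 2 := by gcongr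
    have h3 : a * e * r ≤ 8 * K * r ^ 2 + 8 * K * (e ^ 4) ^ 2 + e ^ 4 := by
      have q1 : ∀ q : ℝ, (2 * (r + q)) ^ 2 ≤ 8 * r ^ 2 + 8 * q ^ 2 := fun q => by
        nlinarith only [sq_nonneg (r - q)]
      have q2 := mul_le_mul_of_nonneg_left (h2.trans (q1 (e ^ 4))) hK.le
      linarith only [q2, h1, hsr.1, e2.2]
    have h4 : 8 * K * (e ^ 4) ^ 2 ≤ e ^ 4 := by
      have q1 : 8 * K * e ^ 4 ≤ 1 := le_trans (by gcongr) s3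
      have q2 := mul_le_mul_of_nonneg_right q1 (pow_pos he0 4).le
      linarith only [q2]
    have h5 : 8 * K * r ^ 2 ≤ a * e * r / 2 := by
      have : 8 * K * r ≤ a * e / 2 := by
        have := mul_le_mul_of_nonneg_left hlt (by positivity : 0 ≤ 8 * K)
        have e9 : 8 * K * (a / (16 * K) * e) = a * e / 2 := by field_simp; norm_num
        linarith only [this, e9]
      have q2 := mul_le_mul_of_nonneg_right this hr0.le
      linarith only [q2]
    have h6 : r ≤ 4 / a * e ^ 3 := by
      rw [div_mul_eq_mul_div, le_div_iff₀ ha]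
      have h7 : a * e * r ≤ 4 * e ^ 4 := by linarith only [h3, h4, h5]
      have h8 : e * (r * a) ≤ e * (4 * e ^ 3) := by linarith only [h7]
      exact le_of_mul_le_mul_left h8 he0
    have h7 : (16 / a + 4) * e ^ 3 ≤ max (16 / a + 4) (4 * A / κ₀) * e ^ 3 := by
      gcongr; exact le_max_left _ _
    have h8 : 0 < e ^ 3 := pow_pos he0 3
    have h9 : 16 / a * e ^ 3 = 4 * (4 / a * e ^ 3) := by ring
    have h10 : 0 < 4 / a * e ^ 3 := by positivity
    refine ⟨le_trans ?_ h7, k, hk'.trans (le_trans ?_ h7)⟩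
    · linarith only [h6, h8, h9, h10]
    · linarith only [h6, h8, h9, h10, e43]
  · intro hlt
    have hrD : r ≤ 2 * D + 1 := by
      have : ‖γ σ - γ t‖ ≤ D + D := (_root_.norm_sub_le _ _).trans (add_le_add (hD _) (hD _))
      linarith
    have hcr : cross (deriv γ t) (γ σ - γ t) < m' := by
      have : A * e * r ≤ A * e * (2 * D + 1) := by gcongr
      have h2 : A * e * (2 * D + 1) + e ≤ m' / 2 := by linarith only [s4]
      linarith only [this, h2, hsr.2, e2.1, e41, hm']
    obtain ⟨k, hk⟩ := hlat t σ hcr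
    have hg : |t - (σ - k * ℓ)| = |σ - t - k * ℓ| := by
      rw [abs_sub_comm]; congr 1; ring
    obtain ⟨g, hgd⟩ : ∃ g, g = |t - (σ - k * ℓ)| := ⟨_, rfl⟩
    have hgr : r ≤ g + e ^ 4 := by
      have := h.norm_sub_le t (σ - k * ℓ)
      rw [h.periodic.sub_int_mul_eq k, abs_sub_comm, ← hgd] at this
      linarith
    have hge : a / (32 * K) * e ≤ g := by
      have h1 : e ^ 4 ≤ a / (32 * K) * e := by
        have : e ^ 4 ≤ e * e := by
          have q3 : e ^ 4 = e * e * e ^ 2 := by ring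
          have h2 : e ^ 2 ≤ 1 := pow_le_one₀ he0.le he1
          have := mul_le_mul_of_nonneg_left h2 (mul_pos he0 he0).le
          linarith only [this, h2, q3]
        have q2 := mul_le_mul_of_nonneg_right s5 he0.le
        linarith only [this, q2]
      have h2 : a / (16 * K) * e = a / (32 * K) * e + a / (32 * K) * e := by field_simp; norm_num
      linarith
    have hg0 : 0 < g := lt_of_lt_of_le (by positivity) hge
    have hzg : ‖z - γ (σ - k * ℓ)‖ ≤ θ * |t - (σ - k * ℓ)| ^ 2 := by
      rw [h.periodic.sub_int_mul_eq k, ← hgd]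
      refine hzσ.trans ?_
      have h1 : (a / (32 * K) * e) ^ 2 ≤ g ^ 2 := by gcongr
      have h2 : e ^ 4 ≤ e * e ^ 2 := by linarith
      have h3 : e * e ^ 2 ≤ θ * (a / (32 * K)) ^ 2 * e ^ 2 := by
        have := sq_nonneg e
        gcongr
        linarith
      calc e ^ 4 ≤ θ * (a / (32 * K)) ^ 2 * e ^ 2 := h2.trans h3
        _ = θ * (a / (32 * K) * e) ^ 2 := by ring
        _ ≤ θ * g ^ 2 := by gcongr
    obtain ⟨f1, f2, f3, -, -⟩ := h.sinAt_near B hθ hθ' hθκ (t := t) (σ := σ - k * ℓ) (z := z)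
      (fun hc => hg0.ne' (by rw [hgd, hc, sub_self, abs_zero]))
      (by rw [hg]; exact hk.le) hzg
    rw [← hgd] at f1 f2
    refine ⟨-k, ?_, ?_, ?_⟩
    · push_cast
      rw [show t - σ - -(k : ℝ) * ℓ = t - (σ - k * ℓ) by ring, ← hgd, div_mul_eq_mul_div,
        div_le_iff₀ hK]
      linarith
    · push_cast
      rw [show t - σ - -(k : ℝ) * ℓ = t - (σ - k * ℓ) by ring, ← hgd]
      have : g ≤ 4 * A / κ₀ * e := by
        rw [div_mul_eq_mul_div, le_div_iff₀ hκ]; linarith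
      refine this.trans ?_
      gcongr; exact le_max_right _ _
    · push_cast
      rw [show σ + -(k : ℝ) * ℓ - t = σ - k * ℓ - t by ring]; exact f3

end IsBoundaryParametrization

/-! ### Monotonicity at the ends -/

/-- The position of a point `z` near `γ σ` relative to a bounce at `γ t` at angle of order `e`. The
sign `ς` is `1` if the orbit comes from `z` and `-1` if it goes to `z`. The end is short if `z` is
within `ϑ e` of `γ t`, and long otherwise; at a long end the bounce is on the far side of `σ`, seen
along the orbit. -/
structure EndData (γ : ℝ → Plane) (a A ϑ c C e σ ς t : ℝ) (z : Plane) : Prop where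
  sin_ge : a * e ≤ sinAt γ t z
  sin_le : sinAt γ t z ≤ A * e
  cos_neg : ς * cosAt γ t z < 0
  short : ‖z - γ t‖ ≤ ϑ * e → ‖z - γ t‖ ≤ C * e ^ 3 ∧ |t - σ| ≤ C * e ^ 3
  long : ϑ * e < ‖z - γ t‖ → c * e ≤ ς * (t - σ) ∧ ς * (t - σ) ≤ C * e

/-- Minus the derivative, in the Lazutkin parameter `u` of the bounce, of the part of the action
contributed by the link from or to the end point `z`. On a billiard path it equals, by the
reflection law, the derivative of the action of the other link at that bounce. -/
noncomputable def endAction (γ : ℝ → Plane) (s : ℝ → ℝ) (ς : ℝ) (z : Plane) (u : ℝ) : ℝ :=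
  -(ς * (deriv s u * (1 + ς * cosAt γ (s u) z)))

/-- Bounds for a smooth increasing reparametrization over a compact interval. -/
theorem exists_window_bounds {s : ℝ → ℝ} (hs : ContDiff ℝ ∞ s) (hpos : ∀ u, 0 < deriv s u)
    (a b : ℝ) : ∃ w₁ > 0, w₁ ≤ 1 ∧ ∃ w₂ ≥ 1, (∀ u ∈ Icc a b, w₁ ≤ deriv s u ∧ deriv s u ≤ w₂) ∧
      (∀ u ∈ Icc a b, ∀ u' ∈ Icc a b, |deriv s u' - deriv s u| ≤ w₂ * |u' - u|) ∧
      ∀ u ∈ Icc a b, ∀ u' ∈ Icc a b, u ≤ u' →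
        w₁ * (u' - u) ≤ s u' - s u ∧ s u' - s u ≤ w₂ * (u' - u) := by
  have hd : ContDiff ℝ ∞ (deriv s) := (contDiff_infty_iff_deriv.1 hs).2
  obtain ⟨C₁, hC₁⟩ := isCompact_Icc.exists_bound_of_continuousOn (s := Icc a b)
    hd.continuous.continuousOn
  obtain ⟨C₂, hC₂⟩ := isCompact_Icc.exists_bound_of_continuousOn (s := Icc a b)
    (f := fun u => (deriv s u)⁻¹) (hd.continuous.inv₀ fun u => (hpos u).ne').continuousOn
  obtain ⟨C₃, hC₃⟩ := hd.contDiffOn.exists_lipschitzOnWith (by simp) (convex_Icc a b) isCompact_Icc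
  have b1 : ∀ u ∈ Icc a b, (max C₂ 1)⁻¹ ≤ deriv s u := fun u hu => by
    have := hC₂ u hu
    rw [Real.norm_eq_abs, abs_of_pos (inv_pos.2 (hpos u))] at this
    exact inv_le_of_inv_le₀ (hpos u) (this.trans (le_max_left _ _))
  have b2 : ∀ u ∈ Icc a b, deriv s u ≤ max (max C₁ C₃) 1 := fun u hu =>
    ((le_abs_self _).trans (hC₁ u hu)).trans ((le_max_left _ _).trans (le_max_left _ _))
  have hsd : ∀ x, HasDerivAt s (deriv s x) x := fun x => (hs.differentiable (by simp) x).hasDerivAt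
  refine ⟨(max C₂ 1)⁻¹, by positivity, inv_le_one_of_one_le₀ (le_max_right _ _),
    max (max C₁ C₃) 1, le_max_right _ _, fun u hu => ⟨b1 u hu, b2 u hu⟩, ?_, ?_⟩
  · intro u hu u' hu'
    have := hC₃.dist_le_mul u' hu' u hu
    rw [Real.dist_eq, Real.dist_eq] at this
    refine this.trans (mul_le_mul_of_nonneg_right ?_ (abs_nonneg _))
    exact (le_max_right _ _).trans (le_max_left _ _)
  · intro u hu u' hu' huu'
    refine ⟨mul_sub_le_of_le_hasDerivAt huu' (fun x _ => hsd x)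
      fun x hx => b1 x ⟨hu.1.trans hx.1, hx.2.trans hu'.2⟩, ?_⟩
    have := mul_sub_le_of_le_hasDerivAt (C := -max (max C₁ C₃) 1) huu' (fun x _ => (hsd x).neg)
      fun x hx => neg_le_neg (b2 x ⟨hu.1.trans hx.1, hx.2.trans hu'.2⟩)
    simp only [Pi.neg_apply] at this
    linarith

namespace IsBoundaryParametrization

variable {Ω : Set Plane} {ℓ : ℝ} {γ : ℝ → Plane} {κ₀ K δ : ℝ} {s : ℝ → ℝ}

/-- At a bounce at angle of order `e`, the factor `1 + ς cos` in the end term is of order `e ^ 2`,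
so that the variation of the reparametrization has little effect. -/
theorem one_add_cos_le (h : IsBoundaryParametrization Ω ℓ γ) {t ς : ℝ} {z : Plane} (hz : z ≠ γ t)
    (hς : ς = 1 ∨ ς = -1) (hc : ς * cosAt γ t z < 0) :
    0 ≤ 1 + ς * cosAt γ t z ∧ 1 + ς * cosAt γ t z ≤ sinAt γ t z ^ 2 := by
  have h1 := h.cosAt_sq_add_sinAt_sq hz
  have h2 : (ς * cosAt γ t z) ^ 2 = cosAt γ t z ^ 2 := by rcases hς with rfl | rfl <;> ring
  constructor <;> nlinarith [sq_nonneg (sinAt γ t z)]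

theorem endAction_sub {ς : ℝ} (hς : ς = 1 ∨ ς = -1) (z : Plane) (u u' : ℝ) :
    endAction γ s ς z u' - endAction γ s ς z u =
      -(deriv s u * (cosAt γ (s u') z - cosAt γ (s u) z)) -
        ς * ((deriv s u' - deriv s u) * (1 + ς * cosAt γ (s u') z)) := by
  unfold endAction
  rcases hς with rfl | rfl <;> ring

/-- At an end of the long class the end term is strongly monotone. -/
theorem exists_endAction_long (h : IsBoundaryParametrization Ω ℓ γ)
    (hs : ContDiff ℝ ∞ s) (hmono : StrictMono s) (hpos : ∀ u, 0 < deriv s u)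
    (B : CurveBounds γ κ₀ K δ) (p q : ℝ) {a A ϑ c C θ : ℝ} (ha : 0 < a) (hc : 0 < c)
    (hθ0 : 0 < θ) (hθ : K * θ ≤ κ₀ / 32) (hθ' : K * θ ≤ 1 / 32) (hθκ : θ ≤ κ₀ / 32) :
    ∃ c' > 0, ∀ᶠ e in 𝓝[>] (0 : ℝ), ∀ (z : Plane) (σ ς u u' : ℝ), ς = 1 ∨ ς = -1 →
      (∀ x, z ≠ γ x) → ‖z - γ σ‖ ≤ e ^ 4 → u ∈ Icc p q → u' ∈ Icc p q →
      EndData γ a A ϑ c C e σ ς (s u) z → EndData γ a A ϑ c C e σ ς (s u') z →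
      ϑ * e < ‖z - γ (s u)‖ → ϑ * e < ‖z - γ (s u')‖ →
      (endAction γ s ς z u' - endAction γ s ς z u) * (u' - u) ≤ -(c' * e) * (u' - u) ^ 2 := by
  obtain ⟨w₁, hw₁, -, w₂, hw₂, hw, hwl, hsl⟩ := exists_window_bounds hs hpos p q
  have hκ := B.pos
  obtain ⟨G, hG⟩ : ∃ G, G = w₁ * (κ₀ ^ 2 / 16 * c * w₁) := ⟨_, rfl⟩
  have hG0 : 0 < G := by rw [hG]; positivity
  refine ⟨G / 2, by positivity, ?_⟩
  filter_upwards [eventually_pos_le one_pos, eventually_mul_le C hθ0,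
    eventually_mul_le 1 (by positivity : 0 < θ * c ^ 2),
    eventually_mul_le (w₂ * A ^ 2) (by positivity : 0 < G / 2)] with e ⟨he0, he1⟩ s1 s2 s3
  intro z σ ς u u' hς hz hzσ hu hu' E E' L L'
  wlog huu' : u ≤ u' generalizing u u'
  · have := this u' u hu' hu E' E L' L (le_of_not_ge huu')
    nlinarith
  obtain ⟨l1, l2⟩ := E.long L
  obtain ⟨l3, l4⟩ := E'.long L'
  have hz' : ‖z - γ σ‖ ≤ θ * (c * e) ^ 2 := by
    refine hzσ.trans ?_
    have e2 : 0 ≤ e ^ 2 := by positivity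
    have : e * e ^ 2 * e ≤ θ * c ^ 2 * e ^ 2 * 1 := by
      rw [one_mul] at s2; gcongr
    nlinarith
  have hg := h.cosAt_growth_long B (t := s u) (t' := s u') (σ := σ) hθ hθ' hθκ (g := c * e)
    (by positivity) hθ0 (hmono.monotone huu') (by
      rcases hς with rfl | rfl
      · left; constructor <;> linarith
      · right; constructor <;> linarith) hz'
  obtain ⟨d1, d2⟩ := h.one_add_cos_le (hz (s u')) hς E'.cos_neg
  have d3 : sinAt γ (s u') z ^ 2 ≤ (A * e) ^ 2 :=
    pow_le_pow_left₀ (le_trans (by positivity) E'.sin_ge) E'.sin_le 2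
  have hx : 0 ≤ u' - u := by linarith
  have m1 : κ₀ ^ 2 / 16 * (c * e) * (w₁ * (u' - u)) ≤ cosAt γ (s u') z - cosAt γ (s u) z :=
    le_trans (mul_le_mul_of_nonneg_left (hsl u hu u' hu' huu').1 (by positivity)) hg
  have m2 : w₁ * (κ₀ ^ 2 / 16 * (c * e) * (w₁ * (u' - u))) ≤
      deriv s u * (cosAt γ (s u') z - cosAt γ (s u) z) :=
    mul_le_mul (hw u hu).1 m1 (by positivity) (hpos u).le
  have m3 : |ς * ((deriv s u' - deriv s u) * (1 + ς * cosAt γ (s u') z))| ≤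
      w₂ * (u' - u) * (A * e) ^ 2 := by
    have a1 : |ς| = 1 := by rcases hς with rfl | rfl <;> simp
    rw [abs_mul, a1, one_mul, abs_mul, abs_of_nonneg d1]
    have a2 := hwl u hu u' hu'
    rw [abs_of_nonneg hx] at a2
    exact mul_le_mul a2 (d2.trans d3) d1 (by positivity)
  have m4 : w₂ * (u' - u) * (A * e) ^ 2 ≤ G / 2 * e * (u' - u) := by
    have := mul_le_mul_of_nonneg_right s3 (mul_nonneg he0.le hx)
    linarith
  rw [endAction_sub hς]
  have m5 := neg_abs_le (ς * ((deriv s u' - deriv s u) * (1 + ς * cosAt γ (s u') z)))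
  have m6 : -(deriv s u * (cosAt γ (s u') z - cosAt γ (s u) z)) -
        ς * ((deriv s u' - deriv s u) * (1 + ς * cosAt γ (s u') z)) ≤ -(G / 2 * e) * (u' - u) := by
    have m7 : w₁ * (κ₀ ^ 2 / 16 * (c * e) * (w₁ * (u' - u))) = G * e * (u' - u) := by rw [hG]; ring
    linarith
  have := mul_le_mul_of_nonneg_right m6 hx
  linarith

/-- At an end of the short class the end term varies so fast that the bounce is pinned. -/
theorem exists_endAction_short (h : IsBoundaryParametrization Ω ℓ γ)
    (hs : ContDiff ℝ ∞ s) (hmono : StrictMono s) (hpos : ∀ u, 0 < deriv s u)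
    (B : CurveBounds γ κ₀ K δ) (p q : ℝ) {a A ϑ c C : ℝ} (ha : 0 < a) (hC : 0 < C) :
    ∃ c' > 0, ∀ᶠ e in 𝓝[>] (0 : ℝ), ∀ (z : Plane) (σ ς u u' : ℝ), ς = 1 ∨ ς = -1 →
      (∀ x, z ≠ γ x) → u ∈ Icc p q → u' ∈ Icc p q →
      EndData γ a A ϑ c C e σ ς (s u) z → EndData γ a A ϑ c C e σ ς (s u') z →
      ‖z - γ (s u)‖ ≤ ϑ * e → ‖z - γ (s u')‖ ≤ ϑ * e →
      c' / e * |u' - u| ≤ |endAction γ s ς z u' - endAction γ s ς z u| := by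
  obtain ⟨w₁, hw₁, -, w₂, hw₂, hw, hwl, hsl⟩ := exists_window_bounds hs hpos p q
  obtain ⟨G, hG⟩ : ∃ G, G = w₁ * (a ^ 2 / (1000 * C) * w₁) := ⟨_, rfl⟩
  have hG0 : 0 < G := by rw [hG]; positivity
  refine ⟨G / 2, by positivity, ?_⟩
  filter_upwards [eventually_pos_le one_pos, h.eventually_cosAt_decay_short B ha hC,
    eventually_mul_le (2 * C) B.delta_pos,
    eventually_mul_le (w₂ * A ^ 2) (by positivity : 0 < G / 2)] with e ⟨he0, he1⟩ s1 s2 s3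
  intro z σ ς u u' hς hz hu hu' E E' L L'
  wlog huu' : u ≤ u' generalizing u u'
  · have := this u' u hu' hu E' E L' L (le_of_not_ge huu')
    rwa [abs_sub_comm, abs_sub_comm (endAction γ s ς z u)] at this
  obtain ⟨l1, l2⟩ := E.short L
  obtain ⟨l3, l4⟩ := E'.short L'
  have e31 : e ^ 3 ≤ e := pow_le_of_le_one he0.le he1 (by norm_num)
  have hg := s1 z (s u) (s u') (hmono.monotone huu') (by
    rw [abs_le] at l2 l4
    have : C * e ^ 3 ≤ C * e := by gcongr
    linarith [l2.1, l4.2]) hz l1 l3 E.sin_ge E'.sin_ge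
  obtain ⟨d1, d2⟩ := h.one_add_cos_le (hz (s u')) hς E'.cos_neg
  have d3 : sinAt γ (s u') z ^ 2 ≤ (A * e) ^ 2 :=
    pow_le_pow_left₀ (le_trans (by positivity) E'.sin_ge) E'.sin_le 2
  have hx : 0 ≤ u' - u := by linarith
  have m1 : a ^ 2 / (1000 * C) / e * (w₁ * (u' - u)) ≤ cosAt γ (s u) z - cosAt γ (s u') z :=
    le_trans (mul_le_mul_of_nonneg_left (hsl u hu u' hu' huu').1 (by positivity)) hg
  have m2 : w₁ * (a ^ 2 / (1000 * C) / e * (w₁ * (u' - u))) ≤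
      deriv s u * (cosAt γ (s u) z - cosAt γ (s u') z) :=
    mul_le_mul (hw u hu).1 m1 (by positivity) (hpos u).le
  have m3 : |ς * ((deriv s u' - deriv s u) * (1 + ς * cosAt γ (s u') z))| ≤
      w₂ * (u' - u) * (A * e) ^ 2 := by
    have a1 : |ς| = 1 := by rcases hς with rfl | rfl <;> simp
    rw [abs_mul, a1, one_mul, abs_mul, abs_of_nonneg d1]
    have a2 := hwl u hu u' hu'
    rw [abs_of_nonneg hx] at a2
    exact mul_le_mul a2 (d2.trans d3) d1 (by positivity)
  have m4 : w₂ * (u' - u) * (A * e) ^ 2 ≤ G / 2 / e * (u' - u) := by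
    have q1 : w₂ * A ^ 2 * e * e ≤ G / 2 / e := by
      rw [le_div_iff₀ he0]
      have q2 : e * e ≤ 1 := by nlinarith
      have q3 : w₂ * A ^ 2 * e * (e * e) ≤ G / 2 * 1 := by gcongr
      linarith
    have := mul_le_mul_of_nonneg_right q1 hx
    linarith
  rw [endAction_sub hς, abs_of_nonneg hx]
  have m5 := le_abs_self (ς * ((deriv s u' - deriv s u) * (1 + ς * cosAt γ (s u') z)))
  refine le_trans ?_ (le_abs_self _)
  have m7 : w₁ * (a ^ 2 / (1000 * C) / e * (w₁ * (u' - u))) = G / e * (u' - u) := by rw [hG]; ring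
  have m8 : G / e * (u' - u) = G / 2 / e * (u' - u) + G / 2 / e * (u' - u) := by
    field_simp; norm_num
  linarith

end IsBoundaryParametrization

/-- The end condition needed by the discrete Poincaré argument follows at both kinds of ends. Here
`E` is the variation of the end term, `ξ` that of the bounce next to the end, and `ξ'` that of its
neighbour. At a short end, `ξ` is at most of order `e ^ 2` times `ξ' - ξ`. -/
theorem exists_end_condition {m C c₁ c₂ : ℝ} (hm : 0 < m) (hC : 0 < C) (hc₁ : 0 < c₁)
    (hc₂ : 0 < c₂) : ∀ᶠ e in 𝓝[>] (0 : ℝ), ∀ E ξ ξ' : ℝ, |E| ≤ C * e * (|ξ| + |ξ'|) →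
      (E * ξ ≤ -(c₁ * e) * ξ ^ 2 ∨ c₂ / e * |ξ| ≤ |E|) →
      E * ξ ≤ -(c₁ * e) * ξ ^ 2 + m * e * (ξ' - ξ) ^ 2 := by
  obtain ⟨D, hD⟩ : ∃ D, D = C / c₂ := ⟨_, rfl⟩
  have hD0 : 0 < D := by rw [hD]; positivity
  filter_upwards [eventually_pos_le one_pos, eventually_mul_le D (by norm_num : (0 : ℝ) < 1 / 4),
    eventually_mul_le (4 * C * D + 4 * c₁ * D ^ 2) hm] with e ⟨he0, he1⟩ s1 s2
  intro E ξ ξ' hE hor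
  rcases hor with hor | hor
  · have : 0 ≤ m * e * (ξ' - ξ) ^ 2 := by positivity
    linarith
  · obtain ⟨η, hη⟩ : ∃ η, η = |ξ' - ξ| := ⟨_, rfl⟩
    have hη0 : 0 ≤ η := hη ▸ abs_nonneg _
    have h1 : |ξ'| ≤ |ξ| + η := by
      have := abs_add_le ξ (ξ' - ξ); rw [add_sub_cancel] at this; rw [hη]; exact this
    have h0 := abs_nonneg ξ
    have h2 : |ξ| ≤ D * e ^ 2 * (|ξ| + |ξ'|) := by
      have := hor.trans hE
      rw [div_mul_eq_mul_div, div_le_iff₀ he0] at this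
      rw [hD, div_mul_eq_mul_div, div_mul_eq_mul_div, le_div_iff₀ hc₂]
      linarith
    have e2 : D * e ^ 2 ≤ 1 / 4 := by
      refine le_trans ?_ s1
      have : e ^ 2 ≤ e := by nlinarith
      gcongr
    have h3 : |ξ| ≤ 2 * D * e ^ 2 * η := by
      have a1 : D * e ^ 2 * (|ξ| + |ξ'|) ≤ D * e ^ 2 * (2 * |ξ| + η) :=
        mul_le_mul_of_nonneg_left (by linarith) (by positivity)
      have a2 : D * e ^ 2 * |ξ| ≤ 1 / 4 * |ξ| := by gcongr
      linarith
    have h4 : |ξ| ≤ η / 2 := by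
      have : 2 * D * e ^ 2 * η ≤ 2 * (1 / 4) * η := by
        have := mul_le_mul_of_nonneg_right e2 hη0; linarith
      linarith
    have h5 : E * ξ ≤ C * e * (2 * η) * (2 * D * e ^ 2 * η) := by
      refine (le_abs_self _).trans ?_
      rw [abs_mul]
      refine mul_le_mul (hE.trans ?_) h3 h0 (by positivity)
      exact mul_le_mul_of_nonneg_left (by linarith) (by positivity)
    have h6 : c₁ * e * ξ ^ 2 ≤ c₁ * e * (2 * D * e ^ 2 * η) ^ 2 := by
      rw [← sq_abs ξ]; gcongr
    have h7 : (ξ' - ξ) ^ 2 = η ^ 2 := by rw [hη, sq_abs]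
    have e3 : e ^ 3 ≤ e * e := by nlinarith [mul_pos he0 he0]
    have e5 : e ^ 5 ≤ e * e := by
      have : e ^ 5 = e * e * e ^ 3 := by ring
      have h2 : e ^ 3 ≤ 1 := pow_le_one₀ he0.le he1
      nlinarith [mul_pos he0 he0]
    have h8 : (4 * C * D * e ^ 3 + 4 * c₁ * D ^ 2 * e ^ 5) * η ^ 2 ≤ m * e * η ^ 2 := by
      refine mul_le_mul_of_nonneg_right ?_ (sq_nonneg _)
      have a1 : 4 * C * D * e ^ 3 ≤ 4 * C * D * (e * e) := by gcongr
      have a2 : 4 * c₁ * D ^ 2 * e ^ 5 ≤ 4 * c₁ * D ^ 2 * (e * e) := by gcongr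
      have a3 := mul_le_mul_of_nonneg_right s2 he0.le
      linarith
    rw [h7]
    linarith

/-! ### Uniqueness in each class -/

/-- `t 0 < ⋯ < t n` are lifts of the bounces of a billiard path from `x` to `y` making approximately
one turn; `t (n + 1)` is the next impact, at which the last link prolonged beyond `y` arrives. -/
structure IsConnecting (ℓ : ℝ) (γ : ℝ → Plane) (n : ℕ) (x y : Plane) (t : ℕ → ℝ) : Prop where
  seq : IsBilliardSeq ℓ γ t (n + 1)
  first : cosAt γ (t 0) (γ (t 1)) = -cosAt γ (t 0) x
  last : y ∈ openSegment ℝ (γ (t n)) (γ (t (n + 1)))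
  total : |t (n + 1) - t 0 - ℓ| ≤ ℓ / 100

theorem tendsto_one_div_nat_succ :
    Tendsto (fun n : ℕ => 1 / ((n : ℝ) + 1)) atTop (𝓝[>] (0 : ℝ)) :=
  tendsto_nhdsWithin_iff.2 ⟨tendsto_one_div_add_atTop_nhds_zero_nat,
    Eventually.of_forall fun n => by simp only [mem_Ioi]; positivity⟩

theorem cosAt_sinAt_eq_of_mem_openSegment {γ : ℝ → Plane} {t : ℝ} {y w : Plane}
    (hy : y ∈ openSegment ℝ (γ t) w) : cosAt γ t y = cosAt γ t w ∧ sinAt γ t y = sinAt γ t w := by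
  rw [openSegment_eq_image'] at hy
  obtain ⟨r, hr, rfl⟩ := hy
  have hr0 : r ≠ 0 := hr.1.ne'
  simp only [cosAt, sinAt, add_sub_cancel_left, inner_smul_right, cross_smul_right, norm_smul,
    Real.norm_eq_abs, abs_of_pos hr.1]
  rw [mul_div_mul_left _ _ hr0, mul_div_mul_left _ _ hr0]
  exact ⟨rfl, rfl⟩

namespace IsBoundaryParametrization

variable {Ω : Set Plane} {ℓ : ℝ} {γ : ℝ → Plane} {κ₀ K δ : ℝ} {s : ℝ → ℝ}

theorem sinAt_sub_int_mul (h : IsBoundaryParametrization Ω ℓ γ) (s : ℝ) (k : ℤ) (z : Plane) :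
    sinAt γ (s - k * ℓ) z = sinAt γ s z := by
  rw [sinAt, sinAt, h.periodic.sub_int_mul_eq k, (periodic_deriv h.periodic).sub_int_mul_eq k]

theorem sub_int_mul (h : IsBoundaryParametrization Ω ℓ γ) (s : ℝ) (k : ℤ) :
    γ (s - k * ℓ) = γ s := h.periodic.sub_int_mul_eq k

theorem isConnecting_sub_int_mul (h : IsBoundaryParametrization Ω ℓ γ) {n : ℕ} {x y : Plane}
    {t : ℕ → ℝ} (ht : IsConnecting ℓ γ n x y t) (k : ℤ) :
    IsConnecting ℓ γ n x y (fun i => t i - k * ℓ) where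
  seq := ⟨fun i hi => by linarith [ht.seq.lt_succ i hi], fun i hi => by
    linarith [ht.seq.succ_lt i hi], fun i hi => by
    simpa only [h.cosAt_sub_int_mul, h.sub_int_mul] using ht.seq.reflect i hi⟩
  first := by simpa only [h.cosAt_sub_int_mul, h.sub_int_mul] using ht.first
  last := by simpa only [h.sub_int_mul] using ht.last
  total := by
    have := ht.total
    rwa [show t (n + 1) - k * ℓ - (t 0 - k * ℓ) - ℓ = t (n + 1) - t 0 - ℓ by ring]

/-- Connecting sequences between points close to `γ σ` turn, up to a deck transformation, exactly
once from `σ` to `σ + ℓ`, with all gaps of order `1 / n`. -/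
theorem exists_connecting_normal_form (h : IsBoundaryParametrization Ω ℓ γ)
    (hΩ : IsSmoothStrictlyConvexDomain Ω) (B : CurveBounds γ κ₀ K δ) {θ : ℝ} (hθ0 : 0 < θ)
    (hθ : K * θ ≤ κ₀ / 32) (hθ' : K * θ ≤ 1 / 32) (hθκ : θ ≤ κ₀ / 32) :
    ∃ m > 0, ∃ M > 0, ∃ a > 0, ∃ A > 0, ∃ ϑ > 0, ∃ c > 0, ∃ C > 0,
      ∀ᶠ n : ℕ in atTop, ∀ e, e = 1 / ((n : ℝ) + 1) → ∀ (x y : Plane) (σ : ℝ) (t : ℕ → ℝ),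
        x ∈ Ω → y ∈ Ω → ‖x - γ σ‖ ≤ e ^ 4 → ‖y - γ σ‖ ≤ e ^ 4 → IsConnecting ℓ γ n x y t →
        ∃ i : ℤ, EndData γ a A ϑ c C e σ 1 (t 0 - i * ℓ) x ∧
          EndData γ a A ϑ c C e (σ + ℓ) (-1) (t n - i * ℓ) y ∧
          ∀ k ≤ n, m * e ≤ t (k + 1) - t k ∧ t (k + 1) - t k ≤ M * e ∧
            σ - ℓ ≤ t k - i * ℓ ∧ t k - i * ℓ ≤ σ + 2 * ℓ := by
  obtain ⟨m, hm, M, hM, n₀, hg⟩ := h.exists_gap_bounds hΩ B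
  have hκ := B.pos
  have hK := B.K_pos
  have hℓ := h.length_pos
  have ha : 0 < κ₀ / 4 * m := by positivity
  have hA : 0 < 2 * K * M := by positivity
  obtain ⟨ϑ, hϑ, c, hc, C, hC, hcl⟩ := h.exists_end_classification hΩ B ha hA hθ0 hθ hθ' hθκ
  refine ⟨m, hm, M, hM, _, ha, _, hA, ϑ, hϑ, c, hc, C, hC, ?_⟩
  filter_upwards [eventually_ge_atTop n₀, tendsto_one_div_nat_succ.eventually (hcl.and
    ((eventually_mul_le M B.delta_pos).and ((eventually_mul_le (M + 2 * C)
      (by positivity : 0 < ℓ / 4)).and (eventually_pos_le one_pos))))] with n hn hev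
  intro e he x y σ t hx hy hxσ hyσ ht
  rw [← he] at hev
  obtain ⟨hcl, s1, s2, he0, he1⟩ := hev
  have htot := abs_le.1 ht.total
  have hgap : ∀ k ≤ n, m * e ≤ t (k + 1) - t k ∧ t (k + 1) - t k ≤ M * e := fun k hk => by
    have := hg t n hn ht.seq (by linarith [ht.seq.lt_succ n (by lia), htot.2]) k hk
    rw [div_eq_mul_one_div M, div_eq_mul_one_div m, ← he] at this
    exact ⟨this.2 (by linarith [htot.1]), this.1⟩
  -- the direction of the path at its first and last bounce
  have hsin : ∀ k ≤ n, κ₀ / 4 * m * e ≤ sinAt γ (t k) (γ (t (k + 1))) ∧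
      sinAt γ (t k) (γ (t (k + 1))) ≤ 2 * K * M * e ∧ 0 < cosAt γ (t k) (γ (t (k + 1))) := by
    intro k hk
    obtain ⟨g1, g2⟩ := hgap k hk
    have hme : 0 < m * e := by positivity
    have h0 : t (k + 1) ≠ t k := by intro h0; rw [h0] at g1; linarith
    have hp : 0 < t (k + 1) - t k := by linarith
    have hd : |t (k + 1) - t k| ≤ δ := by rw [abs_of_pos hp]; linarith
    have q1 := h.le_sinAt B h0 hd
    have q2 := h.sinAt_le B h0 hd
    rw [abs_of_pos hp] at q1 q2
    refine ⟨?_, ?_, pos_of_mul_pos_right (h.cosAt_mul_pos B h0 hd) hp.le⟩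
    · have := mul_le_mul_of_nonneg_left g1 (by positivity : 0 ≤ κ₀ / 4)
      linarith
    · have := mul_le_mul_of_nonneg_left g2 (by positivity : 0 ≤ 2 * K)
      linarith
  obtain ⟨y1, y2, y3⟩ := hsin n le_rfl
  obtain ⟨yc, ys⟩ := cosAt_sinAt_eq_of_mem_openSegment ht.last
  rw [← ys] at y1 y2
  rw [← yc] at y3
  obtain ⟨x1, x2, x3⟩ := hsin 0 (Nat.zero_le _)
  have hne : γ (t 1) ≠ γ (t 0) :=
    h.chord_ne (ht.seq.lt_succ 0 (by lia)) (ht.seq.succ_lt 0 (by lia))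
  have xs : sinAt γ (t 0) (γ (t (0 + 1))) = sinAt γ (t 0) x :=
    sin_eq_of_cos_eq_neg (h.cosAt_sq_add_sinAt_sq hne)
      (h.cosAt_sq_add_sinAt_sq (h.mem_ne hΩ hx)) (h.sinAt_pos hΩ hne) (h.sinAt_pos_of_mem hΩ hx)
      ht.first
  rw [xs] at x1 x2
  rw [zero_add, ht.first] at x3
  have hxn := fun w => h.mem_ne hΩ hx (s := w)
  have hyn := fun w => h.mem_ne hΩ hy (s := w)
  obtain ⟨xsh, xlo⟩ := hcl x (t 0) σ hxn hxσ x1 x2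
  obtain ⟨ysh, ylo⟩ := hcl y (t n) σ hyn hyσ y1 y2
  have e31 : C * e ^ 3 ≤ C * e := by
    gcongr; exact pow_le_of_le_one he0.le he1 (by norm_num)
  obtain ⟨i, i1, i2, i3⟩ : ∃ i : ℤ, |t 0 - σ - i * ℓ| ≤ C * e ∧
      (‖x - γ (t 0)‖ ≤ ϑ * e → ‖x - γ (t 0)‖ ≤ C * e ^ 3 ∧ |t 0 - σ - i * ℓ| ≤ C * e ^ 3) ∧
      (ϑ * e < ‖x - γ (t 0)‖ → c * e ≤ t 0 - σ - i * ℓ) := by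
    rcases le_or_gt ‖x - γ (t 0)‖ (ϑ * e) with hle | hlt
    · obtain ⟨p1, i, p2⟩ := xsh hle
      exact ⟨i, p2.trans e31, fun _ => ⟨p1, p2⟩, fun hc => absurd hle (not_le.2 hc)⟩
    · obtain ⟨i, p1, p2, p3⟩ := xlo hlt
      refine ⟨i, p2, fun hc => absurd hlt (not_lt.2 hc), fun _ => ?_⟩
      rwa [abs_of_pos] at p1
      nlinarith
  obtain ⟨i', j1, j2, j3⟩ : ∃ i : ℤ, |t n - σ - i * ℓ| ≤ C * e ∧
      (‖y - γ (t n)‖ ≤ ϑ * e → ‖y - γ (t n)‖ ≤ C * e ^ 3 ∧ |t n - σ - i * ℓ| ≤ C * e ^ 3) ∧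
      (ϑ * e < ‖y - γ (t n)‖ → c * e ≤ -(t n - σ - i * ℓ)) := by
    rcases le_or_gt ‖y - γ (t n)‖ (ϑ * e) with hle | hlt
    · obtain ⟨p1, i, p2⟩ := ysh hle
      exact ⟨i, p2.trans e31, fun _ => ⟨p1, p2⟩, fun hc => absurd hle (not_le.2 hc)⟩
    · obtain ⟨i, p1, p2, p3⟩ := ylo hlt
      refine ⟨i, p2, fun hc => absurd hlt (not_lt.2 hc), fun _ => ?_⟩
      rwa [abs_of_neg] at p1
      nlinarith
  have hi := abs_le.1 i1
  have hj := abs_le.1 j1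
  have hgn := hgap n le_rfl
  have hme : 0 < m * e := by positivity
  -- the path makes one turn, up to a hundredth, so that its ends are at consecutive lifts of `σ`
  obtain rfl : i' = i + 1 := by
    have q1 : ((i' - i - 1 : ℤ) : ℝ) * ℓ < 1 * ℓ := by push_cast; linarith
    have q2 : (-1 : ℝ) * ℓ < ((i' - i - 1 : ℤ) : ℝ) * ℓ := by push_cast; linarith
    have q3 := lt_of_mul_lt_mul_right q1 hℓ.le
    have q4 := lt_of_mul_lt_mul_right q2 hℓ.le
    have q5 : i' - i - 1 < 1 := by exact_mod_cast q3
    have q6 : -1 < i' - i - 1 := by exact_mod_cast q4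
    lia
  push_cast at j1 j2 j3 hj
  refine ⟨i, ⟨?_, ?_, ?_, ?_, ?_⟩, ⟨?_, ?_, ?_, ?_, ?_⟩,
    fun k hk => ⟨(hgap k hk).1, (hgap k hk).2, ?_⟩⟩
  · rwa [h.sinAt_sub_int_mul]
  · rwa [h.sinAt_sub_int_mul]
  · rw [h.cosAt_sub_int_mul]; linarith
  · rw [h.sub_int_mul, show t 0 - i * ℓ - σ = t 0 - σ - i * ℓ by ring]; exact i2
  · rw [h.sub_int_mul, show 1 * (t 0 - i * ℓ - σ) = t 0 - σ - i * ℓ by ring]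
    exact fun hl => ⟨i3 hl, hi.2⟩
  · rwa [h.sinAt_sub_int_mul]
  · rwa [h.sinAt_sub_int_mul]
  · rw [h.cosAt_sub_int_mul]; linarith
  · rw [h.sub_int_mul, show t n - i * ℓ - (σ + ℓ) = t n - σ - (i + 1) * ℓ by ring]; exact j2
  · rw [h.sub_int_mul, show -1 * (t n - i * ℓ - (σ + ℓ)) = -(t n - σ - (i + 1) * ℓ) by ring]
    exact fun hl => ⟨j3 hl, by linarith [hj.1]⟩
  · have q1 := ht.seq.le_of_le (Nat.zero_le k) (by lia)
    have q2 := ht.seq.le_of_le hk (by lia)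
    constructor <;> linarith [hi.1, hj.2]

/-- For large `n` a connecting sequence is determined, up to a deck transformation, by whether its
first and last links are short. -/
theorem exists_connecting_unique (h : IsBoundaryParametrization Ω ℓ γ)
    (hΩ : IsSmoothStrictlyConvexDomain Ω) :
    ∃ ϑ : ℝ, ∀ᶠ n : ℕ in atTop, ∀ e, e = 1 / ((n : ℝ) + 1) →
      ∀ (x y : Plane) (σ : ℝ) (t t' : ℕ → ℝ), x ∈ Ω → y ∈ Ω → ‖x - γ σ‖ ≤ e ^ 4 →
        ‖y - γ σ‖ ≤ e ^ 4 → IsConnecting ℓ γ n x y t → IsConnecting ℓ γ n x y t' →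
        (‖x - γ (t 0)‖ ≤ ϑ * e ↔ ‖x - γ (t' 0)‖ ≤ ϑ * e) →
        (‖y - γ (t n)‖ ≤ ϑ * e ↔ ‖y - γ (t' n)‖ ≤ ϑ * e) → ∀ k ≤ n, γ (t k) = γ (t' k) := by
  obtain ⟨κ₀, K, δ, B⟩ := h.exists_bounds
  have hκ := B.pos
  have hK := B.K_pos
  have hℓ := h.length_pos
  obtain ⟨θ, hθ0, hθ, hθ', hθκ⟩ : ∃ θ > 0, K * θ ≤ κ₀ / 32 ∧ K * θ ≤ 1 / 32 ∧ θ ≤ κ₀ / 32 := by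
    refine ⟨min (κ₀ / 32) (1 / 32) / K, by positivity, ?_, ?_, ?_⟩
    · rw [mul_div_cancel₀ _ hK.ne']; exact min_le_left _ _
    · rw [mul_div_cancel₀ _ hK.ne']; exact min_le_right _ _
    · exact (div_le_self (by positivity) B.one_le).trans (min_le_left _ _)
  obtain ⟨m, hm, M, hM, a, ha, A, hA, ϑ, hϑ, c, hc, C, hC, hnf⟩ :=
    h.exists_connecting_normal_form hΩ B hθ0 hθ hθ' hθκ
  obtain ⟨s, U, hs, hmono, -, hsU, hpos, hcurv⟩ := h.exists_lazutkin
  have hUle : ∀ p q, p ≤ q → U p ≤ U q := fun p q hpq => by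
    rw [← hmono.le_iff_le, hsU, hsU]; exact hpq
  have hUlt : ∀ p q, p < q → U p < U q := fun p q hpq => by
    rw [← hmono.lt_iff_lt, hsU, hsU]; exact hpq
  obtain ⟨p, hp⟩ : ∃ p, p = U (-ℓ) := ⟨_, rfl⟩
  obtain ⟨q, hq⟩ : ∃ q, q = U (4 * ℓ) := ⟨_, rfl⟩
  obtain ⟨w₁, hw₁, -, w₂, hw₂, -, -, hsl⟩ := exists_window_bounds hs hpos p q
  have hw₂0 : 0 < w₂ := by linarith
  obtain ⟨D, hD, -, C', hC', hact⟩ := h.exists_action_monotone hs hmono hcurv p q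
  obtain ⟨c₁, hc₁, hlong⟩ := h.exists_endAction_long hs hmono hpos B p q (A := A) (ϑ := ϑ) (C := C)
    ha hc hθ0 hθ hθ' hθκ
  obtain ⟨c₂, hc₂, hshort⟩ := h.exists_endAction_short hs hmono hpos B p q (A := A) (ϑ := ϑ)
    (c := c) ha hC
  obtain ⟨M', hM'⟩ : ∃ M', M' = M / w₁ := ⟨_, rfl⟩
  have hM'0 : 0 < M' := by rw [hM']; positivity
  obtain ⟨m', hm'⟩ : ∃ m', m' = m / w₂ := ⟨_, rfl⟩
  have hm'0 : 0 < m' := by rw [hm']; positivity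
  have hend := exists_end_condition (m := m' / 32) (C := C' * M') (c₁ := c₁) (c₂ := c₂)
    (by positivity) (by positivity) hc₁ hc₂
  refine ⟨ϑ, ?_⟩
  filter_upwards [hnf, eventually_ge_atTop 1, tendsto_one_div_nat_succ.eventually
    ((((hlong.and hshort).and hend).and (eventually_mul_le M' hD)).and
    (((eventually_mul_le (C' * M' ^ 2) (by positivity : 0 < m' / 8)).and
    (eventually_mul_le (4 * (C' * M' ^ 4)) (by positivity : 0 < m' / 16))).and
    ((eventually_mul_le (2 * (C' * M' ^ 4)) (by positivity : 0 < c₁ / 2)).and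
    (eventually_pos_le one_pos))))] with n hnf hn1 hev
  rintro e he x y σ₀ t₀ t₀' hx hy hxσ₀ hyσ₀ hc₀ hc₀' hcx hcy
  rw [← he] at hev
  obtain ⟨⟨⟨⟨hlong, hshort⟩, hend⟩, s1⟩, ⟨s2, s3⟩, s4, he0, he1⟩ := hev
  have hne : (n : ℝ) * e ≤ 1 := by
    rw [he, mul_one_div, div_le_one (by positivity)]; linarith
  -- constants are available only over a compact window of parameters; deck transformations move
  -- both paths into it
  obtain ⟨σ, hσ, hσeq⟩ := h.periodic.exists_mem_Ico₀ hℓ σ₀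
  rw [hσeq] at hxσ₀ hyσ₀
  obtain ⟨i, E0, E1, hk⟩ := hnf e he x y σ t₀ hx hy hxσ₀ hyσ₀ hc₀
  obtain ⟨i', E0', E1', hk'⟩ := hnf e he x y σ t₀' hx hy hxσ₀ hyσ₀ hc₀'
  have hT := h.isConnecting_sub_int_mul hc₀ i
  have hT' := h.isConnecting_sub_int_mul hc₀' i'
  obtain ⟨t, ht⟩ : ∃ t : ℕ → ℝ, t = fun k => t₀ k - i * ℓ := ⟨_, rfl⟩
  obtain ⟨t', ht'⟩ : ∃ t : ℕ → ℝ, t = fun k => t₀' k - i' * ℓ := ⟨_, rfl⟩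
  have htk : ∀ k, t₀ k - i * ℓ = t k := fun k => by rw [ht]
  have htk' : ∀ k, t₀' k - i' * ℓ = t' k := fun k => by rw [ht']
  simp only [htk] at hT E0 E1 hk
  simp only [htk'] at hT' E0' E1' hk'
  have hγ : ∀ k, γ (t₀ k) = γ (t k) := fun k => by rw [ht, h.sub_int_mul]
  have hγ' : ∀ k, γ (t₀' k) = γ (t' k) := fun k => by rw [ht', h.sub_int_mul]
  rw [hγ, hγ'] at hcx hcy
  obtain ⟨u, hu⟩ : ∃ u : ℕ → ℝ, u = fun k => U (t k) := ⟨_, rfl⟩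
  obtain ⟨u', hu'⟩ : ∃ u : ℕ → ℝ, u = fun k => U (t' k) := ⟨_, rfl⟩
  have su : ∀ k, s (u k) = t k := fun k => by rw [hu]; exact hsU _
  have su' : ∀ k, s (u' k) = t' k := fun k => by rw [hu']; exact hsU _
  -- the gaps in the Lazutkin parameter
  have key : ∀ (t₀ : ℕ → ℝ) (i : ℤ) (t : ℕ → ℝ), (∀ k, t₀ k - i * ℓ = t k) →
      (∀ k ≤ n, m * e ≤ t₀ (k + 1) - t₀ k ∧
      t₀ (k + 1) - t₀ k ≤ M * e ∧ σ - ℓ ≤ t k ∧ t k ≤ σ + 2 * ℓ) →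
      ∀ k ≤ n, U (t k) ∈ Icc p q ∧ (k < n → U (t k) < U (t (k + 1)) ∧
        m' * e ≤ U (t (k + 1)) - U (t k) ∧ U (t (k + 1)) - U (t k) ≤ M' * e) := by
    intro t₀ i t htk hk k hkn
    have hin : ∀ k ≤ n, U (t k) ∈ Icc p q := fun k hkn => by
      obtain ⟨-, -, h3, h4⟩ := hk k hkn
      rw [hp, hq]
      exact ⟨hUle _ _ (by linarith [hσ.1]), hUle _ _ (by linarith [hσ.2])⟩
    refine ⟨hin k hkn, fun hlt => ?_⟩
    obtain ⟨h1, h2, -⟩ := hk k hkn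
    have hgt : t (k + 1) - t k = t₀ (k + 1) - t₀ k := by rw [← htk, ← htk]; ring
    rw [← hgt] at h1 h2
    have hme : 0 < m * e := by positivity
    have hlt' := hUlt (t k) (t (k + 1)) (by linarith)
    obtain ⟨h3, h4⟩ := hsl _ (hin k hkn) _ (hin (k + 1) hlt) hlt'.le
    rw [hsU, hsU] at h3 h4
    refine ⟨hlt', ?_, ?_⟩
    · rw [hm', div_mul_eq_mul_div, div_le_iff₀ hw₂0]; linarith
    · rw [hM', div_mul_eq_mul_div, le_div_iff₀ hw₁]; linarith
  have hU := key t₀ i t htk hk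
  have hU' := key t₀' i' t' htk' hk'
  have euk : ∀ k, U (t k) = u k := fun k => by rw [hu]
  have euk' : ∀ k, U (t' k) = u' k := fun k => by rw [hu']
  simp only [euk] at hU
  simp only [euk'] at hU'
  have hlink := fun k (hk : k < n) => hact (u k) (hU k hk.le).1 (u' k) (hU' k hk.le).1 (u (k + 1))
    (u' (k + 1)) (M' * e) ((hU k hk.le).2 hk).1 ((hU' k hk.le).2 hk).1 ((hU k hk.le).2 hk).2.2
    ((hU' k hk.le).2 hk).2.2 s1
  -- at either end the discrete boundary term has the right sign
  have hends : ∀ (ς σ v v' ξ' E : ℝ) (z : Plane), ς = 1 ∨ ς = -1 → z ∈ Ω → ‖z - γ σ‖ ≤ e ^ 4 →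
      v ∈ Icc p q → v' ∈ Icc p q → EndData γ a A ϑ c C e σ ς (s v) z →
      EndData γ a A ϑ c C e σ ς (s v') z →
      (‖z - γ (s v)‖ ≤ ϑ * e ↔ ‖z - γ (s v')‖ ≤ ϑ * e) →
      E = endAction γ s ς z v' - endAction γ s ς z v →
      |E| ≤ C' * M' * e * (|v' - v| + |ξ'|) →
      E * (v' - v) ≤ -(c₁ * e) * (v' - v) ^ 2 + m' / 32 * e * (ξ' - (v' - v)) ^ 2 := by
    intro ς σ v v' ξ' E z hς hz hzσ hv hv' E0 E0' hiff hE hEb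
    refine hend E (v' - v) ξ' hEb ?_
    rw [hE]
    rcases le_or_gt ‖z - γ (s v)‖ (ϑ * e) with hle | hlt
    · exact Or.inr (hshort z σ ς v v' hς (fun w => h.mem_ne hΩ hz) hv hv' E0 E0' hle (hiff.1 hle))
    · exact Or.inl (hlong z σ ς v v' hς (fun w => h.mem_ne hΩ hz) hzσ hv hv' E0 E0' hlt
        (not_le.1 fun hc => not_le.2 hlt (hiff.2 hc)))
  have hyσ : ‖y - γ (σ + ℓ)‖ ≤ e ^ 4 := by rwa [h.periodic]
  have hzero : ∀ k ≤ n, u' k - u k = 0 := by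
    refine eq_zero_of_discrete_monotone (n := n) hn1 (ξ := fun k => u' k - u k)
      (P := fun k => actionLeft γ s (u' k) (u' (k + 1)) - actionLeft γ s (u k) (u (k + 1)))
      (R := fun k => actionRight γ s (u' k) (u' (k + 1)) - actionRight γ s (u k) (u (k + 1)))
      (α := m' / 8 * e) (β := C' * (M' * e) ^ 4) (c := c₁ * e) (by positivity) ?_ ?_ ?_ ?_ ?_ ?_
    · intro k hk
      refine le_trans ?_ (hlink k hk).1
      have g1 := ((hU k hk.le).2 hk).2.1
      have g2 := ((hU' k hk.le).2 hk).2.1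
      have g3 := mul_le_mul_of_nonneg_right s2 he0.le
      have : m' / 8 * e ≤ (u (k + 1) - u k + (u' (k + 1) - u' k)) / 8 - C' * (M' * e) ^ 2 := by
        have : C' * (M' * e) ^ 2 = C' * M' ^ 2 * e * e := by ring
        linarith
      have q1 := mul_le_mul_of_nonneg_right this (sq_nonneg (u' (k + 1) - u (k + 1) - (u' k - u k)))
      linarith
    · intro k hk
      have r1 := hT.seq.reflect k (by lia)
      have r2 := hT'.seq.reflect k (by lia)
      simp only [actionLeft, actionRight, su, su', r1, r2]
      ring
    · have hb := (hlink 0 (by lia)).2.1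
      refine (hends 1 σ (u 0) (u' 0) (u' 1 - u 1) _ x (Or.inl rfl) hx hxσ₀ (hU 0 (by lia)).1
        (hU' 0 (by lia)).1 (by rwa [su]) (by rwa [su']) (by rwa [su, su']) ?_ ?_).trans
        (le_of_eq (by ring))
      · have r1 := hT.first
        have r2 := hT'.first
        simp only [actionLeft, endAction, su, su', zero_add, r1, r2]
        ring
      · simpa only [zero_add, mul_assoc] using hb
    · obtain ⟨l, rfl⟩ : ∃ l, n = l + 1 := ⟨n - 1, by lia⟩
      have hb := (hlink l (by lia)).2.2
      simp only [Nat.add_sub_cancel]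
      refine (hends (-1) (σ + ℓ) (u (l + 1)) (u' (l + 1)) (u' l - u l) _ y (Or.inr rfl) hy hyσ
        (hU _ le_rfl).1 (hU' _ le_rfl).1 (by rwa [su]) (by rwa [su']) (by rwa [su, su']) ?_
        ?_).trans ?_
      · have r1 := hT.seq.reflect l (by lia)
        have r2 := hT'.seq.reflect l (by lia)
        rw [← (cosAt_sinAt_eq_of_mem_openSegment hT.last).1] at r1
        rw [← (cosAt_sinAt_eq_of_mem_openSegment hT'.last).1] at r2
        simp only [actionRight, endAction, su, su', r1, r2]
        ring
      · rw [add_comm |u' (l + 1) - u (l + 1)|]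
        simpa only [mul_assoc] using hb
      · have : 0 ≤ c₁ * e * (u' (l + 1) - u (l + 1)) ^ 2 := by positivity
        nlinarith
    · have q1 := mul_le_mul_of_nonneg_right s3 he0.le
      have q2 : ((n : ℝ) * e) ^ 2 ≤ 1 := pow_le_one₀ (by positivity) hne
      have q3 : 4 * (C' * M' ^ 4) * e * e * ((n : ℝ) * e) ^ 2 ≤ 4 * (C' * M' ^ 4) * e * e * 1 :=
        mul_le_mul_of_nonneg_left q2 (by positivity)
      have q4 : 0 < m' * e := by positivity
      have q5 : 4 * (C' * (M' * e) ^ 4) * n ^ 2 =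
        4 * (C' * M' ^ 4) * e * e * ((n : ℝ) * e) ^ 2 := by ring
      rw [q5]
      linarith
    · have q1 := mul_le_mul_of_nonneg_right s4 he0.le
      have q3 : 2 * (C' * M' ^ 4) * (e * e * e) * ((n : ℝ) * e) ≤
          2 * (C' * M' ^ 4) * (e * e * e) * 1 := mul_le_mul_of_nonneg_left hne (by positivity)
      have q6 : e * e * e ≤ e * e * 1 := mul_le_mul_of_nonneg_left he1 (by positivity)
      have q7 := mul_le_mul_of_nonneg_left q6 (by positivity : 0 ≤ 2 * (C' * M' ^ 4))
      have q4 : 0 < c₁ * e := by positivity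
      have q5 : 2 * (C' * (M' * e) ^ 4) * n =
        2 * (C' * M' ^ 4) * (e * e * e) * ((n : ℝ) * e) := by ring
      rw [q5]
      linarith
  intro k hk
  rw [hγ, hγ', ← su, ← su', sub_eq_zero.1 (hzero k hk)]

end IsBoundaryParametrization

/-! ### The billiard map and shooting -/

theorem inner_mul_inner_sub (u v w : Plane) :
    inner ℝ u w * inner ℝ v v - inner ℝ u v * inner ℝ v w = -(cross u v * cross v w) := by
  simp only [plane_inner_eq, cross]; ring

/-- The next impact of the ray leaving `γ b` at an angle of cosine `p` to the tangent. It is unique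
for `-1 < p < 1`, and meaningless for other values of `p`. -/
noncomputable def nextImpact (ℓ : ℝ) (γ : ℝ → Plane) (b p : ℝ) : ℝ :=
  Classical.epsilon fun t => b < t ∧ t < b + ℓ ∧ cosAt γ b (γ t) = p

/-- The lift of the billiard map, in the coordinates arclength and cosine of the outgoing angle. -/
noncomputable def billiardMap (ℓ : ℝ) (γ : ℝ → Plane) (q : ℝ × ℝ) : ℝ × ℝ :=
  (nextImpact ℓ γ q.1 q.2, -cosAt γ (nextImpact ℓ γ q.1 q.2) (γ q.1))

/-- The `k`-th impact, counted from the first bounce at `γ b`, of the billiard path which arrives at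
that bounce from `x`. -/
noncomputable def impact (ℓ : ℝ) (γ : ℝ → Plane) (x : Plane) (k : ℕ) (b : ℝ) : ℝ :=
  ((billiardMap ℓ γ)^[k] (b, -cosAt γ b x)).1

namespace IsBoundaryParametrization

variable {Ω : Set Plane} {ℓ : ℝ} {γ : ℝ → Plane} {κ₀ K δ : ℝ} {s : ℝ → ℝ}

theorem continuousAt_cosAt (h : IsBoundaryParametrization Ω ℓ γ) {b : ℝ} {z : Plane}
    (hz : z ≠ γ b) : ContinuousAt (fun q : ℝ × Plane => cosAt γ q.1 q.2) (b, z) := by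
  have h1 : Continuous fun q : ℝ × Plane => q.2 - γ q.1 :=
    continuous_snd.sub (h.continuous.comp continuous_fst)
  have h2 : Continuous fun q : ℝ × Plane => inner ℝ (deriv γ q.1) (q.2 - γ q.1) :=
    (h.contDiff_deriv.continuous.comp continuous_fst).inner h1
  exact h2.continuousAt.div h1.norm.continuousAt (norm_ne_zero_iff.2 (sub_ne_zero.2 hz))

theorem continuousAt_cosAt_chord (h : IsBoundaryParametrization Ω ℓ γ) {b t : ℝ}
    (ht : γ t ≠ γ b) : ContinuousAt (fun q : ℝ × ℝ => cosAt γ q.1 (γ q.2)) (b, t) :=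
  ContinuousAt.comp (x := (b, t)) (f := fun q : ℝ × ℝ => (q.1, γ q.2))
    (h.continuousAt_cosAt ht)
    (continuous_fst.prodMk (h.continuous.comp continuous_snd)).continuousAt

theorem hasDerivAt_cosAt_chord (h : IsBoundaryParametrization Ω ℓ γ) {b t : ℝ} (ht : γ t ≠ γ b) :
    HasDerivAt (fun t => cosAt γ b (γ t))
      (-(cross (deriv γ b) (γ t - γ b) * cross (deriv γ t) (γ b - γ t)) / ‖γ t - γ b‖ ^ 3) t := by
  have h0 : γ t - γ b ≠ 0 := sub_ne_zero.2 ht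
  have h1 := (h.hasDerivAt t).sub_const (γ b)
  have hn : ‖γ t - γ b‖ ≠ 0 := norm_ne_zero_iff.2 h0
  have h2 := hasDerivAt_norm h1 h0
  have h3 := (hasDerivAt_const t (deriv γ b)).inner ℝ h1
  refine (h3.div h2 hn).congr_deriv ?_
  have h4 := inner_mul_inner_sub (deriv γ b) (γ t - γ b) (deriv γ t)
  have h5 : cross (deriv γ t) (γ b - γ t) = cross (γ t - γ b) (deriv γ t) := by
    rw [cross_swap, ← neg_sub, ← cross_neg_right]
    simp [cross]; ring
  rw [h5, ← h4, real_inner_self_eq_norm_sq, inner_zero_left, add_zero]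
  field_simp

/-- Seen from `γ b`, the points of the boundary are met in the order of their directions. -/
theorem strictAntiOn_cosAt (h : IsBoundaryParametrization Ω ℓ γ)
    (hΩ : IsSmoothStrictlyConvexDomain Ω) (b : ℝ) :
    StrictAntiOn (fun t => cosAt γ b (γ t)) (Ioo b (b + ℓ)) := by
  have hd : ∀ t ∈ Ioo b (b + ℓ), _ := fun t ht => h.hasDerivAt_cosAt_chord (h.chord_ne ht.1 ht.2)
  refine strictAntiOn_of_deriv_neg (convex_Ioo _ _)
    (fun t ht => (hd t ht).continuousAt.continuousWithinAt) fun t ht => ?_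
  rw [interior_Ioo] at ht
  rw [(hd t ht).deriv]
  have hne := h.chord_ne ht.1 ht.2
  have h1 := h.cross_pos hΩ hne
  have h2 := h.cross_pos hΩ hne.symm
  have h3 : 0 < ‖γ t - γ b‖ := norm_pos_iff.2 (sub_ne_zero.2 hne)
  rw [neg_div, neg_lt_zero]
  positivity

theorem abs_cosAt_lt_one (h : IsBoundaryParametrization Ω ℓ γ) {s : ℝ} {z : Plane}
    (hz : z ≠ γ s) (hs : 0 < sinAt γ s z) : -1 < cosAt γ s z ∧ cosAt γ s z < 1 := by
  have := h.cosAt_sq_add_sinAt_sq hz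
  constructor <;> nlinarith

theorem nextImpact_spec (h : IsBoundaryParametrization Ω ℓ γ)
    (hΩ : IsSmoothStrictlyConvexDomain Ω) (b : ℝ) {p : ℝ} (hp : -1 < p) (hp' : p < 1) :
    b < nextImpact ℓ γ b p ∧ nextImpact ℓ γ b p < b + ℓ ∧
      cosAt γ b (γ (nextImpact ℓ γ b p)) = p := by
  refine Classical.epsilon_spec (p := fun t => b < t ∧ t < b + ℓ ∧ cosAt γ b (γ t) = p) ?_
  obtain ⟨κ₀, K, δ, B⟩ := h.exists_bounds
  have hK := B.K_pos
  have hℓ := h.length_pos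
  have hδ := B.delta_pos
  -- nearly tangent directions meet the boundary close to `γ b`, on either side of it
  obtain ⟨g, hg0, hgδ, hgℓ, hg⟩ : ∃ g > 0, g ≤ δ ∧ g < ℓ / 2 ∧ (2 * K * g) ^ 2 < 1 - p ^ 2 := by
    have h1 : ContinuousAt (fun g : ℝ => (2 * K * g) ^ 2) 0 := by fun_prop
    have h2 : ∀ᶠ g in 𝓝 (0 : ℝ), (2 * K * g) ^ 2 < 1 - p ^ 2 :=
      h1.eventually_lt continuousAt_const (by nlinarith)
    obtain ⟨g, hg1, hg2, hg3⟩ := ((h2.filter_mono nhdsWithin_le_nhds).and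
      ((eventually_pos_le hδ).and (eventually_pos_le (by positivity : 0 < ℓ / 4)))).exists
    exact ⟨g, hg2.1, hg2.2, by linarith, hg1⟩
  have aux : ∀ t, |t - b| = g → 1 - cosAt γ b (γ t) ^ 2 < 1 - p ^ 2 := fun t ht => by
    have hne : γ t ≠ γ b := by
      rw [Ne, h.eq_iff]
      rintro ⟨k, hk⟩
      have : |t - b| = |(k : ℝ)| * ℓ := by
        rw [hk, ← abs_of_pos hℓ, ← abs_mul, abs_sub_comm]; congr 1; rw [abs_of_pos hℓ]; ring
      rw [ht] at this
      rcases eq_or_ne k 0 with rfl | hk0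
      · simp at this; linarith
      · have h1 : (1 : ℝ) ≤ |(k : ℝ)| := by exact_mod_cast Int.one_le_abs hk0
        nlinarith
    have h0 : t ≠ b := fun hc => hne (by rw [hc])
    have h2 := h.sinAt_le B h0 (ht.le.trans hgδ)
    rw [ht] at h2
    have h3 := pow_le_pow_left₀ (h.sinAt_pos hΩ hne).le h2 2
    linarith [h.cosAt_sq_add_sinAt_sq hne]
  have r1 : p < cosAt γ b (γ (b + g)) := by
    have h1 := aux (b + g) (by rw [add_sub_cancel_left, abs_of_pos hg0])
    have h2 := h.cosAt_mul_pos B (s := b) (t := b + g) (by linarith)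
      (by rw [add_sub_cancel_left, abs_of_pos hg0]; exact hgδ)
    rw [add_sub_cancel_left] at h2
    have := pos_of_mul_pos_right h2 hg0.le
    nlinarith
  have r2 : cosAt γ b (γ (b + ℓ - g)) < p := by
    rw [show b + ℓ - g = b - g + ℓ by ring, h.periodic]
    have e1 : |b - g - b| = g := by rw [show b - g - b = -g by ring, abs_neg, abs_of_pos hg0]
    have h1 := aux (b - g) e1
    have h2 := h.cosAt_mul_pos B (s := b) (t := b - g) (by linarith) (by rw [e1]; exact hgδ)
    rw [show b - g - b = -g by ring] at h2
    have : cosAt γ b (γ (b - g)) < 0 := by nlinarith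
    nlinarith
  have hc : ContinuousOn (fun t => cosAt γ b (γ t)) (Icc (b + g) (b + ℓ - g)) := fun t ht =>
    (h.hasDerivAt_cosAt_chord (h.chord_ne (by linarith [ht.1])
      (by linarith [ht.2]))).continuousAt.continuousWithinAt
  obtain ⟨t, ht, hte⟩ := intermediate_value_Icc' (by linarith) hc ⟨r2.le, r1.le⟩
  exact ⟨t, by linarith [ht.1], by linarith [ht.2], hte⟩

/-- Continuity of the billiard map, by comparison with fixed directions on either side of the
impact. -/
theorem continuousAt_nextImpact (h : IsBoundaryParametrization Ω ℓ γ)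
    (hΩ : IsSmoothStrictlyConvexDomain Ω) (b : ℝ) {p : ℝ} (hp : -1 < p) (hp' : p < 1) :
    ContinuousAt (fun q : ℝ × ℝ => nextImpact ℓ γ q.1 q.2) (b, p) := by
  obtain ⟨h1, h2, h3⟩ := h.nextImpact_spec hΩ b hp hp'
  have hanti := h.strictAntiOn_cosAt hΩ
  have hstrip : ∀ᶠ q : ℝ × ℝ in 𝓝 (b, p), -1 < q.2 ∧ q.2 < 1 :=
    (continuousAt_const.eventually_lt continuousAt_snd hp).and
      (continuousAt_snd.eventually_lt continuousAt_const hp')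
  have hcos : ∀ t, b < t → t < b + ℓ →
      ContinuousAt (fun q : ℝ × ℝ => cosAt γ q.1 (γ t)) (b, p) := fun t ht ht' =>
    ContinuousAt.comp (x := (b, p)) (f := fun q : ℝ × ℝ => (q.1, t))
      (h.continuousAt_cosAt_chord (h.chord_ne ht ht')) (by fun_prop)
  refine tendsto_order.2 ⟨fun a ha => ?_, fun a ha => ?_⟩
  · obtain ⟨a', ha1, ha2⟩ : ∃ a', max a b < a' ∧ a' < nextImpact ℓ γ b p :=
      exists_between (max_lt ha h1)
    have hab : b < a' := (le_max_right _ _).trans_lt ha1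
    have c1 : ∀ᶠ q : ℝ × ℝ in 𝓝 (b, p), q.2 < cosAt γ q.1 (γ a') :=
      continuousAt_snd.eventually_lt (hcos a' hab (by linarith)) (by
        have := hanti b ⟨hab, by linarith⟩ ⟨h1, h2⟩ ha2
        simp only at this ⊢
        linarith)
    have c2 : ∀ᶠ q : ℝ × ℝ in 𝓝 (b, p), q.1 < a' ∧ a' < q.1 + ℓ :=
      (continuousAt_fst.eventually_lt continuousAt_const hab).and
        (continuousAt_const.eventually_lt (continuousAt_fst.add continuousAt_const)
          (by simp only; linarith))
    filter_upwards [hstrip, c1, c2] with q q1 q2 q3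
    obtain ⟨n1, n2, n3⟩ := h.nextImpact_spec hΩ q.1 q1.1 q1.2
    refine lt_of_le_of_lt (le_max_left a b) (ha1.trans ?_)
    by_contra hle
    have := (hanti q.1).antitoneOn ⟨n1, n2⟩ ⟨q3.1, q3.2⟩ (not_lt.1 hle)
    linarith
  · obtain ⟨a', ha1, ha2⟩ : ∃ a', nextImpact ℓ γ b p < a' ∧ a' < min a (b + ℓ) :=
      exists_between (lt_min ha h2)
    have hab : a' < b + ℓ := ha2.trans_le (min_le_right _ _)
    have c1 : ∀ᶠ q : ℝ × ℝ in 𝓝 (b, p), cosAt γ q.1 (γ a') < q.2 :=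
      (hcos a' (by linarith) hab).eventually_lt continuousAt_snd (by
        have := hanti b ⟨h1, h2⟩ ⟨by linarith, hab⟩ ha1
        simp only at this ⊢
        linarith)
    have c2 : ∀ᶠ q : ℝ × ℝ in 𝓝 (b, p), q.1 < a' ∧ a' < q.1 + ℓ :=
      (continuousAt_fst.eventually_lt continuousAt_const (by simp only; linarith)).and
        (continuousAt_const.eventually_lt (continuousAt_fst.add continuousAt_const) hab)
    filter_upwards [hstrip, c1, c2] with q q1 q2 q3
    obtain ⟨n1, n2, n3⟩ := h.nextImpact_spec hΩ q.1 q1.1 q1.2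
    refine lt_of_lt_of_le (lt_of_not_ge fun hle => ?_) (ha2.le.trans (min_le_left _ _))
    have := (hanti q.1).antitoneOn ⟨q3.1, q3.2⟩ ⟨n1, n2⟩ hle
    linarith

theorem impact_zero (x : Plane) (b : ℝ) : impact ℓ γ x 0 b = b := rfl

theorem billiard_iterate_mem (h : IsBoundaryParametrization Ω ℓ γ)
    (hΩ : IsSmoothStrictlyConvexDomain Ω) {x : Plane} (hx : x ∈ Ω) (k : ℕ) (b : ℝ) :
    -1 < ((billiardMap ℓ γ)^[k] (b, -cosAt γ b x)).2 ∧
      ((billiardMap ℓ γ)^[k] (b, -cosAt γ b x)).2 < 1 := by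
  induction k with
  | zero =>
    obtain ⟨h1, h2⟩ := h.abs_cosAt_lt_one (h.mem_ne hΩ hx) (h.sinAt_pos_of_mem hΩ (s := b) hx)
    constructor <;> simp only [Function.iterate_zero, id] <;> linarith
  | succ k ih =>
    rw [Function.iterate_succ_apply']
    obtain ⟨n1, n2, -⟩ := h.nextImpact_spec hΩ ((billiardMap ℓ γ)^[k] (b, -cosAt γ b x)).1 ih.1 ih.2
    have hne := (h.chord_ne n1 n2).symm
    obtain ⟨h1, h2⟩ := h.abs_cosAt_lt_one hne (h.sinAt_pos hΩ hne)
    constructor <;> simp only [billiardMap] <;> linarith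

theorem continuous_billiard_iterate (h : IsBoundaryParametrization Ω ℓ γ)
    (hΩ : IsSmoothStrictlyConvexDomain Ω) {x : Plane} (hx : x ∈ Ω) (k : ℕ) :
    Continuous fun b => (billiardMap ℓ γ)^[k] (b, -cosAt γ b x) := by
  induction k with
  | zero =>
    refine continuous_id.prodMk (continuous_iff_continuousAt.2 fun b => ?_).neg
    exact (h.hasDerivAt_cosAt (h.mem_ne hΩ hx)).continuousAt
  | succ k ih =>
    simp only [Function.iterate_succ_apply']
    refine continuous_iff_continuousAt.2 fun b => ?_
    obtain ⟨h1, h2⟩ := h.billiard_iterate_mem hΩ hx k b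
    refine ContinuousAt.comp (g := billiardMap ℓ γ) ?_ ih.continuousAt
    obtain ⟨q, hq⟩ : ∃ q, q = (billiardMap ℓ γ)^[k] (b, -cosAt γ b x) := ⟨_, rfl⟩
    rw [← hq] at h1 h2 ⊢
    have c1 := h.continuousAt_nextImpact hΩ q.1 h1 h2
    obtain ⟨n1, n2, -⟩ := h.nextImpact_spec hΩ q.1 h1 h2
    refine c1.prodMk (ContinuousAt.neg ?_)
    exact ContinuousAt.comp (x := q) (f := fun q : ℝ × ℝ => (nextImpact ℓ γ q.1 q.2, q.1))
      (h.continuousAt_cosAt_chord (h.chord_ne n1 n2).symm) (c1.prodMk continuousAt_fst)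

theorem continuous_impact (h : IsBoundaryParametrization Ω ℓ γ)
    (hΩ : IsSmoothStrictlyConvexDomain Ω) {x : Plane} (hx : x ∈ Ω) (k : ℕ) :
    Continuous (impact ℓ γ x k) := continuous_fst.comp (h.continuous_billiard_iterate hΩ hx k)

theorem cosAt_impact (h : IsBoundaryParametrization Ω ℓ γ)
    (hΩ : IsSmoothStrictlyConvexDomain Ω) {x : Plane} (hx : x ∈ Ω) (b : ℝ) :
    cosAt γ b (γ (impact ℓ γ x 1 b)) = -cosAt γ b x :=
  let h0 := h.billiard_iterate_mem hΩ hx 0 b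
  (h.nextImpact_spec hΩ b h0.1 h0.2).2.2

theorem isBilliardSeq_impact (h : IsBoundaryParametrization Ω ℓ γ)
    (hΩ : IsSmoothStrictlyConvexDomain Ω) {x : Plane} (hx : x ∈ Ω) (b : ℝ) (n : ℕ) :
    IsBilliardSeq ℓ γ (fun k => impact ℓ γ x k b) n := by
  have key : ∀ k, _ := fun k =>
    let hk := h.billiard_iterate_mem hΩ hx k b
    h.nextImpact_spec hΩ ((billiardMap ℓ γ)^[k] (b, -cosAt γ b x)).1 hk.1 hk.2
  have e : ∀ k, impact ℓ γ x (k + 1) b = nextImpact ℓ γ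
      ((billiardMap ℓ γ)^[k] (b, -cosAt γ b x)).1 ((billiardMap ℓ γ)^[k] (b, -cosAt γ b x)).2 :=
    fun k => by rw [impact, Function.iterate_succ_apply']; rfl
  refine ⟨fun k _ => ?_, fun k _ => ?_, fun k _ => ?_⟩
  · rw [e]; exact (key k).1
  · rw [e]; exact (key k).2.1
  · have h1 := (key (k + 1)).2.2
    rw [← e] at h1
    refine h1.trans ?_
    simp only [Function.iterate_succ_apply', billiardMap, e]
    rfl

end IsBoundaryParametrization

/-! ### Existence of four orbits -/

/-- Let `f < g` pass from below the level `R` to above it. If `H` is positive whenever `f = R + e`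
or `g = R - e`, but negative when `R` is the midpoint of `f` and `g`, then `H` vanishes twice.
Monotonicity of `f` and `g` is not needed. -/
theorem exists_two_zeros {f g H : ℝ → ℝ} (hf : Continuous f) (hg : Continuous g)
    (hH : Continuous H) (hfg : ∀ c, f c < g c) {R e : ℝ} (he : 0 < e) (h0 : g 0 ≤ R - e)
    (h1 : R + e ≤ f 1)
    (hmid : ∀ c ∈ Icc (0 : ℝ) 1, f c ≤ R + e → R - e ≤ g c → f c + g c = 2 * R → H c < 0)
    (hl : ∀ c ∈ Icc (0 : ℝ) 1, f c = R + e → 0 < H c)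
    (hr : ∀ c ∈ Icc (0 : ℝ) 1, g c = R - e → 0 < H c) :
    ∃ c₁ c₂, 0 < c₁ ∧ c₁ < c₂ ∧ c₂ < 1 ∧ (H c₁ = 0 ∧ f c₁ ≤ R + e ∧ R - e ≤ g c₁) ∧
      (H c₂ = 0 ∧ f c₂ ≤ R + e ∧ R - e ≤ g c₂) := by
  have hf0 := hfg 0
  -- the first parameter at which `f` reaches `R + e`
  have hS : IsCompact (Icc (0 : ℝ) 1 ∩ f ⁻¹' {R + e}) :=
    isCompact_Icc.inter_right (isClosed_singleton.preimage hf)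
  obtain ⟨c₃, ⟨h3, h3f⟩, h3min⟩ := hS.exists_isLeast (by
    obtain ⟨c, hc, hce⟩ := intermediate_value_Icc zero_le_one hf.continuousOn
      (show R + e ∈ Icc (f 0) (f 1) from ⟨by linarith, h1⟩)
    exact ⟨c, hc, hce⟩)
  have h3f : f c₃ = R + e := h3f
  have hf3 : ∀ c ∈ Icc 0 c₃, f c ≤ R + e := by
    intro c hc
    by_contra! hlt
    obtain ⟨d, hd, hde⟩ := intermediate_value_Ioo hc.1 hf.continuousOn
      (show R + e ∈ Ioo (f 0) (f c) from ⟨by linarith, hlt⟩)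
    have := h3min ⟨⟨hd.1.le, by linarith [hd.2, hc.2, h3.2]⟩, hde⟩
    linarith [hd.2, hc.2]
  have hg3 := hfg c₃
  -- the last parameter before it at which `g` equals `R - e`
  have hS' : IsCompact (Icc (0 : ℝ) c₃ ∩ g ⁻¹' {R - e}) :=
    isCompact_Icc.inter_right (isClosed_singleton.preimage hg)
  obtain ⟨c₁, ⟨m1, m1g⟩, m1max⟩ := hS'.exists_isGreatest (by
    obtain ⟨c, hc, hce⟩ := intermediate_value_Icc h3.1 hg.continuousOn
      (show R - e ∈ Icc (g 0) (g c₃) from ⟨h0, by linarith⟩)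
    exact ⟨c, hc, hce⟩)
  have m1g : g c₁ = R - e := m1g
  have hg1 : ∀ c ∈ Icc c₁ c₃, R - e ≤ g c := by
    intro c hc
    by_contra! hlt
    obtain ⟨d, hd, hde⟩ := intermediate_value_Ioo hc.2 hg.continuousOn
      (show R - e ∈ Ioo (g c) (g c₃) from ⟨hlt, by linarith⟩)
    have := m1max ⟨⟨by linarith [hd.1, hc.1, m1.1], hd.2.le⟩, hde⟩
    linarith [hd.1, hc.1]
  have hf1 := hfg c₁
  obtain ⟨c₂, m2, m2e⟩ := intermediate_value_Ioo m1.2 (hf.add hg).continuousOn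
    (show 2 * R ∈ Ioo (f c₁ + g c₁) (f c₃ + g c₃) from ⟨by linarith, by linarith⟩)
  have H1 := hr c₁ ⟨m1.1, m1.2.trans h3.2⟩ m1g
  have H3 := hl c₃ h3 h3f
  have H2 := hmid c₂ ⟨by linarith [m1.1, m2.1], by linarith [m2.2, h3.2]⟩
    (hf3 c₂ ⟨by linarith [m1.1, m2.1], m2.2.le⟩) (hg1 c₂ ⟨m2.1.le, m2.2.le⟩) m2e
  obtain ⟨d₁, p1, p1e⟩ := intermediate_value_Ioo' m2.1.le hH.continuousOn
    (show (0 : ℝ) ∈ Ioo (H c₂) (H c₁) from ⟨H2, H1⟩)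
  obtain ⟨d₂, p2, p2e⟩ := intermediate_value_Ioo m2.2.le hH.continuousOn
    (show (0 : ℝ) ∈ Ioo (H c₂) (H c₃) from ⟨H2, H3⟩)
  refine ⟨d₁, d₂, by linarith [m1.1, p1.1], by linarith [p1.2, p2.1], by linarith [p2.2, h3.2],
    ⟨p1e, hf3 _ ⟨by linarith [m1.1, p1.1], by linarith [p1.2, m2.2]⟩,
      hg1 _ ⟨p1.1.le, by linarith [p1.2, m2.2]⟩⟩,
    ⟨p2e, hf3 _ ⟨by linarith [m1.1, p2.1, m2.1], p2.2.le⟩,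
      hg1 _ ⟨by linarith [p2.1, m2.1], p2.2.le⟩⟩⟩

namespace IsBoundaryParametrization

variable {Ω : Set Plane} {ℓ : ℝ} {γ : ℝ → Plane} {κ₀ K δ : ℝ} {s : ℝ → ℝ}

/-- A triangle inscribed in a short arc has area of the order of the product of the arcs cut off by
its sides. -/
theorem exists_area_ge (h : IsBoundaryParametrization Ω ℓ γ) (B : CurveBounds γ κ₀ K δ) :
    ∃ η > 0, ∀ a b c, a < b → b < c → c - a ≤ η →
      κ₀ / 4 * ((b - a) * (c - b) * (c - a)) ≤ cross (γ b - γ a) (γ c - γ b) := by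
  have hκ := B.pos
  have hK := B.K_pos
  have hδ := B.delta_pos
  refine ⟨min (min δ (1 / 2)) (min (κ₀ / (4 * K ^ 2)) (κ₀ / (8 * K))), by positivity, ?_⟩
  intro a b c hab hbc hη
  obtain ⟨p, hp⟩ : ∃ p, p = b - a := ⟨_, rfl⟩
  obtain ⟨q, hq⟩ : ∃ q, q = c - b := ⟨_, rfl⟩
  have hp0 : 0 < p := by linarith
  have hq0 : 0 < q := by linarith
  have e1 : p + q ≤ min (min δ (1 / 2)) (min (κ₀ / (4 * K ^ 2)) (κ₀ / (8 * K))) := by linarith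
  rw [le_min_iff, le_min_iff, le_min_iff] at e1
  obtain ⟨⟨e1, e2⟩, e3, e4⟩ := e1
  rw [le_div_iff₀ (by positivity)] at e3 e4
  obtain ⟨E, hE⟩ : ∃ E, E = γ a - γ b - (a - b) • deriv γ b -
    ((a - b) ^ 2 / 2) • deriv (deriv γ) b := ⟨_, rfl⟩
  obtain ⟨F, hF⟩ : ∃ F, F = γ c - γ b - (c - b) • deriv γ b := ⟨_, rfl⟩
  have hEn : ‖E‖ ≤ K * p ^ 3 := by
    have := h.norm_taylor_le B b a
    rwa [← hE, abs_sub_comm, abs_of_pos (by linarith), ← hp] at this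
  have hFn : ‖F‖ ≤ K * q ^ 2 := by
    have h1 := h.norm_taylor_le B b c
    rw [← hF, abs_of_pos (by linarith), ← hq] at h1
    have h2 : ‖(q ^ 2 / 2) • deriv (deriv γ) b‖ ≤ q ^ 2 / 2 * K := by
      rw [norm_smul, Real.norm_eq_abs, abs_of_pos (by positivity)]
      exact mul_le_mul_of_nonneg_left (B.norm_two b) (by positivity)
    have h3 := norm_le_norm_sub_add F ((q ^ 2 / 2) • deriv (deriv γ) b)
    have h4 : K * q ^ 3 ≤ K * q ^ 2 * (1 / 2) := by
      have := mul_le_mul_of_nonneg_left (show q ≤ 1 / 2 by linarith) (by positivity : 0 ≤ K * q ^ 2)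
      linarith
    linarith
  have hV : ‖γ c - γ b‖ ≤ q := by
    have := h.norm_sub_le b c
    rwa [abs_of_pos (by linarith), ← hq] at this
  have c1 : κ₀ / 4 * q ^ 2 ≤ cross (deriv γ b) (γ c - γ b) := by
    have := h.cross_tangent_chord_ge B (s := b) (t := c) (by
      rw [abs_of_pos (by linarith)]; linarith)
    rwa [← hq] at this
  have c2 : cross (deriv (deriv γ) b) (γ c - γ b) ≤ -(κ₀ * q) + K * (K * q ^ 2) := by
    have h1 : γ c - γ b = q • deriv γ b + F := by rw [hF, hq]; abel
    have h2 : cross (deriv (deriv γ) b) (deriv γ b) = -curvature γ b := by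
      rw [cross_swap]; rfl
    rw [h1, cross_add_right, cross_smul_right, h2]
    have h3 := (le_abs_self _).trans (abs_cross_le (deriv (deriv γ) b) F)
    have h4 : ‖deriv (deriv γ) b‖ * ‖F‖ ≤ K * (K * q ^ 2) :=
      mul_le_mul (B.norm_two b) hFn (norm_nonneg _) hK.le
    have h5 := mul_le_mul_of_nonneg_left (B.curv_ge b) hq0.le
    linarith
  have c3 : |cross E (γ c - γ b)| ≤ K * p ^ 3 * q :=
    (abs_cross_le _ _).trans (mul_le_mul hEn hV (norm_nonneg _) (by positivity))
  have h1 : γ b - γ a = p • deriv γ b - (p ^ 2 / 2) • deriv (deriv γ) b - E := by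
    rw [hE, hp, show (a - b) ^ 2 = (b - a) ^ 2 by ring, show a - b = -(b - a) by ring, neg_smul]
    abel
  rw [h1, cross_sub_left, cross_sub_left, cross_smul_left, cross_smul_left]
  have c4 := (abs_le.1 c3).2
  have t1 := mul_le_mul_of_nonneg_left c1 hp0.le
  have t2 := mul_le_mul_of_nonneg_left c2 (by positivity : 0 ≤ p ^ 2 / 2)
  have t3 : (p ^ 2 * q) * (q * (4 * K ^ 2)) ≤ (p ^ 2 * q) * κ₀ :=
    mul_le_mul_of_nonneg_left (le_trans (by gcongr; linarith) e3) (by positivity)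
  have t4 : (p ^ 2 * q) * (p * (8 * K)) ≤ (p ^ 2 * q) * κ₀ :=
    mul_le_mul_of_nonneg_left (le_trans (by gcongr; linarith) e4) (by positivity)
  rw [← hp, ← hq, show c - a = p + q by linarith]
  linarith

/-- On which side of a chord of length of order `e` a point within `e ^ 4` of `γ σ` lies: the height
of the chord over the boundary is of order `e ^ 2`, and prevails. -/
theorem exists_side (h : IsBoundaryParametrization Ω ℓ γ) {m M : ℝ} (hm : 0 < m) (hM : 0 < M) :
    ∀ᶠ e in 𝓝[>] (0 : ℝ), ∀ (y : Plane) (σ a c : ℝ), ‖y - γ σ‖ ≤ e ^ 4 → c - a ≤ M * e →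
      a + m * e ≤ c →
      (a + m * e ≤ σ → σ + m * e ≤ c → cross (γ c - γ a) (y - γ a) < 0) ∧
      (σ + m * e ≤ a → a ≤ σ + M * e → 0 < cross (γ c - γ a) (y - γ a)) ∧
      (c + m * e ≤ σ → σ ≤ c + M * e → 0 < cross (γ c - γ a) (y - γ a)) := by
  obtain ⟨κ₀, K, δ, B⟩ := h.exists_bounds
  obtain ⟨η, hη, harea⟩ := h.exists_area_ge B
  have hκ := B.pos
  filter_upwards [eventually_pos_le one_pos, eventually_mul_le (2 * M) hη,
    eventually_mul_le M (by positivity : 0 < κ₀ / 8 * m ^ 3)] with e ⟨he0, he1⟩ s1 s2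
  intro y σ a c hy hca hac
  have hme : 0 < m * e := by positivity
  have hMe : 0 < M * e := by positivity
  have herr : |cross (γ c - γ a) (y - γ σ)| ≤ κ₀ / 8 * (m * e) ^ 3 := by
    refine (abs_cross_le _ _).trans ?_
    have h1 := h.norm_sub_le a c
    rw [abs_of_pos (by linarith)] at h1
    have h2 : ‖γ c - γ a‖ * ‖y - γ σ‖ ≤ M * e * e ^ 4 :=
      mul_le_mul (h1.trans hca) hy (norm_nonneg _) hMe.le
    have h3 : M * e * e ^ 4 ≤ κ₀ / 8 * m ^ 3 * e ^ 3 := by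
      have h4 : e ^ 4 ≤ e ^ 3 := pow_le_pow_of_le_one he0.le he1 (by norm_num)
      exact mul_le_mul s2 h4 (by positivity) (by positivity)
    linarith
  have hsplit : cross (γ c - γ a) (y - γ a) =
      cross (γ c - γ a) (y - γ σ) + cross (γ c - γ a) (γ σ - γ a) := by
    rw [← cross_add_right]; congr 1; abel
  have hbig : ∀ a b c, a + m * e ≤ b → b + m * e ≤ c → c - a ≤ 2 * M * e →
      κ₀ / 4 * (m * e) ^ 3 ≤ cross (γ b - γ a) (γ c - γ b) := by
    intro a b c hab hbc hca
    refine le_trans ?_ (harea a b c (by linarith) (by linarith) (by linarith))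
    have h1 : m * e * (m * e) * (m * e) ≤ (b - a) * (c - b) * (c - a) := by
      refine mul_le_mul (mul_le_mul ?_ ?_ hme.le ?_) ?_ hme.le ?_
      · linarith
      · linarith
      · linarith
      · linarith
      · exact mul_nonneg (by linarith) (by linarith)
    have := mul_le_mul_of_nonneg_left h1 (by positivity : 0 ≤ κ₀ / 4)
    linarith
  have hpos : 0 < κ₀ / 8 * (m * e) ^ 3 := by positivity
  obtain ⟨er1, er2⟩ := abs_le.1 herr
  rw [hsplit]
  refine ⟨fun h1 h2 => ?_, fun h1 h2 => ?_, fun h1 h2 => ?_⟩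
  · have h3 := hbig a σ c h1 h2 (by linarith)
    have h4 : cross (γ c - γ a) (γ σ - γ a) = -cross (γ σ - γ a) (γ c - γ σ) := by
      simp [cross]; ring
    linarith
  · have h3 := hbig σ a c h1 hac (by linarith)
    have h4 : cross (γ c - γ a) (γ σ - γ a) = cross (γ a - γ σ) (γ c - γ a) := by
      simp [cross]; ring
    linarith
  · have h3 := hbig a c σ hac h1 (by linarith)
    have h4 : cross (γ c - γ a) (γ σ - γ a) = cross (γ c - γ a) (γ σ - γ c) := by
      simp [cross]; ring
    linarith

/-- A point of the domain on the line through two boundary points lies between them. -/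
theorem mem_openSegment_of_cross_eq_zero (h : IsBoundaryParametrization Ω ℓ γ)
    (hΩ : IsSmoothStrictlyConvexDomain Ω) {a c : ℝ} {y : Plane} (hy : y ∈ Ω) (hne : γ c ≠ γ a)
    (h0 : cross (γ c - γ a) (y - γ a) = 0) : y ∈ openSegment ℝ (γ a) (γ c) := by
  obtain ⟨v, hv⟩ : ∃ v, v = γ c - γ a := ⟨_, rfl⟩
  have hv0 : 0 < ‖v‖ ^ 2 := by
    have := norm_pos_iff.2 (sub_ne_zero.2 hne); rw [hv]; positivity
  obtain ⟨r, hr⟩ : ∃ r, r = inner ℝ v (y - γ a) / ‖v‖ ^ 2 := ⟨_, rfl⟩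
  have hyr : y - γ a = r • v := by
    rw [← hv] at h0
    have h1 : ‖v‖ ^ 2 • (y - γ a) = (inner ℝ v (y - γ a)) • v := by
      rw [plane_norm_sq, plane_inner_eq]
      rw [cross] at h0
      ext i
      fin_cases i
      · simp only [PiLp.smul_apply, smul_eq_mul, Fin.zero_eta]; linear_combination -v 1 * h0
      · simp only [PiLp.smul_apply, smul_eq_mul, Fin.mk_one]; linear_combination v 0 * h0
    rw [hr, div_eq_inv_mul, mul_smul, ← h1, inv_smul_smul₀ hv0.ne']
  have h1 := h.cross_pos_of_mem hΩ a hy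
  have h2 := h.cross_pos_of_mem hΩ c hy
  have h3 := h.cross_pos hΩ hne
  have h4 := h.cross_pos hΩ hne.symm
  rw [hyr, hv, cross_smul_right] at h1
  have h5 : y - γ c = (1 - r) • (γ a - γ c) := by
    rw [← sub_sub_sub_cancel_right y (γ c) (γ a), hyr, hv, sub_smul, one_smul, smul_sub, smul_sub]
    abel
  rw [h5, cross_smul_right] at h2
  have r0 : 0 < r := pos_of_mul_pos_left h1 h3.le
  have r1 : 0 < 1 - r := pos_of_mul_pos_left h2 h4.le
  rw [openSegment_eq_image']
  exact ⟨r, ⟨r0, by linarith⟩, by simp only; rw [← hv, ← hyr]; abel⟩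

/-- If the first bounce is at distance of order `e ^ 2` from the foot `γ σ` of the source, the path
hardly turns; if it is much closer, or at distance of order `e`, it makes more than a turn. -/
theorem exists_shooting_range (h : IsBoundaryParametrization Ω ℓ γ)
    (hΩ : IsSmoothStrictlyConvexDomain Ω) :
    ∃ A > 0, ∀ᶠ n : ℕ in atTop, ∀ e, e = 1 / ((n : ℝ) + 1) → ∀ (x : Plane) (σ : ℝ), x ∈ Ω →
      ‖x - γ σ‖ ≤ e ^ 4 → ∃ b₀ b₁ b₂, b₁ < b₀ ∧ b₀ < b₂ ∧ σ - A * e ≤ b₁ ∧ b₂ ≤ σ + A * e ∧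
        impact ℓ γ x (n + 1) b₀ ≤ σ + ℓ - e ∧ σ + ℓ + e ≤ impact ℓ γ x n b₁ ∧
        σ + ℓ + e ≤ impact ℓ γ x n b₂ := by
  obtain ⟨κ₀, K, δ, B⟩ := h.exists_bounds
  have hκ := B.pos
  have hK := B.K_pos
  have hℓ := h.length_pos
  obtain ⟨θ, hθ0, hθ, hθ', hθκ⟩ : ∃ θ > 0, K * θ ≤ κ₀ / 32 ∧ K * θ ≤ 1 / 32 ∧ θ ≤ κ₀ / 32 := by
    refine ⟨min (κ₀ / 32) (1 / 32) / K, by positivity, ?_, ?_, ?_⟩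
    · rw [mul_div_cancel₀ _ hK.ne']; exact min_le_left _ _
    · rw [mul_div_cancel₀ _ hK.ne']; exact min_le_right _ _
    · exact (div_le_self (by positivity) B.one_le).trans (min_le_left _ _)
  obtain ⟨m, hm, M, hM, n₀, hgap⟩ := h.exists_gap_bounds hΩ B
  obtain ⟨δ₁, hδ₁, L, hL, -, hcomp⟩ := h.exists_gap_comparable hΩ B
  obtain ⟨μ, hμ, hnear⟩ := h.exists_near_of_sinAt hΩ B (lt_min hδ₁ B.delta_pos)
  -- a first angle above `A e` gives a first gap above `M e`, too long for a single turn; at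
  -- distance `A' e` from `σ` the angle exceeds `A e`, and `N e ^ 2` is the closest distance from
  -- `σ` at which `x` still looks like `γ σ`
  obtain ⟨A, hA⟩ : ∃ A, A = 2 * K * M + 1 := ⟨_, rfl⟩
  have hA0 : 0 < A := by rw [hA]; positivity
  obtain ⟨A', hA'⟩ : ∃ A', A' = 4 * A / κ₀ := ⟨_, rfl⟩
  have hA'0 : 0 < A' := by rw [hA']; positivity
  obtain ⟨N, hN⟩ : ∃ N, N = 1 / θ + 1 := ⟨_, rfl⟩
  have hN1 : 1 ≤ N := by rw [hN]; linarith [(by positivity : 0 < 1 / θ)]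
  have hNθ : 1 ≤ θ * N ^ 2 := by
    have h1 : θ * N = 1 + θ := by rw [hN]; field_simp
    nlinarith
  obtain ⟨G, hG⟩ : ∃ G, G = L * (4 * K * N / κ₀) := ⟨_, rfl⟩
  have hG0 : 0 < G := by rw [hG]; positivity
  refine ⟨A', hA'0, ?_⟩
  filter_upwards [eventually_ge_atTop n₀, tendsto_one_div_nat_succ.eventually
    (((eventually_mul_le N (lt_min hθ0 (lt_min hA'0 one_pos) : 0 < min θ (min A' 1))).and
    (eventually_mul_le (2 * N) hA'0)).and (((eventually_mul_le (K * N) hμ).and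
    (eventually_mul_le (N + G + 3) hℓ)).and (((eventually_mul_le A' hθ0).and
    (eventually_mul_le 1 (by positivity : 0 < θ * A' ^ 2))).and
    (((eventually_mul_le M B.delta_pos).and (eventually_mul_le A one_pos)).and
      (eventually_pos_le one_pos)))))] with n hn hev
  intro e he x σ hx hxσ
  rw [← he] at hev
  obtain ⟨⟨s1, s2⟩, ⟨s3, s4⟩, ⟨s5, s6⟩, ⟨s7, s8⟩, he0, he1⟩ := hev
  rw [le_min_iff, le_min_iff] at s1
  obtain ⟨s1, s1', s1''⟩ := s1
  have hne : ((n : ℝ) + 1) * e = 1 := by rw [he]; field_simp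
  have hee : e ^ 2 ≤ e := by nlinarith
  have he2 : 0 < e ^ 2 := by positivity
  have hNe : N * e ^ 2 ≤ N * e := mul_le_mul_of_nonneg_left hee (by linarith)
  have hNe0 : 0 < N * e ^ 2 := by positivity
  have hNe' : N * e ^ 2 ≤ e := by
    have := mul_le_mul_of_nonneg_right s1'' he0.le; linarith
  have hbs : ∀ b, IsBilliardSeq ℓ γ (fun k => impact ℓ γ x k b) (n + 1) := fun b =>
    h.isBilliardSeq_impact hΩ hx b (n + 1)
  -- the outgoing angle at the first bounce is the incoming one
  have hout : ∀ b, γ (impact ℓ γ x 1 b) ≠ γ b ∧ b < impact ℓ γ x 1 b ∧ impact ℓ γ x 1 b < b + ℓ ∧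
      sinAt γ b (γ (impact ℓ γ x 1 b)) = sinAt γ b x := fun b => by
    have h1 := (hbs b).lt_succ 0 (by lia)
    have h2 := (hbs b).succ_lt 0 (by lia)
    simp only [impact_zero, zero_add] at h1 h2
    have hne := h.chord_ne h1 h2
    exact ⟨hne, h1, h2, sin_eq_of_cos_eq_neg (h.cosAt_sq_add_sinAt_sq hne)
      (h.cosAt_sq_add_sinAt_sq (h.mem_ne hΩ hx)) (h.sinAt_pos hΩ hne) (h.sinAt_pos_of_mem hΩ hx)
      (h.cosAt_impact hΩ hx b)⟩
  -- a large angle makes the path turn too much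
  have hlarge : ∀ b, σ - e ≤ b → A * e ≤ sinAt γ b x → σ + ℓ + e ≤ impact ℓ γ x n b := by
    intro b hb hs
    by_contra! hlt
    have hl3 : 3 * e ≤ ℓ := by
      have : 0 < (N + G) * e := by positivity
      linarith
    have h1 := (hgap _ n hn (hbs b) (by simp only [impact_zero]; linarith) 0 (Nat.zero_le _)).1
    simp only [impact_zero, zero_add] at h1
    rw [div_eq_mul_one_div, ← he] at h1
    obtain ⟨p1, p2, p3, p4⟩ := hout b
    have h2 := h.sinAt_le B p2.ne' (by rw [abs_of_pos (by linarith)]; linarith)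
    rw [p4, abs_of_pos (by linarith)] at h2
    have h3 := mul_le_mul_of_nonneg_left h1 (by positivity : 0 ≤ 2 * K)
    have : A * e = 2 * K * (M * e) + e := by rw [hA]; ring
    linarith
  have hsmallz : ∀ b, |b - σ| = N * e ^ 2 → ‖x - γ σ‖ ≤ θ * |b - σ| ^ 2 := fun b hb => by
    rw [hb]
    refine hxσ.trans ?_
    have := mul_le_mul_of_nonneg_right hNθ (by positivity : 0 ≤ e ^ 4)
    linarith
  have a1 : |σ + N * e ^ 2 - σ| = N * e ^ 2 := by rw [add_sub_cancel_left, abs_of_pos hNe0]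
  have a2 : |σ - N * e ^ 2 - σ| = N * e ^ 2 := by
    rw [show σ - N * e ^ 2 - σ = -(N * e ^ 2) by ring, abs_neg, abs_of_pos hNe0]
  obtain ⟨-, u2, u3, -, -⟩ := h.sinAt_near B hθ hθ' hθκ (t := σ + N * e ^ 2) (by linarith)
    (by rw [a1]; linarith) (hsmallz _ a1)
  obtain ⟨-, -, v3, -, -⟩ := h.sinAt_near B hθ hθ' hθκ (t := σ - N * e ^ 2) (by linarith)
    (by rw [a2]; linarith) (hsmallz _ a2)
  rw [a1] at u2
  have u4 : cosAt γ (σ + N * e ^ 2) x < 0 := by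
    have u5 : 0 < N * e ^ 2 * -cosAt γ (σ + N * e ^ 2) x := by linarith
    linarith [pos_of_mul_pos_right u5 hNe0.le]
  have v4 : 0 < cosAt γ (σ - N * e ^ 2) x := by
    rw [show σ - (σ - N * e ^ 2) = N * e ^ 2 by ring] at v3
    exact pos_of_mul_pos_right v3 hNe0.le
  have hcont : Continuous fun b => cosAt γ b x := continuous_iff_continuousAt.2 fun b =>
    (h.hasDerivAt_cosAt (h.mem_ne hΩ hx)).continuousAt
  -- between the two sides of `σ` there is a point from which `x` is seen along the normal
  obtain ⟨b₁, hb₁, hb₁c⟩ := intermediate_value_Ioo' (a := σ - N * e ^ 2) (b := σ + N * e ^ 2)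
    (by linarith) hcont.continuousOn ⟨u4, v4⟩
  have a3 : |σ + A' * e - σ| = A' * e := by rw [add_sub_cancel_left, abs_of_pos (by positivity)]
  have hA'e : 0 < A' * e := by positivity
  obtain ⟨w1, -⟩ := h.sinAt_near B hθ hθ' hθκ (t := σ + A' * e) (z := x) (σ := σ) (by linarith)
    (by rw [a3]; linarith) (by
      rw [a3]
      refine hxσ.trans ?_
      have h1 : e ^ 2 ≤ θ * A' ^ 2 := by linarith
      have := mul_le_mul_of_nonneg_right h1 he2.le
      linarith)
  rw [a3] at w1
  refine ⟨σ + N * e ^ 2, b₁, σ + A' * e, hb₁.2, ?_, ?_, le_rfl, ?_, ?_, ?_⟩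
  · have := mul_le_mul_of_nonneg_right s2 he0.le
    linarith
  · have := mul_le_mul_of_nonneg_right s1' he0.le
    linarith [hb₁.1]
  · obtain ⟨p1, p2, p3, p4⟩ := hout (σ + N * e ^ 2)
    have hb := hbs (σ + N * e ^ 2)
    obtain ⟨T, hT⟩ : ∃ T : ℕ → ℝ, T = fun k => impact ℓ γ x k (σ + N * e ^ 2) := ⟨_, rfl⟩
    rw [← hT] at hb
    have hT0 : T 0 = σ + N * e ^ 2 := by rw [hT]; rfl
    have hT1 : impact ℓ γ x 1 (σ + N * e ^ 2) = T 1 := by rw [hT]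
    rw [hT1] at p1 p2 p3 p4
    have hc := h.cosAt_impact hΩ hx (σ + N * e ^ 2)
    rw [hT1] at hc
    have g1 := (hnear _ _ p2 p3).1 (by
      rw [p4]
      have := mul_le_mul_of_nonneg_left hee (by positivity : 0 ≤ K * N)
      linarith) (by rw [hc]; linarith)
    rw [lt_min_iff] at g1
    have g2 := h.le_sinAt B p2.ne' (by rw [abs_of_pos (by linarith)]; linarith)
    rw [p4, abs_of_pos (by linarith), ← hT0] at g2
    rw [← hT0] at g1
    have g3 : L * (T 1 - T 0) ≤ G * e ^ 2 := by
      have : T 1 - T 0 ≤ 4 * K * N / κ₀ * e ^ 2 := by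
        rw [div_mul_eq_mul_div, le_div_iff₀ hκ]
        rw [← hT0] at u2
        linarith
      have := mul_le_mul_of_nonneg_left this (by linarith : 0 ≤ L)
      rw [hG]; linarith
    -- all gaps are comparable to the first one, hence of order `e ^ 2`
    have key : ∀ r ≤ n + 1, T r - T 0 ≤ r * (G * e ^ 2) := by
      intro r
      induction r with
      | zero => intro; simp
      | succ r ih =>
        intro hr
        have i1 := ih (by lia)
        have i2 : (r : ℝ) * (G * e ^ 2) ≤ G * e := by
          have q1 : (r : ℝ) ≤ n + 1 := by exact_mod_cast (by lia : r ≤ n + 1)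
          have q2 := mul_le_mul_of_nonneg_right q1 (by positivity : 0 ≤ G * e ^ 2)
          have q3 : ((n : ℝ) + 1) * (G * e ^ 2) = ((n : ℝ) + 1) * e * (G * e) := by ring
          rw [q3, hne, one_mul] at q2
          exact q2
        have i3 : G * e ≤ 2 * ℓ := by
          have : 0 < (N + 3) * e := by positivity
          linarith
        have i4 := (hcomp T r (hb.mono hr) (by linarith) 0 (Nat.zero_le _)
          (by rw [zero_add]; exact g1.1.le) r le_rfl).1
        rw [zero_add] at i4
        push_cast
        linarith
    have k1 := key (n + 1) le_rfl
    push_cast at k1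
    rw [show ((n : ℝ) + 1) * (G * e ^ 2) = ((n : ℝ) + 1) * e * (G * e) by ring, hne, one_mul,
      hT0] at k1
    have hTn : impact ℓ γ x (n + 1) (σ + N * e ^ 2) = T (n + 1) := by rw [hT]
    rw [hTn]
    linarith
  · refine hlarge b₁ (by linarith [hb₁.1]) ?_
    have h1 := h.cosAt_sq_add_sinAt_sq (h.mem_ne hΩ hx (s := b₁))
    have h2 := h.sinAt_pos_of_mem hΩ (s := b₁) hx
    simp only at hb₁c
    rw [hb₁c] at h1
    by_contra! hlt
    linarith [pow_lt_one₀ h2.le (hlt.trans_le s8) two_ne_zero]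
  · refine hlarge _ (by linarith) (le_trans (le_of_eq ?_) w1)
    rw [hA']; field_simp

/-- On each branch of initial bounces along which the path passes from turning too little to turning
too much, its last link sweeps twice across the target. -/
theorem exists_two_connecting (h : IsBoundaryParametrization Ω ℓ γ)
    (hΩ : IsSmoothStrictlyConvexDomain Ω) {A : ℝ} (hA : 0 < A) :
    ∀ᶠ n : ℕ in atTop, ∀ e, e = 1 / ((n : ℝ) + 1) → ∀ (x y : Plane) (σ b b' : ℝ), x ∈ Ω → y ∈ Ω →
      ‖y - γ σ‖ ≤ e ^ 4 → |b - σ| ≤ A * e → |b' - σ| ≤ A * e →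
      impact ℓ γ x (n + 1) b ≤ σ + ℓ - e → σ + ℓ + e ≤ impact ℓ γ x n b' →
      ∃ c₁ c₂ : ℝ, 0 < c₁ ∧ c₁ < c₂ ∧ c₂ < 1 ∧
        IsConnecting ℓ γ n x y (fun k => impact ℓ γ x k (b + c₁ * (b' - b))) ∧
        IsConnecting ℓ γ n x y (fun k => impact ℓ γ x k (b + c₂ * (b' - b))) := by
  obtain ⟨κ₀, K, δ, B⟩ := h.exists_bounds
  have hℓ := h.length_pos
  obtain ⟨m, hm, M, hM, n₀, hgap⟩ := h.exists_gap_bounds hΩ B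
  have hside := h.exists_side (m := min (m / 2) 1) (M := M + 1) (by positivity) (by positivity)
  filter_upwards [eventually_ge_atTop n₀, tendsto_one_div_nat_succ.eventually
    ((hside.and (eventually_mul_le (A + M + 2) (by positivity : 0 < ℓ / 100))).and
    (eventually_pos_le one_pos))] with n hn hev
  intro e he x y σ b b' hx hy hyσ hb hb' h0 h1
  rw [← he] at hev
  obtain ⟨⟨hside, s1⟩, he0, he1⟩ := hev
  have hAe : 0 < A * e := by positivity
  have hMe : 0 < M * e := by positivity
  have hme : 0 < m * e := by positivity
  obtain ⟨m', hm'⟩ : ∃ m', m' = min (m / 2) 1 := ⟨_, rfl⟩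
  rw [← hm'] at hside
  have hm1 : m' * e ≤ m / 2 * e :=
    mul_le_mul_of_nonneg_right (hm' ▸ min_le_left _ _) he0.le
  have hm2 : m' * e ≤ 1 * e := mul_le_mul_of_nonneg_right (hm' ▸ min_le_right _ _) he0.le
  obtain ⟨β, hβ⟩ : ∃ β : ℝ → ℝ, β = fun c => b + c * (b' - b) := ⟨_, rfl⟩
  have hβc : Continuous β := by rw [hβ]; fun_prop
  have hβσ : ∀ c ∈ Icc (0 : ℝ) 1, |β c - σ| ≤ A * e := fun c hc => by
    rw [abs_le] at hb hb' ⊢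
    rw [hβ]
    constructor <;> simp only <;> nlinarith [hc.1, hc.2]
  obtain ⟨T, hT⟩ : ∃ T : ℕ → ℝ → ℝ, T = fun k c => impact ℓ γ x k (β c) := ⟨_, rfl⟩
  have hTc : ∀ k, Continuous (T k) := fun k => by
    rw [hT]; exact (h.continuous_impact hΩ hx k).comp hβc
  have hTs : ∀ c, IsBilliardSeq ℓ γ (fun k => T k c) (n + 1) := fun c => by
    rw [hT]; exact h.isBilliardSeq_impact hΩ hx (β c) (n + 1)
  have hT0 : ∀ c, T 0 c = β c := fun c => by rw [hT]; rfl
  have hlt : ∀ c, T n c < T (n + 1) c := fun c => (hTs c).lt_succ n (by lia)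
  -- the last gap, as long as the path has not turned too much
  have hgap' : ∀ c ∈ Icc (0 : ℝ) 1, T n c ≤ σ + ℓ + e → σ + ℓ - e ≤ T (n + 1) c →
      m * e ≤ T (n + 1) c - T n c ∧ T (n + 1) c - T n c ≤ M * e := fun c hc h1 h2 => by
    have hs := abs_le.1 (hβσ c hc)
    have := hgap _ n hn (hTs c) (by simp only [hT0]; linarith) n le_rfl
    rw [div_eq_mul_one_div, div_eq_mul_one_div m, ← he] at this
    exact ⟨this.2 (by simp only [hT0]; linarith), this.1⟩
  have hyσ' : ‖y - γ (σ + ℓ)‖ ≤ e ^ 4 := by rwa [h.periodic]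
  have hfin : ∀ c ∈ Icc (0 : ℝ) 1, cross (γ (T (n + 1) c) - γ (T n c)) (y - γ (T n c)) = 0 →
      T n c ≤ σ + ℓ + e → σ + ℓ - e ≤ T (n + 1) c → IsConnecting ℓ γ n x y (fun k => T k c) := by
    intro c hc h0 h1 h2
    obtain ⟨g1, g2⟩ := hgap' c hc h1 h2
    have hs := abs_le.1 (hβσ c hc)
    refine ⟨hTs c, ?_, h.mem_openSegment_of_cross_eq_zero hΩ hy
      (h.chord_ne (hlt c) ((hTs c).succ_lt n (by lia))) h0, ?_⟩
    · rw [hT]; exact h.cosAt_impact hΩ hx (β c)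
    · rw [abs_le, hT0]
      constructor <;> linarith
  obtain ⟨c₁, c₂, k1, k2, k3, ⟨k4, k5, k6⟩, k7, k8, k9⟩ := exists_two_zeros (hTc n) (hTc (n + 1))
    (H := fun c => cross (γ (T (n + 1) c) - γ (T n c)) (y - γ (T n c)))
    (((h.continuous.comp (hTc _)).sub (h.continuous.comp (hTc _))).cross
      (continuous_const.sub (h.continuous.comp (hTc _)))) hlt he0 (R := σ + ℓ)
    (by simpa [hT, hβ] using h0) (by simpa [hT, hβ] using h1)
    (by
      intro c hc h1 h2 h3
      obtain ⟨g1, g2⟩ := hgap' c hc h1 h2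
      exact (hside y (σ + ℓ) _ _ hyσ' (by linarith) (by linarith)).1 (by linarith) (by linarith))
    (by
      intro c hc h1
      obtain ⟨g1, g2⟩ := hgap' c hc h1.le (by linarith [hlt c])
      exact (hside y (σ + ℓ) _ _ hyσ' (by linarith) (by linarith)).2.1 (by linarith) (by linarith))
    (by
      intro c hc h1
      obtain ⟨g1, g2⟩ := hgap' c hc (by linarith [hlt c]) h1.ge
      exact (hside y (σ + ℓ) _ _ hyσ' (by linarith) (by linarith)).2.2 (by linarith) (by linarith))
  have f1 := hfin c₁ ⟨by linarith, by linarith⟩ k4 k5 k6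
  have f2 := hfin c₂ ⟨by linarith, by linarith⟩ k7 k8 k9
  rw [hT, hβ] at f1 f2
  exact ⟨c₁, c₂, k1, k2, k3, f1, f2⟩

theorem exists_four_connecting (h : IsBoundaryParametrization Ω ℓ γ)
    (hΩ : IsSmoothStrictlyConvexDomain Ω) :
    ∀ᶠ n : ℕ in atTop, ∀ e, e = 1 / ((n : ℝ) + 1) → ∀ (x y : Plane) (σ : ℝ), x ∈ Ω → y ∈ Ω →
      ‖x - γ σ‖ ≤ e ^ 4 → ‖y - γ σ‖ ≤ e ^ 4 → ∃ t : Fin 4 → ℕ → ℝ,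
        (∀ i, IsConnecting ℓ γ n x y (t i)) ∧ Function.Injective fun i => γ (t i 0) := by
  have hℓ := h.length_pos
  obtain ⟨A, hA, hr⟩ := h.exists_shooting_range hΩ
  filter_upwards [hr, h.exists_two_connecting hΩ hA, tendsto_one_div_nat_succ.eventually
    ((eventually_mul_le (4 * A) hℓ).and (eventually_pos_le one_pos))] with n hr h2 hev
  intro e he x y σ hx hy hxσ hyσ
  rw [← he] at hev
  obtain ⟨s1, he0, -⟩ := hev
  obtain ⟨b₀, b₁, b₂, q1, q2, q3, q4, q5, q6, q7⟩ := hr e he x σ hx hxσ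
  have hAe : 0 < A * e := by positivity
  have a0 : |b₀ - σ| ≤ A * e := by rw [abs_le]; constructor <;> linarith
  have a1 : |b₁ - σ| ≤ A * e := by rw [abs_le]; constructor <;> linarith
  have a2 : |b₂ - σ| ≤ A * e := by rw [abs_le]; constructor <;> linarith
  obtain ⟨c₁, c₂, k1, k2, k3, k4, k5⟩ := h2 e he x y σ b₀ b₁ hx hy hyσ a0 a1 q5 q6
  obtain ⟨d₁, d₂, l1, l2, l3, l4, l5⟩ := h2 e he x y σ b₀ b₂ hx hy hyσ a0 a2 q5 q7
  -- two first bounces on either branch, in increasing order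
  obtain ⟨β, hβ⟩ : ∃ β : Fin 4 → ℝ, β = ![b₀ + c₂ * (b₁ - b₀), b₀ + c₁ * (b₁ - b₀),
    b₀ + d₁ * (b₂ - b₀), b₀ + d₂ * (b₂ - b₀)] := ⟨_, rfl⟩
  have hmono : StrictMono β := by
    refine Fin.strictMono_iff_lt_succ.2 fun i => ?_
    rw [hβ]
    fin_cases i
    · simp; nlinarith
    · simp; nlinarith
    · simp; nlinarith
  have hrange : ∀ i, b₁ < β i ∧ β i < b₂ := by
    intro i
    rw [hβ]
    fin_cases i <;> simp <;> constructor <;> nlinarith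
  refine ⟨fun i k => impact ℓ γ x k (β i), fun i => ?_, fun i j hij => ?_⟩
  · rw [hβ]; fin_cases i
    exacts [k5, k4, l4, l5]
  · simp only [impact_zero] at hij
    by_contra hne
    have hi := hrange i
    have hj := hrange j
    rcases lt_or_gt_of_ne (hmono.injective.ne hne) with hlt | hlt
    · exact h.chord_ne hlt (by linarith) hij.symm
    · exact h.chord_ne hlt (by linarith) hij

end IsBoundaryParametrization

/-! ### Broken geodesics as connecting sequences -/

/-- The reflection law in terms of angles: the cosine changes its sign, and the sine does not, when
the incoming direction is replaced by the outgoing one, both seen from the point of reflection. -/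
theorem reflectsAt_iff {γ : ℝ → Plane} {s : ℝ} (hT : ‖deriv γ s‖ = 1) (a b : Plane) :
    ReflectsAt (deriv γ s) a (γ s) b ↔
      cosAt γ s b = -cosAt γ s a ∧ sinAt γ s b = sinAt γ s a := by
  obtain ⟨T, hTe⟩ : ∃ T, T = deriv γ s := ⟨_, rfl⟩
  rw [ReflectsAt, cosAt, cosAt, sinAt, sinAt, ← hTe]
  rw [← hTe] at hT
  obtain ⟨v, hv⟩ : ∃ v, v = ‖γ s - a‖⁻¹ • (γ s - a) := ⟨_, rfl⟩
  have hTT : inner ℝ T T = 1 := by rw [real_inner_self_eq_norm_sq, hT]; norm_num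
  have hr : (Submodule.span ℝ {T}).reflection v = (2 * inner ℝ T v) • T - v := by
    rw [Submodule.reflection_singleton_apply]
    simp [hT, two_smul, two_mul, add_smul]
  have e1 : inner ℝ T v = -(inner ℝ T (a - γ s) / ‖a - γ s‖) := by
    rw [hv, inner_smul_right, ← neg_sub a (γ s), norm_neg, inner_neg_right]; ring
  have e2 : cross T v = -(cross T (a - γ s) / ‖a - γ s‖) := by
    rw [hv, cross_smul_right, ← neg_sub a (γ s), norm_neg, cross_neg_right]; ring
  have f1 : inner ℝ T (‖b - γ s‖⁻¹ • (b - γ s)) = inner ℝ T (b - γ s) / ‖b - γ s‖ := by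
    rw [inner_smul_right]; ring
  have f2 : cross T (‖b - γ s‖⁻¹ • (b - γ s)) = cross T (b - γ s) / ‖b - γ s‖ := by
    rw [cross_smul_right]; ring
  have g1 : inner ℝ T ((2 * inner ℝ T v) • T - v) = inner ℝ T v := by
    rw [inner_sub_right, inner_smul_right, hTT]; ring
  have g2 : cross T ((2 * inner ℝ T v) • T - v) = -cross T v := by
    rw [cross_sub_right, cross_smul_right, plane_cross_self]; ring
  rw [← hv, hr]
  constructor
  · intro he
    rw [← f1, ← f2, he, g1, g2, e1, e2, neg_neg]
    exact ⟨rfl, rfl⟩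
  · rintro ⟨h1, h2⟩
    refine eq_of_inner_eq_of_cross_eq hT ?_ ?_
    · rw [f1, g1, e1, h1]
    · rw [f2, g2, e2, neg_neg, h2]

/-- The vertices `x, γ (t 0), …, γ (t n), y` of a broken geodesic. -/
def pathVertex (γ : ℝ → Plane) (n : ℕ) (x y : Plane) (t : ℕ → ℝ) : ℕ → Plane
  | 0 => x
  | k + 1 => if k ≤ n then γ (t k) else y

/-- A set with four distinct elements which are told apart by two yes-or-no questions has exactly
four elements. -/
theorem encard_eq_four {α : Type*} {O : Set α} {f : Fin 4 → α} (hf : Function.Injective f)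
    (hfO : ∀ i, f i ∈ O) {g : α → Prop × Prop} (hg : InjOn g O) : O.encard = 4 := by
  refine le_antisymm ?_ ?_
  · have := encard_le_encard_of_injOn (mapsTo_univ g O) hg
    rw [encard_univ, ENat.card_eq_coe_fintype_card] at this
    simpa using this
  · have := hf.encard_range.trans (encard_le_encard (range_subset_iff.2 hfO))
    rw [ENat.card_eq_coe_fintype_card] at this
    simpa using this

namespace IsBoundaryParametrization

variable {Ω : Set Plane} {ℓ : ℝ} {γ : ℝ → Plane} {κ₀ K δ : ℝ} {s : ℝ → ℝ}

theorem deriv_eq_of_eq (h : IsBoundaryParametrization Ω ℓ γ) {s t : ℝ} (hst : γ s = γ t) :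
    deriv γ s = deriv γ t := by
  obtain ⟨k, rfl⟩ := (h.eq_iff s t).1 hst
  exact ((periodic_deriv h.periodic).int_mul k s).symm

/-- Connecting sequences yield broken geodesics. -/
theorem pathVertex_mem (h : IsBoundaryParametrization Ω ℓ γ)
    (hΩ : IsSmoothStrictlyConvexDomain Ω) {n : ℕ} {x y : Plane} (hx : x ∈ Ω) (hy : y ∈ Ω)
    {t : ℕ → ℝ} (ht : IsConnecting ℓ γ n x y t) :
    (fun i : Fin (n + 1 + 2) => pathVertex γ n x y t i) ∈
      counterclockwiseOrbits Ω ℓ γ (n + 1) x y := by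
  have hne : ∀ k ≤ n, γ (t (k + 1)) ≠ γ (t k) := fun k hk =>
    h.chord_ne (ht.seq.lt_succ k (by lia)) (ht.seq.succ_lt k (by lia))
  have v0 : pathVertex γ n x y t 0 = x := rfl
  have v1 : ∀ k ≤ n, pathVertex γ n x y t (k + 1) = γ (t k) := fun k hk => if_pos hk
  have v2 : pathVertex γ n x y t (n + 2) = y := if_neg (by lia)
  refine ⟨⟨rfl, v2, fun k => ?_, fun k => ?_⟩, fun i => t i, fun k => ?_, ?_, fun k => ?_, ?_⟩
  · obtain ⟨k, hk⟩ := k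
    simp only [Fin.castSucc_mk, Fin.succ_mk]
    rcases k with _ | k
    · rw [v0, v1 0 (by lia)]
      exact h.openSegment_subset_of_mem hΩ hx
    · rw [v1 k (by lia)]
      rcases (by lia : k < n ∨ k = n) with hkn | rfl
      · rw [v1 (k + 1) (by lia)]
        exact h.openSegment_subset hΩ (hne k hkn.le)
      · rw [v2, openSegment_symm]
        exact h.openSegment_subset_of_mem hΩ hy
  · obtain ⟨k, hk⟩ := k
    simp only [Fin.castSucc_mk, Fin.succ_mk]
    rw [v1 k (by lia)]
    refine ⟨t k, rfl, (reflectsAt_iff (h.unit_speed _) _ _).2 ?_⟩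
    have out : cosAt γ (t k) (pathVertex γ n x y t (k + 2)) = cosAt γ (t k) (γ (t (k + 1))) ∧
        sinAt γ (t k) (pathVertex γ n x y t (k + 2)) = sinAt γ (t k) (γ (t (k + 1))) := by
      rcases (by lia : k < n ∨ k = n) with hkn | rfl
      · rw [v1 (k + 1) (by lia)]; exact ⟨rfl, rfl⟩
      · rw [v2]; exact cosAt_sinAt_eq_of_mem_openSegment ht.last
    have hk' : k ≤ n := by lia
    obtain ⟨hc, hv, hs⟩ : cosAt γ (t k) (γ (t (k + 1))) =
        -cosAt γ (t k) (pathVertex γ n x y t k) ∧ pathVertex γ n x y t k ≠ γ (t k) ∧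
        0 < sinAt γ (t k) (pathVertex γ n x y t k) := by
      rcases k with _ | k
      · exact ⟨ht.first, h.mem_ne hΩ hx, h.sinAt_pos_of_mem hΩ hx⟩
      · rw [v1 k (by lia)]
        have hne' := (hne k (by lia)).symm
        exact ⟨ht.seq.reflect k (by lia), hne', h.sinAt_pos hΩ hne'⟩
    rw [out.1, out.2]
    exact ⟨hc, sin_eq_of_cos_eq_neg (h.cosAt_sq_add_sinAt_sq (hne k hk'))
      (h.cosAt_sq_add_sinAt_sq hv) (h.sinAt_pos hΩ (hne k hk')) hs hc⟩
  · obtain ⟨k, hk⟩ := k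
    simp only [Fin.castSucc_mk, Fin.succ_mk]
    rw [v1 k (by lia)]
  · have := ht.last
    rw [← v2, ← v1 n le_rfl] at this
    exact this
  · obtain ⟨k, hk⟩ := k
    simp only [Fin.castSucc_mk, Fin.succ_mk]
    exact ⟨sub_pos.2 (ht.seq.lt_succ k hk), by linarith [ht.seq.succ_lt k hk]⟩
  · exact ht.total

/-- Broken geodesics come from connecting sequences. -/
theorem exists_isConnecting (h : IsBoundaryParametrization Ω ℓ γ) {n : ℕ} {x y : Plane}
    {p : Fin (n + 1 + 2) → Plane} (hp : p ∈ counterclockwiseOrbits Ω ℓ γ (n + 1) x y) :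
    ∃ t, IsConnecting ℓ γ n x y t ∧ p = fun i : Fin (n + 1 + 2) => pathVertex γ n x y t i := by
  obtain ⟨⟨hx, hy, -, hrefl⟩, s, hs, hlast, hgap, htot⟩ := hp
  obtain ⟨t, ht⟩ : ∃ t : ℕ → ℝ, ∀ k (hk : k < n + 1 + 1), t k = s ⟨k, hk⟩ :=
    ⟨fun k => if hk : k < n + 1 + 1 then s ⟨k, hk⟩ else 0, fun k hk => dif_pos hk⟩
  have hv : p = fun i : Fin (n + 1 + 2) => pathVertex γ n x y t i := by
    funext i
    obtain ⟨k, hk⟩ := i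
    rcases k with _ | k
    · exact hx
    · rcases (by lia : k ≤ n ∨ k = n + 1) with hkn | rfl
      · simp only [pathVertex, if_pos hkn]
        rw [ht k (by lia)]
        exact (hs ⟨k, by lia⟩).symm
      · simp only [pathVertex]
        rw [if_neg (by lia)]
        exact hy
  refine ⟨t, ?_, hv⟩
  have v0 : pathVertex γ n x y t 0 = x := rfl
  have v1 : ∀ k ≤ n, pathVertex γ n x y t (k + 1) = γ (t k) := fun k hk => if_pos hk
  have v2 : pathVertex γ n x y t (n + 2) = y := if_neg (by lia)
  have hl : y ∈ openSegment ℝ (γ (t n)) (γ (t (n + 1))) := by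
    rw [← v2, ← v1 n le_rfl, ht (n + 1) (by lia)]
    rw [hv] at hlast
    exact hlast
  have hr : ∀ k ≤ n, cosAt γ (t k) (γ (t (k + 1))) = -cosAt γ (t k) (pathVertex γ n x y t k) := by
    intro k hk
    obtain ⟨τ, h1, h2⟩ := hrefl ⟨k, by lia⟩
    rw [hv] at h1 h2
    simp only [Fin.castSucc_mk, Fin.succ_mk] at h1 h2
    rw [v1 k hk] at h1 h2
    rw [h.deriv_eq_of_eq h1, reflectsAt_iff (h.unit_speed _)] at h2
    rw [← h2.1]
    rcases (by lia : k < n ∨ k = n) with hkn | rfl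
    · rw [v1 (k + 1) (by lia)]
    · rw [v2]; exact (cosAt_sinAt_eq_of_mem_openSegment hl).1.symm
  have hg : ∀ k < n + 1, 0 < t (k + 1) - t k ∧ t (k + 1) - t k < ℓ := fun k hk => by
    have := hgap ⟨k, hk⟩
    rw [ht k (by lia), ht (k + 1) (by lia)]
    exact this
  refine ⟨⟨fun k hk => by linarith [(hg k hk).1], fun k hk => by linarith [(hg k hk).2],
    fun k hk => ?_⟩, hr 0 (by lia), hl, ?_⟩
  · rw [← v1 k (by lia)]
    exact hr (k + 1) (by lia)
  · rw [ht 0 (by lia), ht (n + 1) (by lia)]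
    exact htot

/-- The count for one orientation. -/
theorem eventually_encard_eq_four (h : IsBoundaryParametrization Ω ℓ γ)
    (hΩ : IsSmoothStrictlyConvexDomain Ω) : ∀ᶠ n : ℕ in atTop, ∀ x ∈ Ω, ∀ y ∈ Ω,
      NearBoundaryDiagonal Ω (1 / ((n : ℝ) + 1) ^ 4) x y →
        (counterclockwiseOrbits Ω ℓ γ (n + 1) x y).encard = 4 := by
  obtain ⟨ϑ, hu⟩ := h.exists_connecting_unique hΩ
  filter_upwards [hu, h.exists_four_connecting hΩ] with n hu h4
  rintro x hx y hy ⟨q, hq, hd⟩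
  rw [← h.range_eq] at hq
  obtain ⟨σ, rfl⟩ := hq
  obtain ⟨e, he⟩ : ∃ e, e = 1 / ((n : ℝ) + 1) := ⟨_, rfl⟩
  rw [← one_div_pow, ← he] at hd
  have hxσ : ‖x - γ σ‖ ≤ e ^ 4 := by
    rw [← dist_eq_norm]
    exact (Real.le_sqrt_of_sq_le (by linarith [sq_nonneg (dist y (γ σ))])).trans hd
  have hyσ : ‖y - γ σ‖ ≤ e ^ 4 := by
    rw [← dist_eq_norm]
    exact (Real.le_sqrt_of_sq_le (by linarith [sq_nonneg (dist x (γ σ))])).trans hd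
  obtain ⟨t, ht, hinj⟩ := h4 e he x y σ hx hy hxσ hyσ
  -- the two questions are whether the first and the last link are short
  refine encard_eq_four (f := fun i (k : Fin (n + 1 + 2)) => pathVertex γ n x y (t i) k)
    (g := fun p => (‖x - p 1‖ ≤ ϑ * e, ‖y - p (Fin.last (n + 1)).castSucc‖ ≤ ϑ * e))
    (fun i j hij => hinj ?_) (fun i => h.pathVertex_mem hΩ hx hy (ht i)) ?_
  · have := congrFun hij 1
    simpa [pathVertex] using this
  · intro p hp p' hp' hpp
    obtain ⟨τ, hτ, rfl⟩ := h.exists_isConnecting hp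
    obtain ⟨τ', hτ', rfl⟩ := h.exists_isConnecting hp'
    simp only [Prod.mk.injEq, Fin.val_one, Fin.val_castSucc, Fin.val_last, pathVertex,
      eq_iff_iff, zero_le, le_refl, if_true] at hpp
    have hk := hu e he x y σ τ τ' hx hy hxσ hyσ hτ hτ' hpp.1 hpp.2
    funext i
    obtain ⟨k, hkn⟩ := i
    rcases k with _ | k
    · rfl
    · simp only [pathVertex]
      split_ifs with hle
      · exact hk k hle
      · rfl

end IsBoundaryParametrization

/-! ### Change of parametrization and of orientation -/

theorem approxOneRotation_comp_add (ℓ : ℝ) (γ : ℝ → Plane) (a : ℝ) (j : ℕ)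
    (p : Fin (j + 2) → Plane) :
    ApproxOneRotation ℓ (fun t => γ (t + a)) j p ↔ ApproxOneRotation ℓ γ j p := by
  constructor
  · rintro ⟨s, h1, h2, h3, h4⟩
    refine ⟨fun k => s k + a, h1, h2, fun k => ?_, ?_⟩
    · have := h3 k; simpa using this
    · simpa using h4
  · rintro ⟨s, h1, h2, h3, h4⟩
    refine ⟨fun k => s k - a, fun k => ?_, ?_, fun k => ?_, ?_⟩
    · simpa using h1 k
    · simpa using h2
    · have := h3 k; simpa using this
    · simpa using h4

theorem isBrokenGeodesic_comp_add (Ω : Set Plane) (γ : ℝ → Plane) (a : ℝ) (j : ℕ) (x y : Plane)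
    (p : Fin (j + 2) → Plane) :
    IsBrokenGeodesic Ω (fun t => γ (t + a)) j x y p ↔ IsBrokenGeodesic Ω γ j x y p := by
  have hd : ∀ t, deriv (fun t => γ (t + a)) t = deriv γ (t + a) := fun t =>
    deriv_comp_add_const γ a t
  constructor
  · rintro ⟨h1, h2, h3, h4⟩
    refine ⟨h1, h2, h3, fun k => ?_⟩
    obtain ⟨t, ht, hr⟩ := h4 k
    exact ⟨t + a, ht, by rwa [hd] at hr⟩
  · rintro ⟨h1, h2, h3, h4⟩
    refine ⟨h1, h2, h3, fun k => ?_⟩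
    obtain ⟨t, ht, hr⟩ := h4 k
    exact ⟨t - a, by simpa using ht, by rwa [hd, sub_add_cancel]⟩

/-- The reflection of the plane in the horizontal axis. -/
noncomputable def mirror : Plane ≃ₗᵢ[ℝ] Plane :=
  LinearIsometryEquiv.piLpCongrRight 2 fun i : Fin 2 =>
    if i = 0 then LinearIsometryEquiv.refl ℝ ℝ else LinearIsometryEquiv.neg ℝ

theorem cross_mirror (u v : Plane) : cross (mirror u) (mirror v) = -cross u v := by
  simp [cross, mirror]; ring

theorem reflectsAt_mirror (T a p b : Plane) :
    ReflectsAt (-mirror T) (mirror a) (mirror p) (mirror b) ↔ ReflectsAt T a p b := by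
  have hs : Submodule.span ℝ {-mirror T} =
      (Submodule.span ℝ {T}).map (mirror.toLinearEquiv : Plane →ₗ[ℝ] Plane) := by
    rw [Submodule.map_span, image_singleton, ← Submodule.span_neg, neg_singleton, neg_neg]; rfl
  have hr : ∀ v, (Submodule.span ℝ {-mirror T}).reflection (mirror v) =
      mirror ((Submodule.span ℝ {T}).reflection v) := fun v => by
    simp only [hs, Submodule.reflection_map_apply, LinearIsometryEquiv.symm_apply_apply]
  rw [ReflectsAt, ReflectsAt, ← map_sub, ← map_sub, LinearIsometryEquiv.norm_map,
    LinearIsometryEquiv.norm_map, ← map_smul, ← map_smul, hr, mirror.injective.eq_iff]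

theorem mirror_image_openSegment (a b : Plane) :
    mirror '' openSegment ℝ a b = openSegment ℝ (mirror a) (mirror b) :=
  image_openSegment ℝ (mirror.toLinearEquiv : Plane →ₗ[ℝ] Plane).toAffineMap a b

namespace IsBoundaryParametrization

variable {Ω : Set Plane} {ℓ ℓ' : ℝ} {γ γ' : ℝ → Plane} {κ₀ K δ : ℝ} {s : ℝ → ℝ}

/-- The unit tangent at a boundary point does not depend on the parametrization: the domain lies to
its left. -/
theorem deriv_eq_of_eq' (h : IsBoundaryParametrization Ω ℓ γ)
    (h' : IsBoundaryParametrization Ω ℓ' γ') (hΩ : IsSmoothStrictlyConvexDomain Ω) {s t : ℝ}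
    (hst : γ s = γ' t) : deriv γ s = deriv γ' t := by
  have hd : HasDerivAt (fun r => cross (deriv γ s) (γ' r - γ s))
      (cross 0 (γ' t - γ s) + cross (deriv γ s) (deriv γ' t)) t :=
    (hasDerivAt_const t (deriv γ s)).cross ((h'.hasDerivAt t).sub_const (γ s))
  have hmin : IsLocalMin (fun r => cross (deriv γ s) (γ' r - γ s)) t :=
    Eventually.of_forall fun r => by
      simp only [hst, sub_self, cross_zero_right]
      rw [← hst]
      exact h.cross_nonneg hΩ s (h'.mem_closure r)
  have h0 := hmin.hasDerivAt_eq_zero hd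
  rw [show cross 0 (γ' t - γ s) = 0 by simp [cross], zero_add] at h0
  have hne : Ω.Nonempty := by
    rw [nonempty_iff_ne_empty]
    rintro rfl
    simpa using h.mem_frontier 0
  obtain ⟨z, hz⟩ := hne
  have p1 := h.cross_pos_of_mem hΩ s hz
  have p2 := h'.cross_pos_of_mem hΩ t hz
  have e := eq_inner_smul_add_cross_smul (h.unit_speed s) (deriv γ' t)
  rw [h0, zero_smul, add_zero] at e
  rw [e, cross_smul_left, ← hst] at p2
  have hpos := pos_of_mul_pos_left p2 p1.le
  have hn := congrArg norm e
  rw [norm_smul, h.unit_speed, h'.unit_speed, mul_one, Real.norm_eq_abs, abs_of_pos hpos] at hn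
  rw [e, ← hn, one_smul]

/-- Any two counterclockwise arclength parametrizations of the boundary differ by a translation, as
both solve the same differential equation. -/
theorem exists_eq_comp_add (h : IsBoundaryParametrization Ω ℓ γ)
    (h' : IsBoundaryParametrization Ω ℓ' γ') (hΩ : IsSmoothStrictlyConvexDomain Ω) :
    ℓ' = ℓ ∧ ∃ a, γ' = fun t => γ (t + a) := by
  obtain ⟨κ₀, K, δ, B⟩ := h.exists_bounds
  have hK := B.K_pos
  obtain ⟨m, hm, hca⟩ := h.exists_chord_arc B
  obtain ⟨V, hV⟩ : ∃ V : Plane → Plane, ∀ t, V (γ t) = deriv γ t :=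
    ⟨fun z => deriv γ (Function.invFun γ z), fun t =>
      h.deriv_eq_of_eq (Function.invFun_eq ⟨t, rfl⟩)⟩
  have hL : LipschitzOnWith (Real.toNNReal (max (2 * K) (2 / m))) V (range γ) := by
    refine LipschitzOnWith.of_dist_le_mul ?_
    rintro _ ⟨t, rfl⟩ _ ⟨s, rfl⟩
    rw [hV, hV, dist_eq_norm, dist_eq_norm, Real.coe_toNNReal _ (by positivity)]
    rcases lt_or_ge ‖γ t - γ s‖ m with hlt | hge
    · obtain ⟨k, hk⟩ := hca s t hlt
      have h1 := h.norm_tangent_sub_le B s (t - k * ℓ)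
      rw [h.deriv_eq_of_eq (h.sub_int_mul t k), show t - k * ℓ - s = t - s - k * ℓ by ring] at h1
      have h2 := mul_le_mul_of_nonneg_left hk hK.le
      have h3 := mul_le_mul_of_nonneg_right (le_max_left (2 * K) (2 / m)) (norm_nonneg (γ t - γ s))
      linarith
    · have h1 := _root_.norm_sub_le (deriv γ t) (deriv γ s)
      rw [h.unit_speed, h.unit_speed] at h1
      have h3 := mul_le_mul_of_nonneg_right (le_max_right (2 * K) (2 / m))
        (norm_nonneg (γ t - γ s))
      have h4 : 2 / m * m ≤ 2 / m * ‖γ t - γ s‖ := mul_le_mul_of_nonneg_left hge (by positivity)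
      rw [div_mul_cancel₀ _ hm.ne'] at h4
      linarith
  have hmem : ∀ t, γ' t ∈ range γ := fun t => by rw [h.range_eq]; exact h'.mem_frontier t
  obtain ⟨a, ha⟩ := hmem 0
  have heq : γ' = fun t => γ (t + a) := by
    refine ODE_solution_unique_univ (v := fun _ => V) (s := fun _ => range γ) (t₀ := 0)
      (fun _ => hL) (fun t => ⟨?_, hmem t⟩) (fun t => ⟨?_, mem_range_self _⟩) ?_
    · obtain ⟨s, hs⟩ := hmem t
      rw [← hs, hV, h.deriv_eq_of_eq' h' hΩ hs]
      exact h'.hasDerivAt t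
    · rw [hV]
      exact (h.hasDerivAt (t + a)).comp_add_const t a
    · simpa using ha.symm
  refine ⟨?_, a, heq⟩
  have hℓ := h.length_pos
  have hℓ' := h'.length_pos
  have e1 : γ a = γ (ℓ' + a) := by
    have := h'.periodic 0
    rw [heq] at this
    simpa using this.symm
  have e2 : γ' 0 = γ' ℓ := by
    rw [heq]
    have := h.periodic a
    simp only [zero_add]
    rw [add_comm ℓ a, this]
  obtain ⟨k, hk⟩ := (h.eq_iff _ _).1 e1
  obtain ⟨k', hk'⟩ := (h'.eq_iff _ _).1 e2
  have k1 : ℓ' = k * ℓ := by linarith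
  have k2 : ℓ = k' * ℓ' := by linarith
  have p1 : 1 ≤ k := by
    have : (0 : ℝ) < k := by
      by_contra! hc
      nlinarith
    exact_mod_cast this
  have p2 : 1 ≤ k' := by
    have : (0 : ℝ) < k' := by
      by_contra! hc
      nlinarith
    exact_mod_cast this
  have p1' : (1 : ℝ) ≤ k := by exact_mod_cast p1
  have p2' : (1 : ℝ) ≤ k' := by exact_mod_cast p2
  exact le_antisymm (by nlinarith) (by nlinarith)

theorem counterclockwiseOrbits_eq (h : IsBoundaryParametrization Ω ℓ γ)
    (h' : IsBoundaryParametrization Ω ℓ' γ') (hΩ : IsSmoothStrictlyConvexDomain Ω) (j : ℕ)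
    (x y : Plane) :
    counterclockwiseOrbits Ω ℓ' γ' j x y = counterclockwiseOrbits Ω ℓ γ j x y := by
  obtain ⟨rfl, a, rfl⟩ := h.exists_eq_comp_add h' hΩ
  ext p
  simp only [counterclockwiseOrbits, mem_ofPred_eq, isBrokenGeodesic_comp_add,
    approxOneRotation_comp_add]

theorem clockwiseOrbits_eq (h : IsBoundaryParametrization Ω ℓ γ)
    (h' : IsBoundaryParametrization Ω ℓ' γ') (hΩ : IsSmoothStrictlyConvexDomain Ω) (j : ℕ)
    (x y : Plane) : clockwiseOrbits Ω ℓ' γ' j x y = clockwiseOrbits Ω ℓ γ j x y := by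
  obtain ⟨rfl, a, rfl⟩ := h.exists_eq_comp_add h' hΩ
  ext p
  have : (fun t => γ (-t + a)) = fun t => (fun r => γ (-r)) (t + -a) := by
    funext t; simp only; congr 1; ring
  simp only [clockwiseOrbits, mem_ofPred_eq, isBrokenGeodesic_comp_add]
  rw [this, approxOneRotation_comp_add ℓ' (fun r => γ (-r))]

theorem _root_.HasDerivAt.mirror_comp_neg {f : ℝ → Plane} {f' : Plane} {t : ℝ}
    (hf : HasDerivAt f f' (-t)) : HasDerivAt (fun t => mirror (f (-t))) (-mirror f') t := by
  have h1 : HasDerivAt (fun t => f (-t)) (-f') t :=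
    (hf.scomp t (hasDerivAt_neg t)).congr_deriv (by simp)
  exact (mirror.toContinuousLinearEquiv.toContinuousLinearMap.hasFDerivAt.comp_hasDerivAt t
    h1).congr_deriv (by simp)

theorem hasDerivAt_mirror (h : IsBoundaryParametrization Ω ℓ γ) (t : ℝ) :
    HasDerivAt (fun t => mirror (γ (-t))) (-mirror (deriv γ (-t))) t :=
  (h.hasDerivAt (-t)).mirror_comp_neg

/-- A reflection reverses the orientation, and reversal of time restores it. -/
theorem mirror_parametrization (h : IsBoundaryParametrization Ω ℓ γ) :
    IsBoundaryParametrization (mirror '' Ω) ℓ (fun t => mirror (γ (-t))) where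
  length_pos := h.length_pos
  smooth := mirror.toContinuousLinearEquiv.contDiff.comp (h.smooth.comp contDiff_neg)
  unit_speed t := by
    rw [(h.hasDerivAt_mirror t).deriv, norm_neg, LinearIsometryEquiv.norm_map, h.unit_speed]
  eq_iff s t := by
    rw [mirror.injective.eq_iff, h.eq_iff]
    constructor
    · rintro ⟨k, hk⟩
      exact ⟨-k, by push_cast; linarith⟩
    · rintro ⟨k, hk⟩
      exact ⟨-k, by push_cast; linarith⟩
  range_eq := by
    have h1 : range (fun t => mirror (γ (-t))) = mirror '' range γ := by
      rw [← range_comp]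
      exact (Equiv.neg ℝ).surjective.range_comp (mirror ∘ γ)
    rw [h1, h.range_eq]
    exact mirror.toHomeomorph.image_frontier Ω
  curvature_pos t := by
    have h1 : deriv (fun t => mirror (γ (-t))) = fun t => -mirror (deriv γ (-t)) :=
      funext fun t => (h.hasDerivAt_mirror t).deriv
    have h2 : HasDerivAt (fun t => -mirror (deriv γ (-t))) (mirror (deriv (deriv γ) (-t))) t :=
      (h.hasDerivAt2 (-t)).mirror_comp_neg.neg.congr_deriv (neg_neg _)
    rw [h1, h2.deriv, cross_swap, cross_neg_right, cross_mirror, cross_swap]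
    simpa using h.curvature_pos (-t)

/-- The mirror image of a clockwise path is a counterclockwise one. -/
theorem mem_clockwiseOrbits_iff (h : IsBoundaryParametrization Ω ℓ γ) (j : ℕ) (x y : Plane)
    (p : Fin (j + 2) → Plane) :
    mirror ∘ p ∈ counterclockwiseOrbits (mirror '' Ω) ℓ (fun t => mirror (γ (-t))) j (mirror x)
      (mirror y) ↔ p ∈ clockwiseOrbits Ω ℓ γ j x y := by
  have hd := fun t => (h.hasDerivAt_mirror t).deriv
  have hinj := mirror.injective
  refine and_congr ⟨?_, ?_⟩ ?_
  · rintro ⟨h1, h2, h3, h4⟩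
    refine ⟨hinj h1, hinj h2, fun k => ?_, fun k => ?_⟩
    · have := h3 k
      rw [Function.comp, Function.comp, ← mirror_image_openSegment] at this
      exact (image_subset_image_iff hinj).1 this
    · obtain ⟨t, ht, hr⟩ := h4 k
      rw [hd] at hr
      exact ⟨-t, hinj ht, (reflectsAt_mirror _ _ _ _).1 hr⟩
  · rintro ⟨h1, h2, h3, h4⟩
    refine ⟨congrArg mirror h1, congrArg mirror h2, fun k => ?_, fun k => ?_⟩
    · rw [Function.comp, Function.comp, ← mirror_image_openSegment]
      exact image_mono (h3 k)
    · obtain ⟨t, ht, hr⟩ := h4 k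
      refine ⟨-t, ?_, ?_⟩
      · simp only [neg_neg, Function.comp, ht]
      · rw [hd, neg_neg]
        exact (reflectsAt_mirror _ _ _ _).2 hr
  · refine exists_congr fun s => and_congr ?_ (and_congr ?_ Iff.rfl)
    · exact forall_congr' fun k => hinj.eq_iff
    · rw [Function.comp, Function.comp, ← mirror_image_openSegment]
      exact hinj.mem_set_image

end IsBoundaryParametrization

theorem IsSmoothStrictlyConvexDomain.mirror_image {Ω : Set Plane}
    (hΩ : IsSmoothStrictlyConvexDomain Ω) : IsSmoothStrictlyConvexDomain (mirror '' Ω) where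
  isOpen := mirror.toHomeomorph.isOpenMap _ hΩ.isOpen
  convex := hΩ.convex.linear_image (mirror.toLinearEquiv : Plane →ₗ[ℝ] Plane)
  bounded := mirror.lipschitz.isBounded_image hΩ.bounded
  smooth_boundary := by
    obtain ⟨ℓ, γ, h⟩ := hΩ.smooth_boundary
    exact ⟨ℓ, _, h.mirror_parametrization⟩

theorem NearBoundaryDiagonal.mirror_image {Ω : Set Plane} {r : ℝ} {x y : Plane}
    (h : NearBoundaryDiagonal Ω r x y) :
    NearBoundaryDiagonal (mirror '' Ω) r (mirror x) (mirror y) := by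
  obtain ⟨q, hq, hd⟩ := h
  refine ⟨mirror q, ?_, by rwa [LinearIsometryEquiv.dist_map, LinearIsometryEquiv.dist_map]⟩
  have := mirror.toHomeomorph.image_frontier Ω
  exact this ▸ mem_image_of_mem _ hq

theorem theorem3p1 :
    ∃ C₀ : ℝ, 0 < C₀ ∧
      ∀ Ω : Set Plane, IsSmoothStrictlyConvexDomain Ω →
        ∃ j₀ : ℕ, ∀ j : ℕ, j₀ ≤ j →
          ∀ (ℓ : ℝ) (γ : ℝ → Plane), IsBoundaryParametrization Ω ℓ γ →
            ∀ x ∈ Ω, ∀ y ∈ Ω, NearBoundaryDiagonal Ω (C₀ / (j : ℝ) ^ 4) x y →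
              (counterclockwiseOrbits Ω ℓ γ j x y).encard = 4 ∧
              (clockwiseOrbits Ω ℓ γ j x y).encard = 4 := by
  refine ⟨1, one_pos, fun Ω hΩ => ?_⟩
  obtain ⟨ℓ₀, γ₀, h₀⟩ := hΩ.smooth_boundary
  obtain ⟨n₀, hn₀⟩ := eventually_atTop.1 ((h₀.eventually_encard_eq_four hΩ).and
    (h₀.mirror_parametrization.eventually_encard_eq_four hΩ.mirror_image))
  refine ⟨n₀ + 1, fun j hj ℓ γ h x hx y hy hxy => ?_⟩
  obtain ⟨n, rfl⟩ : ∃ n, j = n + 1 := ⟨j - 1, by lia⟩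
  obtain ⟨h1, h2⟩ := hn₀ n (by lia)
  push_cast at hxy
  rw [h₀.counterclockwiseOrbits_eq h hΩ, h₀.clockwiseOrbits_eq h hΩ]
  refine ⟨h1 x hx y hy hxy, ?_⟩
  have hbij : Function.Bijective fun p : Fin (n + 1 + 2) → Plane => mirror ∘ p :=
    ⟨mirror.injective.comp_left, mirror.surjective.comp_left⟩
  have h3 := encard_preimage_of_bijective hbij (counterclockwiseOrbits (mirror '' Ω) ℓ₀
    (fun t => mirror (γ₀ (-t))) (n + 1) (mirror x) (mirror y))
  rw [h2 _ (mem_image_of_mem _ hx) _ (mem_image_of_mem _ hy) hxy.mirror_image] at h3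
  rw [← h3]
  congr 1
  ext p
  exact (h₀.mem_clockwiseOrbits_iff (n + 1) x y p).symm
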